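/- **Setting.** Let $P\ge 1$, let $c_1,\dots,c_P$ be negative imaginary numbers, and let $z_1,\dots,z_P$ satisfy $\operatorname{Im} z_p>0$ and $\operatorname{Re} z_1<\dots<\operatorname{Re} z_P$. Put $$u_0(z)=\sum_{p=1}^P\Big(\frac{c_p}{z-z_p}+\frac{c_p^*}{z-z_p^*}\Big),$$ and suppose that $u_0|_{\mathbb R}$ is integrable and positive and that it is of Klaus–Shaw type: there is $x_c\in\mathbb R$ such that $u_0$ is strictly monotone on $(-\infty,x_c)$ and on $(x_c,\infty)$, and $x_c$ is the only real critical point of $u_0$. For $\lambda<0$ put $h(z;\lambda)=\lambda z+f(z)$, where $$f(z)=\sum_{p=1}^P \Big( c_p\big(\mathrm{Log}(i(z-z_p))+\tfrac{\pi i}{2}\big)+c_p^*\big(\mathrm{Log}(-i(z-z_p^*))-\tfrac{\pi i}{2}\big)\Big)$$ with principal logarithms. Thus $f'=u_0$, and $f$ is analytic off the vertical branch cuts going up from the $z_p$ and down from the $z_p^*$. The critical points of $h(\cdot;\lambda)$ are the zeros of the rational function $h'(z;\lambda)=\lambda+u_0(z)$; such a point is simple if $u_0'\ne0$ there. Put $R(z)=\operatorname{Re}\{-ih(z;\lambda)\}$,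 which is single-valued on $\mathbb C\setminus\{z_p,z_p^*\}$. All contours below are piecewise $C^1$ curves that begin and end at $i\infty$ with vertical tails. For $m=1,\dots,P$ let $C_m$ be such a contour in the domain of analyticity of $f$, beginning at $i\infty$ to the left of $\operatorname{Re}z=\operatorname{Re}z_1$ and ending at $i\infty$ to the right of $\operatorname{Re}z=\operatorname{Re}z_m$ and, if $m<P$, to the left of $\operatorname{Re}z=\operatorname{Re}z_{m+1}$. For $\epsilon>0$ let $\mathbf A(\lambda)$ be the $P\times P$ matrix with entries $$A_{mp}(\lambda)=\int_{C_m}\frac{e^{-ih(z;\lambda)/\epsilon}}{z-z_p}\,dz .$$ A contour *passes over* a nonempty set $S$ of critical points of $h(\cdot;\lambda)$ if the critical points lying on it are exactly the elements of $S$, each of them is traversed exactly once and with nonzero velocity, and at all other points of the contour $R$ is strictly smaller than at each point of $S$. **Statement.** Let $\lambda<0$ be such that the critical points of $h(\cdot;\lambda)$ in the open upper half-plane are all simple and correspond to distinct nonzero values of $R$. If $\lambda=-u_0(x_c)=-\max_{\mathbb R} u_0$, suppose also that $u_0''(x_c)\neq0$. Then there are an index $Q$, contours $W_1,\dots,W_P$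 that avoid all $z_p,z_p^*$, and on each $W_m$ a branch of $h(\cdot;\lambda)$ continued analytically along $W_m$, all independent of $\epsilon$, such that: 1. for $m\ne Q$, $W_m$ passes over exactly one critical point of $h(\cdot;\lambda)$, and that point lies in the open upper half-plane; 2. $W_Q$ passes either over exactly one critical point in the open upper half-plane, or over exactly the real critical points of $h(\cdot;\lambda)$; in the second case these are at most two in number ($x_\pm(\lambda)$) and $R=0$ at each of them; 3. different contours pass over different critical points; 4. for every $\epsilon>0$ the integrals $$\tilde A_{mp}(\lambda)=\int_{W_m}\frac{e^{-ih(z;\lambda)/\epsilon}}{z-z_p}\,dz ,$$ taken with the chosen branch of $h$ on $W_m$, converge absolutely, and there is an invertible matrix $\mathbf N\in\mathbb C^{P\times P}$, which may depend on $\epsilon$, with $\mathbf N\mathbf A(\lambda)=\tilde{\mathbf A}(\lambda)$ for every choice of the $C_m$ as above. -/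

import Mathlib

open Complex

noncomputable section

namespace BenjaminOno

variable {P : ℕ}

/-- The rational function `u₀(w) = ∑ₚ (cₚ / (w - zₚ) + c̄ₚ / (w - z̄ₚ))` of a complex variable; on the
real line this is `∑ₚ cₚ / (x - zₚ) + c.c.` -/
def u0 (c z : Fin P → ℂ) (w : ℂ) : ℂ :=
  ∑ p, (c p / (w - z p) + (starRingEnd ℂ) (c p) / (w - (starRingEnd ℂ) (z p)))

/-- The restriction of `u₀` to the real line, as a real-valued function. -/
def u0Real (c z : Fin P → ℂ) (x : ℝ) : ℝ := (u0 c z (x : ℂ)).re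

/-- Admissible data of a rational potential: nonzero coefficients, poles in the upper half-plane with
real parts strictly increasing with the index, and `u₀ ∈ L¹(ℝ)`. -/
structure IsRationalPotential (c z : Fin P → ℂ) : Prop where
  coeff_ne_zero : ∀ p, c p ≠ 0
  pole_im_pos : ∀ p, 0 < (z p).im
  pole_re_strictMono : StrictMono fun p => (z p).re
  integrable : MeasureTheory.Integrable (u0Real c z)

/-- Rational Klaus-Shaw potentials: `u₀` is strictly monotone on each of the intervals `(-∞, x_c)` and
`(x_c, ∞)`, and `x_c` is its unique real critical point. -/
structure IsRationalKlausShaw (c z : Fin P → ℂ) : Prop extends IsRationalPotential c z where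
  exists_critical : ∃ xc : ℝ,
    (StrictMonoOn (u0Real c z) (Set.Iio xc) ∨ StrictAntiOn (u0Real c z) (Set.Iio xc)) ∧
    (StrictMonoOn (u0Real c z) (Set.Ioi xc) ∨ StrictAntiOn (u0Real c z) (Set.Ioi xc)) ∧
    ∀ x : ℝ, deriv (u0Real c z) x = 0 ↔ x = xc

/-- The plane without the vertical branch cuts emanating upwards from the `zₚ` and downwards from the
`z̄ₚ`. -/
def slitDomain (z : Fin P → ℂ) : Set ℂ :=
  {w | ∀ p, I * (w - z p) ∈ Complex.slitPlane ∧
    -I * (w - (starRingEnd ℂ) (z p)) ∈ Complex.slitPlane}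

/-- The antiderivative `f(w) = ∑ₚ cₚ (Log (i (w - zₚ)) + π i / 2) + c.c.` of `u₀` (principal branches);
the complex conjugate term on the real line is continued analytically. -/
def f (c z : Fin P → ℂ) (w : ℂ) : ℂ :=
  ∑ p, (c p * (log (I * (w - z p)) + Real.pi * I / 2) +
    (starRingEnd ℂ) (c p) * (log (-I * (w - (starRingEnd ℂ) (z p))) - Real.pi * I / 2))

/-- `h(w; lam) = lam w + f(w)`. -/
def h (c z : Fin P → ℂ) (lam : ℝ) (w : ℂ) : ℂ := lam * w + f c z w

/-- On the domain of analyticity of `f`, the derivative of `h(·; lam)` is `lam + u₀`. -/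
theorem hasDerivAt_h (c z : Fin P → ℂ) (lam : ℝ) {w : ℂ} (hw : w ∈ slitDomain z) :
    HasDerivAt (h c z lam) (lam + u0 c z w) w := by
  have h1 : HasDerivAt (fun w : ℂ => (lam : ℂ) * w) lam w := by
    simpa using (hasDerivAt_id w).const_mul (lam : ℂ)
  refine h1.add ?_
  refine HasDerivAt.fun_sum fun p _ => ?_
  obtain ⟨ha, hb⟩ := hw p
  have ha0 := Complex.slitPlane_ne_zero ha
  have hb0 := Complex.slitPlane_ne_zero hb
  have ka : HasDerivAt (fun w : ℂ => I * (w - z p)) (I * 1) w :=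
    ((hasDerivAt_id w).sub_const _).const_mul I
  have kb : HasDerivAt (fun w : ℂ => -I * (w - (starRingEnd ℂ) (z p))) (-I * 1) w :=
    ((hasDerivAt_id w).sub_const _).const_mul (-I)
  have la := ((ka.clog ha).add_const (Real.pi * I / 2 : ℂ)).const_mul (c p)
  have lb := ((kb.clog hb).sub_const (Real.pi * I / 2 : ℂ)).const_mul ((starRingEnd ℂ) (c p))
  have ha1 : w - z p ≠ 0 := right_ne_zero_of_mul ha0
  have hb1 : w - (starRingEnd ℂ) (z p) ≠ 0 := right_ne_zero_of_mul hb0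
  refine (la.add lb).congr_deriv ?_
  rw [mul_div_mul_left _ _ I_ne_zero, mul_div_mul_left _ _ (neg_ne_zero.mpr I_ne_zero)]
  ring

/-- The landscape function `R(w) = Re (-i h(w; lam))`. -/
def R (c z : Fin P → ℂ) (lam : ℝ) (w : ℂ) : ℝ := (-I * h c z lam w).re

/-- The critical points of the multivalued function `h(·; lam)`: away from the singularities
`zₚ, z̄ₚ`, the zeros of its single-valued derivative `lam + u₀`. -/
def IsCritical (c z : Fin P → ℂ) (lam : ℝ) (w : ℂ) : Prop :=
  (∀ p, w ≠ z p ∧ w ≠ (starRingEnd ℂ) (z p)) ∧ (lam : ℂ) + u0 c z w = 0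

/-- Piecewise `C¹` contours of bounded speed in the plane that come from `i∞` and return to `i∞`, along
the vertical lines `Re = left` and `Re = right` respectively. -/
structure UContour where
  toFun : ℝ → ℂ
  breaks : Finset ℝ
  left : ℝ
  right : ℝ
  lipschitz : ∃ K : NNReal, LipschitzWith K toFun
  contDiffAt : ∀ t, t ∉ breaks → ContDiffAt ℝ 1 toFun t
  tails : ∃ T : ℝ, (∀ t ≥ T, toFun t = right + t * I) ∧ (∀ t ≤ -T, toFun t = left - t * I)

instance : CoeFun UContour fun _ => ℝ → ℂ := ⟨UContour.toFun⟩

/-- The contours `U_m^<`: contained in the domain of analyticity of `f`, beginning at `i∞` to the left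
of `Re z₁`, and ending at `i∞` to the right of `Re z_m` and to the left of `Re z_{m+1}` (if any). -/
def IsU (z : Fin P → ℂ) (m : Fin P) (γ : UContour) : Prop :=
  (∀ t, γ t ∈ slitDomain z) ∧ (∀ p, γ.left < (z p).re) ∧
    (∀ p ≤ m, (z p).re < γ.right) ∧ (∀ p > m, γ.right < (z p).re)

/-- `H` is an analytic branch of `h(·; lam)` continued along `γ`: the logarithms in `f` are replaced
by continuous logarithms along `γ` (in particular `γ` avoids all `zₚ, z̄ₚ`). -/
def IsBranchAlong (c z : Fin P → ℂ) (lam : ℝ) (γ : UContour) (H : ℝ → ℂ) : Prop :=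
  ∃ l l' : Fin P → ℝ → ℂ,
    (∀ p, Continuous (l p) ∧ ∀ t, exp (l p t) = I * (γ t - z p)) ∧
    (∀ p, Continuous (l' p) ∧ ∀ t, exp (l' p t) = -I * (γ t - (starRingEnd ℂ) (z p))) ∧
    ∀ t, H t = lam * γ t + ∑ p, (c p * (l p t + Real.pi * I / 2) +
      (starRingEnd ℂ) (c p) * (l' p t - Real.pi * I / 2))

/-- The integrand `e^{-i H / ε} / (w - zₚ) dw` pulled back to the parameter line of `γ`, where `H` is
the branch of `h` used along `γ`. -/
def integrand (z : Fin P → ℂ) (ε : ℝ) (γ : UContour) (H : ℝ → ℂ) (p : Fin P) (t : ℝ) : ℂ :=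
  exp (-I * H t / ε) / (γ t - z p) * deriv γ t

/-- The matrix with entries `∫_{γ_m} e^{-i h / ε} / (w - zₚ) dw`, with branch `H m` of `h` along the
contour `γ m` of row `m`. -/
def contourMatrix (z : Fin P → ℂ) (ε : ℝ) (γ : Fin P → UContour) (H : Fin P → ℝ → ℂ) :
    Matrix (Fin P) (Fin P) ℂ :=
  Matrix.of fun m p => ∫ t : ℝ, integrand z ε (γ m) (H m) p t

/-- The matrix `A(lam)`, with integration contours `C m` and the principal branch of `h`. -/
def matrixA (c z : Fin P → ℂ) (lam ε : ℝ) (C : Fin P → UContour) : Matrix (Fin P) (Fin P) ℂ :=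
  contourMatrix z ε C fun m t => h c z lam (C m t)

/-- `γ` passes over the set `S` of critical points of `h`: the critical points on `γ` are exactly the
elements of `S`, each of them is traversed exactly once and with a nonzero velocity, and everywhere
else on `γ` the function `R` is strictly smaller than at each point of `S`. -/
def PassesOver (c z : Fin P → ℂ) (lam : ℝ) (γ : UContour) (S : Set ℂ) : Prop :=
  S.Nonempty ∧
  (∀ w, w ∈ S ↔ IsCritical c z lam w ∧ w ∈ Set.range γ) ∧
  (∀ w ∈ S, ∃! t : ℝ, γ t = w) ∧
  (∀ t, γ t ∈ S → ∃ v : ℂ, v ≠ 0 ∧ HasDerivAt γ v t) ∧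
  (∀ t, γ t ∉ S → ∀ w ∈ S, R c z lam (γ t) < R c z lam w)

/-- Suitability of the contours `W m` with exceptional index `Q`. Each contour other than `W Q` passes
over exactly one critical point, lying in the upper half-plane. The contour `W Q` passes either over
exactly one such point, or exactly over the real critical points of `h`; these are at most two and lie
on the zero level of `R`. Different contours pass over different critical points. -/
def IsSuitable (c z : Fin P → ℂ) (lam : ℝ) (Q : Fin P) (W : Fin P → UContour) : Prop :=
  ∃ S : Fin P → Set ℂ,
    (∀ m, PassesOver c z lam (W m) (S m)) ∧
    (Pairwise fun m n => Disjoint (S m) (S n)) ∧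
    (∀ m, m ≠ Q → ∃ w : ℂ, 0 < w.im ∧ S m = {w}) ∧
    ((∃ w : ℂ, 0 < w.im ∧ S Q = {w}) ∨
      (S Q = {w : ℂ | IsCritical c z lam w ∧ w.im = 0} ∧ (S Q).encard ≤ 2 ∧
        ∀ w ∈ S Q, R c z lam w = 0))

end BenjaminOno

end

open Complex Set Filter Topology MeasureTheory ComplexConjugate

namespace BenjaminOno

variable {P : ℕ}

/-! Since the residues are imaginary, `R` is a combination of `Im w` and logarithms of distances to
the poles. It is harmonic off the poles, vanishes on the real line, tends to +∞ at each `z p`, and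
decreases to -∞ high up.

Enough critical points. The numerator of `lam + u₀` has degree 2P and its roots are symmetric under
conjugation. The upper roots are simple, and the Klaus-Shaw shape leaves at most two real roots,
counted with multiplicity. So there are at least P upper critical points, or at least P - 1 of them
together with real ones (`le_card_critical`).

Contours. By the minimum principle every component of a sublevel set in the upper half-plane reaches
i∞ (`exists_height_subset_component`). From a simple saddle one can therefore leave in both steepest
descent directions and rise to i∞ below the level of the saddle (`exists_saddle_contour`). If one
contour is missing, it is the graph of -μ(lam + u₀) over a real interval, continued upwards by
vertical rays: to first order `R` equals -μ(lam + u₀)² there (`exists_real_contour`).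

The matrix. Integration along a contour is treated as a functional on all functions holomorphic off
the poles and bounded near infinity, since the P functions 1/(w - z p) alone would not separate
functionals. If `g` is annihilated by all the `C m`, the primitives of e^{-ih/ε} g decaying at i∞
fit together across the cuts: multiplied by e^{ih/ε} they give one single-valued function above the
lower poles. Hence `g` is annihilated by every contour on any sheet there (`integral_eq_zero`), and
so each `W m` is a linear combination of the `C k`. The coefficients form N.

Invertibility. N is invertible if the functionals of the `W m` are independent. In a relation among
them, the combined Cauchy transform has zero Taylor series at every pole, because the test functions
include all (w - q)^{-k}. Let `W m` have the highest level among the contours occurring. By the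
maximum principle each component of a superlevel set contains a pole, so at an upper saddle both
sides of `W m` are joined to poles without meeting any occurring contour; at a real crossing this
needs a separate construction. The transform vanishes on both sides, but its jump is 2πi times the
coefficient times a nonzero weight (`tendsto_cauchy_sub`), so the coefficient is zero
(`eq_zero_of_sum_eq_zero`). -/

/-- The standing assumptions: imaginary residues, poles in the upper half-plane with increasing real
parts, negative spectral parameter. -/
structure IsAdmissible (c z : Fin P → ℂ) (lam : ℝ) : Prop where
  coeff : ∀ p, (c p).re = 0 ∧ (c p).im < 0
  im_pos : ∀ p, 0 < (z p).im
  re_strictMono : StrictMono fun p => (z p).re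
  lam_neg : lam < 0
  size_pos : 0 < P

/-- `w` is none of the poles `zₚ, z̄ₚ`. -/
def Regular (z : Fin P → ℂ) (w : ℂ) : Prop := ∀ p, w ≠ z p ∧ w ≠ conj (z p)

theorem isClosed_not_regular (z : Fin P → ℂ) : IsClosed {w | ¬ Regular z w} := by
  have : {w | ¬ Regular z w} = ⋃ p, ({z p, conj (z p)} : Set ℂ) := by
    ext w
    simp only [Regular, mem_ofPred_eq, not_forall, mem_iUnion, mem_insert_iff, mem_singleton_iff]
    refine exists_congr fun p => ?_
    tauto
  rw [this]
  exact isClosed_iUnion_of_finite fun p => (Set.toFinite _).isClosed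

theorem isOpen_regular (z : Fin P → ℂ) : IsOpen {w | Regular z w} := by
  have := (isClosed_not_regular z).isOpen_compl
  rwa [show {w | ¬ Regular z w}ᶜ = {w | Regular z w} by ext; simp] at this

theorem log_norm_I_mul (w : ℂ) : (log (I * w)).re = Real.log ‖w‖ := by
  rw [log_re]; simp

theorem log_norm_neg_I_mul (w : ℂ) : (log (-I * w)).re = Real.log ‖w‖ := by
  rw [log_re]; simp

/-! ### The landscape function: closed form, local primitives, behaviour at infinity and at the
poles. -/

section Data

variable {c z : Fin P → ℂ} {lam : ℝ}

theorem IsAdmissible.conj_coeff (hA : IsAdmissible c z lam) (p : Fin P) :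
    conj (c p) = - c p := by
  apply Complex.ext <;> simp [(hA.coeff p).1]

theorem IsAdmissible.coeff_eq (hA : IsAdmissible c z lam) (p : Fin P) :
    c p = ((c p).im : ℂ) * I := by
  apply Complex.ext <;> simp [(hA.coeff p).1]

theorem IsAdmissible.regular_of_im_pos (hA : IsAdmissible c z lam) {w : ℂ} (hw : 0 < w.im)
    (h : ∀ p, w ≠ z p) : Regular z w := fun p => ⟨h p, fun h' => by
  have := hA.im_pos p
  rw [h'] at hw; simp at hw; linarith⟩

theorem IsAdmissible.regular_real (hA : IsAdmissible c z lam) (x : ℝ) : Regular z x := fun p =>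
  ⟨fun h' => by have := hA.im_pos p; rw [← h'] at this; simp at this,
   fun h' => by
    have := hA.im_pos p
    have h2 := congrArg Complex.im h'
    simp at h2; linarith⟩

/-- For imaginary `c p` the arguments of the logarithms contribute only to the imaginary part of
-ih. Only the moduli survive, so `R` does not see the choice of branch. -/
theorem R_eq (hA : IsAdmissible c z lam) (w : ℂ) :
    R c z lam w = lam * w.im +
      ∑ p, (-(c p).im) * (Real.log ‖w - conj (z p)‖ - Real.log ‖w - z p‖) := by
  have key : -I * h c z lam w = -I * (lam * w) + ∑ p, (((-(c p).im : ℝ) : ℂ) *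
      (log (-I * (w - conj (z p))) - log (I * (w - z p))) + ((c p).im * Real.pi : ℝ) * I) := by
    rw [h, f, mul_add, Finset.mul_sum]
    congr 1
    refine Finset.sum_congr rfl fun p _ => ?_
    rw [hA.conj_coeff p, hA.coeff_eq p]
    push_cast
    simp only [mul_im, ofReal_re, I_im, ofReal_im, I_re, mul_one, mul_zero, add_zero]
    linear_combination (-((c p).im : ℂ)) *
      (log (I * (w - z p)) + Real.pi * I - log (-I * (w - conj (z p)))) * I_mul_I
  rw [R, key, add_re, re_sum]
  congr 1
  · simp
  · refine Finset.sum_congr rfl fun p _ => ?_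
    rw [add_re, re_ofReal_mul, sub_re, log_norm_I_mul, log_norm_neg_I_mul]
    simp

/-- A real point is equidistant from `z p` and its conjugate. -/
theorem R_ofReal (hA : IsAdmissible c z lam) (x : ℝ) : R c z lam x = 0 := by
  rw [R_eq hA]
  simp only [ofReal_im, mul_zero, zero_add]
  refine Finset.sum_eq_zero fun p _ => ?_
  have : ‖(x : ℂ) - conj (z p)‖ = ‖(x : ℂ) - z p‖ := by
    rw [← norm_conj ((x : ℂ) - z p)]; simp
  rw [this]; ring

theorem R_of_im_eq_zero (hA : IsAdmissible c z lam) {w : ℂ} (hw : w.im = 0) :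
    R c z lam w = 0 := by
  have : w = (w.re : ℂ) := by apply Complex.ext <;> simp [hw]
  rw [this]; exact R_ofReal hA _

/-- Locally `R` is the real part of a primitive of `-i h'`. -/
theorem exists_local_primitive (hA : IsAdmissible c z lam) {w : ℂ} (hw : Regular z w) :
    ∃ r > 0, ∃ k : ℂ → ℂ, ∀ ζ ∈ Metric.ball w r, Regular z ζ ∧
      HasDerivAt k (-I * (lam + u0 c z ζ)) ζ ∧ (k ζ).re = R c z lam ζ := by
  obtain ⟨r, hr, hball⟩ := Metric.isOpen_iff.mp (isOpen_regular z) w hw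
  -- The ball misses q, so its radius is at most |w - q|. After division by w - q the argument lies
  -- within distance 1 of 1, where the principal logarithm is analytic. The lost modulus is added
  -- back as a constant.
  have hq : ∀ q : ℂ, w ≠ q → (∀ ζ ∈ Metric.ball w r, ζ ≠ q) → ∀ ζ ∈ Metric.ball w r,
      (ζ - q) / (w - q) ∈ slitPlane := by
    intro q hwq hq ζ hζ
    have h0 : w - q ≠ 0 := sub_ne_zero.mpr hwq
    have : (ζ - q) / (w - q) = 1 + (ζ - w) / (w - q) := by field_simp; ring
    rw [this]
    apply mem_slitPlane_of_norm_lt_one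
    rw [norm_div, div_lt_one (norm_pos_iff.mpr h0), ← dist_eq_norm, ← dist_eq_norm]
    have h1 : q ∉ Metric.ball w r := fun h' => hq q h' rfl
    rw [Metric.mem_ball] at hζ
    rw [Metric.mem_ball, not_lt, dist_comm] at h1
    linarith
  let k : ℂ → ℂ := fun ζ => -I * lam * ζ + ∑ p, ((-(c p).im : ℝ) : ℂ) *
    ((log ((ζ - conj (z p)) / (w - conj (z p))) + Real.log ‖w - conj (z p)‖) -
     (log ((ζ - z p) / (w - z p)) + Real.log ‖w - z p‖))
  refine ⟨r, hr, k, fun ζ hζ => ⟨hball hζ, ?_, ?_⟩⟩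
  · have hlog : ∀ q : ℂ, w ≠ q → (∀ ζ ∈ Metric.ball w r, ζ ≠ q) →
        HasDerivAt (fun ζ => log ((ζ - q) / (w - q)) + Real.log ‖w - q‖) (1 / (ζ - q)) ζ := by
      intro q h1 h2
      have h3 := hq q h1 h2 ζ hζ
      have h0 : w - q ≠ 0 := sub_ne_zero.mpr h1
      have h0' : ζ - q ≠ 0 := sub_ne_zero.mpr (h2 ζ hζ)
      have := ((((hasDerivAt_id ζ).sub_const q).div_const (w - q)).clog h3).add_const
        (Real.log ‖w - q‖ : ℂ)
      refine this.congr_deriv ?_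
      simp only [id_eq]
      field_simp
    have h1 : HasDerivAt (fun ζ : ℂ => -I * lam * ζ) (-I * lam) ζ := by
      simpa using (hasDerivAt_id ζ).const_mul (-I * lam : ℂ)
    refine (h1.add (HasDerivAt.fun_sum fun p _ =>
      ((hlog _ (hw p).2 fun ζ hζ => (hball hζ p).2).sub
        (hlog _ (hw p).1 fun ζ hζ => (hball hζ p).1)).const_mul _)).congr_deriv ?_
    rw [u0, mul_add, Finset.mul_sum]
    congr 1
    refine Finset.sum_congr rfl fun p _ => ?_
    rw [hA.conj_coeff p, hA.coeff_eq p]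
    push_cast
    simp only [mul_im, ofReal_re, I_im, ofReal_im, I_re, mul_one, mul_zero, add_zero]
    linear_combination ((c p).im : ℂ) * (1 / (ζ - z p) - 1 / (ζ - conj (z p))) * I_mul_I
  · rw [R_eq hA]
    simp only [k, add_re, re_sum]
    congr 1
    · simp
    refine Finset.sum_congr rfl fun p _ => ?_
    have hlog : ∀ q : ℂ, w ≠ q → ζ ≠ q →
        (log ((ζ - q) / (w - q)) + Real.log ‖w - q‖).re = Real.log ‖ζ - q‖ := by
      intro q h1 h2
      rw [add_re, log_re, ofReal_re, norm_div, Real.log_div, sub_add_cancel]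
      · exact norm_ne_zero_iff.mpr (sub_ne_zero.mpr h2)
      · exact norm_ne_zero_iff.mpr (sub_ne_zero.mpr h1)
    rw [re_ofReal_mul, sub_re, hlog _ (hw p).2 (hball hζ p).2, hlog _ (hw p).1 (hball hζ p).1]

theorem hasDerivAt_R_comp (hA : IsAdmissible c z lam) {γ : ℝ → ℂ} {γ' : ℂ} {t : ℝ}
    (hw : Regular z (γ t)) (hγ : HasDerivAt γ γ' t) :
    HasDerivAt (fun s => R c z lam (γ s)) (-I * (lam + u0 c z (γ t)) * γ').re t := by
  obtain ⟨r, hr, k, hk⟩ := exists_local_primitive hA hw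
  have h1 := (hk _ (Metric.mem_ball_self hr)).2.1.comp t hγ
  have h2 := (reCLM.hasFDerivAt.comp_hasDerivAt t h1)
  refine h2.congr_of_eventuallyEq ?_
  filter_upwards [hγ.continuousAt.eventually_mem (Metric.ball_mem_nhds _ hr)] with s hs
  exact (hk _ hs).2.2.symm

theorem continuousAt_R (hA : IsAdmissible c z lam) {w : ℂ} (hw : Regular z w) :
    ContinuousAt (R c z lam) w := by
  obtain ⟨r, hr, k, hk⟩ := exists_local_primitive hA hw
  have h1 := continuous_re.continuousAt.comp (hk _ (Metric.mem_ball_self hr)).2.1.continuousAt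
  refine h1.congr ?_
  filter_upwards [Metric.ball_mem_nhds _ hr] with s hs
  exact (hk _ hs).2.2

theorem hasDerivAt_R_vertical (hA : IsAdmissible c z lam) {x y : ℝ}
    (hw : Regular z (x + y * I)) :
    HasDerivAt (fun s : ℝ => R c z lam (x + s * I)) (lam + (u0 c z (x + y * I)).re) y := by
  have h1 : HasDerivAt (fun s : ℝ => (x : ℂ) + s * I) I y := by
    simpa using ((hasDerivAt_id y).ofReal_comp.mul_const I).const_add (x : ℂ)
  refine (hasDerivAt_R_comp hA (γ := fun s : ℝ => (x : ℂ) + s * I) hw h1).congr_deriv ?_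
  rw [mul_right_comm, neg_mul, I_mul_I]
  simp

theorem differentiableAt_u0 {w : ℂ} (hw : Regular z w) : DifferentiableAt ℂ (u0 c z) w := by
  unfold u0
  refine DifferentiableAt.fun_sum fun p _ => ?_
  have h1 := sub_ne_zero.mpr (hw p).1
  have h2 := sub_ne_zero.mpr (hw p).2
  fun_prop (disch := assumption)

theorem u0_conj (w : ℂ) : u0 c z (conj w) = conj (u0 c z w) := by
  simp only [u0, map_sum, map_add, map_div₀, map_sub, conj_conj]
  exact Finset.sum_congr rfl fun p _ => add_comm _ _

theorem u0_ofReal (x : ℝ) : u0 c z x = u0Real c z x := by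
  rw [u0Real]
  have := u0_conj (c := c) (z := z) (x : ℂ)
  rw [conj_ofReal] at this
  exact (Complex.conj_eq_iff_re.mp this.symm).symm

theorem tendsto_u0_cocompact : Tendsto (u0 c z) (cocompact ℂ) (𝓝 0) := by
  have key : ∀ a q : ℂ, Tendsto (fun w : ℂ => a / (w - q)) (cocompact ℂ) (𝓝 0) := by
    intro a q
    have h1 : Tendsto (fun w : ℂ => w - q) (cocompact ℂ) (cocompact ℂ) :=
      (Homeomorph.subRight q).isClosedEmbedding.tendsto_cocompact
    have h2 := (tendsto_inv₀_cobounded (α := ℂ)).comp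
      (by rw [Metric.cobounded_eq_cocompact]; exact h1 : Tendsto (fun w : ℂ => w - q) (cocompact ℂ) (Bornology.cobounded ℂ))
    simpa [div_eq_mul_inv] using h2.const_mul a
  unfold u0
  have := tendsto_finsetSum (Finset.univ : Finset (Fin P))
    fun p _ => (key (c p) (z p)).add (key (conj (c p)) (conj (z p)))
  simpa using this

/-- Away from a disk `h'` is dominated by `lam`. -/
theorem exists_radius (hA : IsAdmissible c z lam) : ∃ K > 0, (∀ p, ‖z p‖ < K) ∧ ∀ w : ℂ, K ≤ ‖w‖ →
    Regular z w ∧ ‖u0 c z w‖ ≤ -lam / 2 := by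
  -- The bound -lam/2 keeps the real part of h' at most lam/2 < 0. This excludes critical points far
  -- away and gives a definite rate of descent.
  have h1 := (tendsto_u0_cocompact (c := c) (z := z)).eventually
    (Metric.closedBall_mem_nhds 0 (by linarith [hA.lam_neg] : 0 < -lam / 2))
  rw [← Metric.cobounded_eq_cocompact, ← comap_norm_atTop] at h1
  obtain ⟨s, hs, hs'⟩ := h1
  obtain ⟨K, hK⟩ := mem_atTop_sets.mp hs
  have hle : ∀ p, ‖z p‖ ≤ ∑ p, ‖z p‖ := fun p =>
    Finset.single_le_sum (f := fun p => ‖z p‖) (fun _ _ => norm_nonneg _) (Finset.mem_univ p)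
  have hs0 : 0 ≤ ∑ p, ‖z p‖ := Finset.sum_nonneg fun _ _ => norm_nonneg _
  have hlt : ∀ p, ‖z p‖ < max K (∑ p, ‖z p‖ + 1) := fun p =>
    lt_max_of_lt_right (by linarith [hle p])
  refine ⟨max K (∑ p, ‖z p‖ + 1), lt_max_of_lt_right (by linarith), hlt, fun w hw => ⟨fun p => ⟨?_, ?_⟩, ?_⟩⟩
  · rintro rfl; exact absurd hw (not_le.mpr (hlt p))
  · rintro rfl; rw [norm_conj] at hw; exact absurd hw (not_le.mpr (hlt p))
  · have := hs' (show w ∈ norm ⁻¹' s from hK _ (le_trans (le_max_left _ _) hw))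
    simpa using this

/-- Far away `R` decreases upwards at a definite rate. -/
theorem R_vertical_le (hA : IsAdmissible c z lam) {K : ℝ}
    (hK : ∀ w : ℂ, K ≤ ‖w‖ → Regular z w ∧ ‖u0 c z w‖ ≤ -lam / 2) {x y y' : ℝ} (hy : y ≤ y')
    (hfar : ∀ s ∈ Icc y y', K ≤ ‖(x + s * I : ℂ)‖) :
    R c z lam (x + y' * I) ≤ R c z lam (x + y * I) + lam / 2 * (y' - y) := by
  have hd : ∀ s ∈ Icc y y', HasDerivAt (fun s : ℝ => R c z lam (x + s * I))
      (lam + (u0 c z (x + s * I)).re) s := fun s hs =>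
    hasDerivAt_R_vertical hA (hK _ (hfar s hs)).1
  have := Convex.image_sub_le_mul_sub_of_deriv_le (convex_Icc y y') (C := lam / 2)
    (fun s hs => (hd s hs).continuousAt.continuousWithinAt)
    (fun s hs => (hd s (interior_subset hs)).differentiableAt.differentiableWithinAt)
    (fun s hs => by
      rw [(hd s (interior_subset hs)).deriv]
      have h1 := (hK _ (hfar s (interior_subset hs))).2
      linarith [le_trans (re_le_norm _) h1]) y (left_mem_Icc.mpr hy) y' (right_mem_Icc.mpr hy) hy
  linarith

theorem le_norm_of_le_abs_re {K : ℝ} {x s : ℝ} (h : K ≤ |x|) : K ≤ ‖(x + s * I : ℂ)‖ := by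
  have := abs_re_le_norm (x + s * I : ℂ)
  simp at this; linarith

/-- Upper bound of `R` outside a disk. -/
theorem exists_R_le (hA : IsAdmissible c z lam) : ∃ K > 0, ∃ C ≥ 0, ∀ w : ℂ, K ≤ ‖w‖ →
    R c z lam w ≤ lam * w.im + C := by
  obtain ⟨K, hK0, hK, -⟩ := exists_radius hA
  -- For ‖w‖ ≥ 2K > 2‖z p‖ the quotient (‖w‖ + ‖z p‖)/(‖w‖ - ‖z p‖) is at most 3.
  refine ⟨2 * K, by linarith, ∑ p, -(c p).im * Real.log 3,
    Finset.sum_nonneg fun p _ => mul_nonneg (by linarith [(hA.coeff p).2])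
      (Real.log_nonneg (by norm_num)), fun w hw => ?_⟩
  rw [R_eq hA]
  gcongr with p
  · linarith [(hA.coeff p).2]
  have h1 : ‖w‖ - ‖z p‖ ≤ ‖w - z p‖ := norm_sub_norm_le _ _
  have h2 : ‖w - conj (z p)‖ ≤ ‖w‖ + ‖z p‖ := by
    simpa using norm_sub_le w (conj (z p))
  have h3 := hK p
  have h4 : ‖w‖ - ‖z p‖ ≤ ‖w - conj (z p)‖ := by
    simpa using norm_sub_norm_le w (conj (z p))
  have h5 := norm_nonneg (z p)
  rw [← Real.log_div (by linarith) (by linarith)]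
  refine Real.log_le_log (div_pos (by linarith) (by linarith)) ?_
  rw [div_le_iff₀ (by linarith)]
  linarith

/-- Only one logarithm is singular at `z p`, and its sign is decided by `(c p).im < 0`. -/
theorem tendsto_R_pole (hA : IsAdmissible c z lam) (p : Fin P) :
    Tendsto (R c z lam) (𝓝[≠] (z p)) atTop := by
  classical
  have hne : ∀ q, q ≠ p → z p - z q ≠ 0 := fun q hq h' => hq (by
    have := sub_eq_zero.mp h'
    exact (hA.re_strictMono.injective (by simp [this])))
  have hne' : ∀ q, z p - conj (z q) ≠ 0 := fun q h' => by
    have h1 := congrArg Complex.im h'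
    have := hA.im_pos p; have := hA.im_pos q
    simp at h1; linarith
  have hlog : Tendsto (fun w => -Real.log ‖w - z p‖) (𝓝[≠] (z p)) atTop := by
    refine tendsto_neg_atBot_atTop.comp (Real.tendsto_log_nhdsGT_zero.comp ?_)
    refine tendsto_nhdsWithin_iff.mpr ⟨?_, ?_⟩
    · have : ContinuousAt (fun w => ‖w - z p‖) (z p) := by fun_prop
      simpa using this.tendsto.mono_left nhdsWithin_le_nhds
    · filter_upwards [self_mem_nhdsWithin] with w hw
      exact norm_pos_iff.mpr (sub_ne_zero.mpr hw)
  have hcont : ContinuousAt (fun w => lam * w.im + (∑ q ∈ Finset.univ.erase p, (-(c q).im) *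
      (Real.log ‖w - conj (z q)‖ - Real.log ‖w - z q‖)) + (-(c p).im) *
      Real.log ‖w - conj (z p)‖) (z p) := by
    refine ContinuousAt.add (ContinuousAt.add (by fun_prop) (tendsto_finsetSum _ fun q hq => ?_)) ?_
    · refine ContinuousAt.tendsto (f := fun w => -(c q).im * (Real.log ‖w - conj (z q)‖ - Real.log ‖w - z q‖)) ?_
      have h1 := norm_ne_zero_iff.mpr (hne q (Finset.ne_of_mem_erase hq))
      have h2 := norm_ne_zero_iff.mpr (hne' q)
      fun_prop (disch := assumption)
    · have h2 := norm_ne_zero_iff.mpr (hne' p)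
      fun_prop (disch := assumption)
  have h3 := (hcont.tendsto.mono_left (nhdsWithin_le_nhds (s := {z p}ᶜ))).add_atTop
    (hlog.const_mul_atTop (by linarith [(hA.coeff p).2] : 0 < -(c p).im))
  refine h3.congr fun w => ?_
  rw [R_eq hA, ← Finset.sum_erase_add _ _ (Finset.mem_univ p)]
  ring

end Data

/-! ### Numerators of partial fractions and multiplicities of their roots. -/

section PartialFractions

open Polynomial

variable {ι : Type*} [Fintype ι] [DecidableEq ι]

/-- The numerator of the rational function `a + ∑ dᵢ / (w - ζᵢ)`. -/
noncomputable def numerator (a : ℂ) (d ζ : ι → ℂ) : ℂ[X] :=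
  C a * ∏ i, (X - C (ζ i)) + ∑ i, C (d i) * ∏ j ∈ Finset.univ.erase i, (X - C (ζ j))

theorem natDegree_numerator {a : ℂ} (ha : a ≠ 0) (d ζ : ι → ℂ) :
    (numerator a d ζ).natDegree = Fintype.card ι := by
  have h1 : (C a * ∏ i, (X - C (ζ i))).degree = Fintype.card ι := by
    rw [degree_C_mul ha, degree_prod]; simp
  rw [numerator]
  refine natDegree_eq_of_degree_eq_some ?_
  rw [degree_add_eq_left_of_degree_lt, h1]
  rw [h1]
  refine lt_of_le_of_lt (degree_sum_le _ _) ?_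
  rw [Finset.sup_lt_iff (WithBot.bot_lt_coe _)]
  intro i _
  rw [degree_mul]
  refine lt_of_le_of_lt (add_le_add_left degree_C_le _) ?_
  rw [zero_add, degree_prod]
  simp only [degree_X_sub_C, Finset.sum_const, Finset.card_erase_of_mem (Finset.mem_univ i),
    Finset.card_univ]
  have : 0 < Fintype.card ι := Fintype.card_pos_iff.mpr ⟨i⟩
  simp only [nsmul_eq_mul, mul_one]
  exact_mod_cast Nat.sub_lt this one_pos

theorem eval_numerator (a : ℂ) (d ζ : ι → ℂ) {w : ℂ} (hw : ∀ i, w ≠ ζ i) :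
    (numerator a d ζ).eval w = (a + ∑ i, d i / (w - ζ i)) * ∏ i, (w - ζ i) := by
  rw [numerator, eval_add, eval_finsetSum, add_mul, Finset.sum_mul]
  congr 1
  · simp [eval_prod]
  refine Finset.sum_congr rfl fun i _ => ?_
  rw [← Finset.mul_prod_erase _ _ (Finset.mem_univ i)]
  have := sub_ne_zero.mpr (hw i)
  simp only [eval_mul, eval_C, eval_prod, eval_sub, eval_X]
  field_simp

/-- Exactly one summand lacks the factor vanishing at `ζ i`. So clearing denominators creates no
spurious roots. -/
theorem eval_numerator_pole (a : ℂ) {d ζ : ι → ℂ} (hd : ∀ i, d i ≠ 0)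
    (hζ : Function.Injective ζ) (i : ι) : (numerator a d ζ).eval (ζ i) ≠ 0 := by
  rw [numerator, eval_add, eval_finsetSum, Finset.sum_eq_single i]
  · rw [eval_mul, eval_prod, Finset.prod_eq_zero (Finset.mem_univ i) (by simp), mul_zero, zero_add,
      eval_mul, eval_prod, eval_C]
    refine mul_ne_zero (hd i) (Finset.prod_ne_zero_iff.mpr fun j hj => ?_)
    simp only [eval_sub, eval_X, eval_C]
    exact sub_ne_zero.mpr fun h' => (Finset.ne_of_mem_erase hj) (hζ h').symm
  · intro j _ hj
    rw [eval_mul, eval_prod, Finset.prod_eq_zero (i := i) (by simpa using hj.symm) (by simp),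
      mul_zero]
  · simp

/-- At a zero of g the derivative of gD is g'D, which is nonzero here. -/
theorem rootMultiplicity_eq_one_of_hasDerivAt {N : ℂ[X]} {w v : ℂ} {g D : ℂ → ℂ} (hN : N ≠ 0)
    (hg : HasDerivAt g v w) (hv : v ≠ 0) (hg0 : g w = 0) (hD : DifferentiableAt ℂ D w)
    (hD0 : D w ≠ 0) (hNg : ∀ᶠ x in 𝓝 w, N.eval x = g x * D x) : N.rootMultiplicity w = 1 := by
  have h1 := (N.hasDerivAt w).unique ((hg.mul hD.hasDerivAt).congr_of_eventuallyEq hNg)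
  rw [hg0, zero_mul, add_zero] at h1
  have h2 : N.IsRoot w := by rw [IsRoot, hNg.self_of_nhds, hg0, zero_mul]
  refine le_antisymm (not_lt.mp fun h3 => ?_) ((rootMultiplicity_pos hN).mpr h2)
  have := ((one_lt_rootMultiplicity_iff_isRoot hN).mp h3).2
  rw [IsRoot, h1] at this
  exact mul_ne_zero hv hD0 this

/-- At a double zero of g the second derivative of gD reduces to g''D. -/
theorem rootMultiplicity_le_two {N : ℂ[X]} {w : ℂ} {g D : ℂ → ℂ} (hN : N ≠ 0)
    (hg : AnalyticAt ℂ g w) (hv : deriv (deriv g) w ≠ 0) (hg0 : g w = 0) (hg1 : deriv g w = 0)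
    (hD : AnalyticAt ℂ D w) (hD0 : D w ≠ 0) (hNg : ∀ᶠ x in 𝓝 w, N.eval x = g x * D x) :
    N.rootMultiplicity w ≤ 2 := by
  have h1 : ∀ᶠ x in 𝓝 w, N.derivative.eval x = deriv g x * D x + g x * deriv D x := by
    filter_upwards [hNg.eventually_nhds, hg.eventually_analyticAt, hD.eventually_analyticAt]
      with x hx hgx hDx
    exact (N.hasDerivAt x).unique
      ((hgx.differentiableAt.hasDerivAt.mul hDx.differentiableAt.hasDerivAt).congr_of_eventuallyEq hx)
  have h2 := (N.derivative.hasDerivAt w).unique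
    (((hg.deriv.differentiableAt.hasDerivAt.mul hD.differentiableAt.hasDerivAt).add
      (hg.differentiableAt.hasDerivAt.mul hD.deriv.differentiableAt.hasDerivAt)).congr_of_eventuallyEq
      h1)
  rw [hg0, hg1] at h2
  simp only [zero_mul, add_zero] at h2
  by_contra h3
  rw [not_le] at h3
  have := (lt_rootMultiplicity_iff_isRoot_iterate_derivative hN).mp h3 2 le_rfl
  simp only [Function.iterate_succ, Function.iterate_zero, Function.comp_apply, id_eq] at this
  rw [IsRoot, h2] at this
  exact mul_ne_zero hv hD0 this

end PartialFractions

/-! ### Critical points: sign patterns on the real line and the counting argument. -/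

section Data

variable {c z : Fin P → ℂ} {lam : ℝ}

theorem isCritical_iff {w : ℂ} :
    IsCritical c z lam w ↔ Regular z w ∧ (lam : ℂ) + u0 c z w = 0 := Iff.rfl

theorem IsAdmissible.isCritical_ofReal_iff (hA : IsAdmissible c z lam) (x : ℝ) :
    IsCritical c z lam x ↔ lam + u0Real c z x = 0 := by
  rw [isCritical_iff, u0_ofReal]
  constructor
  · rintro ⟨-, h⟩; exact_mod_cast h
  · intro h; exact ⟨hA.regular_real x, by exact_mod_cast h⟩

theorem IsCritical.conj {w : ℂ} (hw : IsCritical c z lam w) : IsCritical c z lam (conj w) := by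
  refine ⟨fun p => ⟨fun h => (hw.1 p).2 ?_, fun h => (hw.1 p).1 ?_⟩, ?_⟩
  · rw [← h, conj_conj]
  · exact (starRingEnd ℂ).injective h
  · rw [u0_conj, ← conj_ofReal, ← map_add, hw.2, map_zero]

theorem analyticAt_u0 {w : ℂ} (hw : Regular z w) : AnalyticAt ℂ (u0 c z) w := by
  have : DifferentiableOn ℂ (u0 c z) {w | Regular z w} := fun w hw =>
    (differentiableAt_u0 hw).differentiableWithinAt
  exact this.analyticAt ((isOpen_regular z).mem_nhds hw)

theorem IsAdmissible.hasDerivAt_u0Real (hA : IsAdmissible c z lam) (x : ℝ) :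
    HasDerivAt (u0Real c z) (deriv (u0 c z) x).re x :=
  ((differentiableAt_u0 (c := c) (hA.regular_real x)).hasDerivAt).real_of_complex

theorem IsAdmissible.deriv_u0_ofReal (hA : IsAdmissible c z lam) (x : ℝ) :
    deriv (u0 c z) x = (deriv (u0Real c z) x : ℝ) := by
  have h1 := ((differentiableAt_u0 (c := c) (hA.regular_real x)).hasDerivAt).comp_ofReal
  have h2 := (hA.hasDerivAt_u0Real x)
  rw [h2.deriv]
  have h3 : (fun y : ℝ => u0 c z y) = fun y : ℝ => (u0Real c z y : ℂ) :=
    funext fun y => u0_ofReal y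
  rw [h3] at h1
  exact h1.unique h2.ofReal_comp

theorem IsAdmissible.deriv_deriv_u0_ofReal (hA : IsAdmissible c z lam) (x : ℝ) :
    deriv (deriv (u0 c z)) x = (deriv (deriv (u0Real c z)) x : ℝ) := by
  have ha := (analyticAt_u0 (c := c) (hA.regular_real x)).deriv.differentiableAt.hasDerivAt
  have h1 := ha.comp_ofReal
  have h2 := ha.real_of_complex
  have h3 : (fun y : ℝ => deriv (u0 c z) y) = fun y : ℝ => ((deriv (u0Real c z) y : ℝ) : ℂ) :=
    funext fun y => hA.deriv_u0_ofReal y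
  have h4 : (fun y : ℝ => (deriv (u0 c z) y).re) = deriv (u0Real c z) :=
    funext fun y => by rw [hA.deriv_u0_ofReal y, ofReal_re]
  rw [h4] at h2
  rw [h3] at h1
  rw [h1.unique h2.ofReal_comp, h2.deriv]

theorem IsAdmissible.continuous_u0Real (hA : IsAdmissible c z lam) : Continuous (u0Real c z) :=
  continuous_iff_continuousAt.mpr fun x => (hA.hasDerivAt_u0Real x).continuousAt

theorem tendsto_u0Real : Tendsto (u0Real c z) (cocompact ℝ) (𝓝 0) := by
  have h1 : Tendsto (fun x : ℝ => (x : ℂ)) (cocompact ℝ) (cocompact ℂ) :=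
    isometry_ofReal.isClosedEmbedding.tendsto_cocompact
  have h2 := (continuous_re.tendsto _).comp ((tendsto_u0_cocompact (c := c) (z := z)).comp h1)
  rw [zero_re] at h2
  exact h2

theorem sum_elim_u0 (c z : Fin P → ℂ) (w : ℂ) :
    u0 c z w = ∑ i, Sum.elim c (fun p => conj (c p)) i / (w - Sum.elim z (fun p => conj (z p)) i) := by
  rw [Fintype.sum_sum_type, ← Finset.sum_add_distrib]
  rfl

/-- The numerator of `lam + u₀`. -/
noncomputable def criticalPoly (c z : Fin P → ℂ) (lam : ℝ) : Polynomial ℂ :=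
  numerator lam (Sum.elim c (fun p => conj (c p))) (Sum.elim z (fun p => conj (z p)))

theorem regular_iff_sum {w : ℂ} :
    Regular z w ↔ ∀ i, w ≠ Sum.elim z (fun p => conj (z p)) i := by
  simp [Regular, Sum.forall, forall_and]

theorem IsAdmissible.pole_injective (hA : IsAdmissible c z lam) :
    Function.Injective (Sum.elim z (fun p => conj (z p))) := by
  have hre : Function.Injective fun p => (z p).re := hA.re_strictMono.injective
  refine Function.Injective.sumElim (fun p q h => hre (congrArg Complex.re h))
    (fun p q h => hre ?_) fun p q h => ?_
  · simpa using congrArg Complex.re h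
  · have h1 := congrArg Complex.im h
    have := hA.im_pos p; have := hA.im_pos q
    simp at h1; linarith

theorem IsAdmissible.coeff_ne_zero (hA : IsAdmissible c z lam) (p : Fin P) : c p ≠ 0 := fun h => by
  have := (hA.coeff p).2; simp [h] at this

theorem IsAdmissible.criticalPoly_ne_zero (hA : IsAdmissible c z lam) :
    criticalPoly c z lam ≠ 0 := fun h0 => by
  have := natDegree_numerator (a := lam) (by exact_mod_cast hA.lam_neg.ne)
    (Sum.elim c (fun p => conj (c p))) (Sum.elim z (fun p => conj (z p)))
  have hP := hA.size_pos
  rw [← criticalPoly, h0] at this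
  simp at this
  omega

theorem IsAdmissible.isCritical_iff_isRoot (hA : IsAdmissible c z lam) (w : ℂ) :
    IsCritical c z lam w ↔ (criticalPoly c z lam).IsRoot w := by
  rw [isCritical_iff, Polynomial.IsRoot, criticalPoly]
  by_cases hw : Regular z w
  · have hw' := regular_iff_sum.mp hw
    rw [eval_numerator _ _ _ hw', ← sum_elim_u0, mul_eq_zero]
    have : ∏ i, (w - Sum.elim z (fun p => conj (z p)) i) ≠ 0 :=
      Finset.prod_ne_zero_iff.mpr fun i _ => sub_ne_zero.mpr (hw' i)
    simp only [hw, true_and, this, or_false]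
  · simp only [hw, false_and, false_iff]
    rw [regular_iff_sum] at hw
    push Not at hw
    obtain ⟨i, rfl⟩ := hw
    refine eval_numerator_pole _ (fun i => ?_) hA.pole_injective i
    rcases i with p | p
    · exact hA.coeff_ne_zero p
    · simpa using hA.coeff_ne_zero p

theorem IsAdmissible.finite_isCritical (hA : IsAdmissible c z lam) :
    {w | IsCritical c z lam w}.Finite := by
  have : {w | IsCritical c z lam w} = {w | (criticalPoly c z lam).IsRoot w} :=
    Set.ext hA.isCritical_iff_isRoot
  rw [this]
  exact Polynomial.finite_setOfPred_isRoot hA.criticalPoly_ne_zero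

theorem eventually_eval_criticalPoly {w : ℂ} (hw : Regular z w) :
    ∀ᶠ x in 𝓝 w, (criticalPoly c z lam).eval x =
      (lam + u0 c z x) * ∏ i, (x - Sum.elim z (fun p => conj (z p)) i) := by
  filter_upwards [(isOpen_regular z).mem_nhds hw] with x hx
  rw [criticalPoly, eval_numerator _ _ _ (regular_iff_sum.mp hx), ← sum_elim_u0]

theorem IsAdmissible.rootMultiplicity_eq_one (hA : IsAdmissible c z lam) {w : ℂ}
    (hw : IsCritical c z lam w) (hd : deriv (u0 c z) w ≠ 0) :
    (criticalPoly c z lam).rootMultiplicity w = 1 :=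
  rootMultiplicity_eq_one_of_hasDerivAt hA.criticalPoly_ne_zero
    ((differentiableAt_u0 hw.1).hasDerivAt.const_add (lam : ℂ)) hd hw.2 (by fun_prop)
    (Finset.prod_ne_zero_iff.mpr fun i _ => sub_ne_zero.mpr (regular_iff_sum.mp hw.1 i))
    (eventually_eval_criticalPoly hw.1)

theorem IsAdmissible.rootMultiplicity_le_two (hA : IsAdmissible c z lam) {w : ℂ}
    (hw : IsCritical c z lam w) (hd : deriv (u0 c z) w = 0) (hd2 : deriv (deriv (u0 c z)) w ≠ 0) :
    (criticalPoly c z lam).rootMultiplicity w ≤ 2 := by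
  have h1 : deriv (fun x => (lam : ℂ) + u0 c z x) = deriv (u0 c z) :=
    funext fun x => deriv_const_add _
  refine BenjaminOno.rootMultiplicity_le_two (g := fun x => lam + u0 c z x)
    hA.criticalPoly_ne_zero (analyticAt_const.add (analyticAt_u0 hw.1)) ?_ hw.2 ?_
    (D := fun x => ∏ i, (x - Sum.elim z (fun p => conj (z p)) i)) ?_
    (Finset.prod_ne_zero_iff.mpr fun i _ => sub_ne_zero.mpr (regular_iff_sum.mp hw.1 i))
    (eventually_eval_criticalPoly hw.1)
  · rwa [h1]
  · rwa [h1]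
  · fun_prop

/-- The possible sign patterns of `lam + u₀` on the real line. -/
inductive RealSigns (c z : Fin P → ℂ) (lam : ℝ) : Prop
  | none (h : ∀ x, lam + u0Real c z x < 0)
  | double (x₀ : ℝ) (h0 : lam + u0Real c z x₀ = 0) (h : ∀ x, x ≠ x₀ → lam + u0Real c z x < 0)
      (h1 : deriv (u0Real c z) x₀ = 0) (h2 : deriv (deriv (u0Real c z)) x₀ ≠ 0)
  | pair (x₁ x₂ : ℝ) (hlt : x₁ < x₂) (h1 : lam + u0Real c z x₁ = 0) (h2 : lam + u0Real c z x₂ = 0)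
      (hl : ∀ x < x₁, lam + u0Real c z x < 0) (hr : ∀ x > x₂, lam + u0Real c z x < 0)
      (hm : ∀ x, x₁ < x → x < x₂ → 0 < lam + u0Real c z x)
      (hd1 : deriv (u0Real c z) x₁ ≠ 0) (hd2 : deriv (u0Real c z) x₂ ≠ 0)

/-- A positive function tending to 0 at both ends must increase up to `xc` and decrease afterwards.
The three patterns correspond to the maximum being below, at, or above -lam. -/
theorem realSigns (hA : IsAdmissible c z lam) (hKS : IsRationalKlausShaw c z)
    (hpos : ∀ x : ℝ, 0 < u0Real c z x)
    (hedge : ∀ x : ℝ, deriv (u0Real c z) x = 0 → lam = -u0Real c z x →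
      deriv (deriv (u0Real c z)) x ≠ 0) : RealSigns c z lam := by
  obtain ⟨xc, hl, hr, hcrit⟩ := hKS.exists_critical
  have hcont := hA.continuous_u0Real
  have hbot : Tendsto (u0Real c z) atBot (𝓝 0) := tendsto_u0Real.mono_left atBot_le_cocompact
  have htop : Tendsto (u0Real c z) atTop (𝓝 0) := tendsto_u0Real.mono_left atTop_le_cocompact
  have hl' : StrictMonoOn (u0Real c z) (Iio xc) := by
    refine hl.resolve_right fun h => ?_
    have := ge_of_tendsto hbot (b := u0Real c z (xc - 1)) ?_
    · linarith [hpos (xc - 1)]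
    · filter_upwards [eventually_lt_atBot (xc - 1)] with x hx
      exact (h (show x < xc by linarith) (show xc - 1 < xc by linarith) hx).le
  have hr' : StrictAntiOn (u0Real c z) (Ioi xc) := by
    refine hr.resolve_left fun h => ?_
    have := ge_of_tendsto htop (b := u0Real c z (xc + 1)) ?_
    · linarith [hpos (xc + 1)]
    · filter_upwards [eventually_gt_atTop (xc + 1)] with x hx
      exact (h (show xc < xc + 1 by linarith) (show xc < x by linarith) hx).le
  have hlc : ∀ x < xc, u0Real c z x < u0Real c z xc := fun x hx => by
    obtain ⟨y, hxy, hy⟩ := exists_between hx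
    refine lt_of_lt_of_le (hl' hx hy hxy) ?_
    refine ge_of_tendsto (hcont.continuousAt.tendsto.mono_left (nhdsWithin_le_nhds (s := Iio xc))) ?_
    filter_upwards [Ioo_mem_nhdsLT hy] with s hs
    exact (hl' hy hs.2 hs.1).le
  have hrc : ∀ x > xc, u0Real c z x < u0Real c z xc := fun x hx => by
    obtain ⟨y, hy, hxy⟩ := exists_between hx
    refine lt_of_lt_of_le (hr' hy hx hxy) ?_
    refine ge_of_tendsto (hcont.continuousAt.tendsto.mono_left (nhdsWithin_le_nhds (s := Ioi xc))) ?_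
    filter_upwards [Ioo_mem_nhdsGT hy] with s hs
    exact (hr' hs.1 hy hs.2).le
  rcases lt_trichotomy (lam + u0Real c z xc) 0 with h0 | h0 | h0
  · refine .none fun x => ?_
    rcases lt_trichotomy x xc with hx | rfl | hx
    · linarith [hlc x hx]
    · exact h0
    · linarith [hrc x hx]
  · refine .double xc h0 (fun x hx => ?_) ((hcrit xc).mpr rfl)
      -- This is the edge value -lam = max u₀, where the nonvanishing of u₀'' keeps the real root
      -- from having multiplicity above two.
      (hedge xc ((hcrit xc).mpr rfl) (by linarith))
    rcases hx.lt_or_gt with hx | hx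
    · linarith [hlc x hx]
    · linarith [hrc x hx]
  · have hlam := hA.lam_neg
    obtain ⟨a, hax, ha⟩ : ∃ a < xc, lam + u0Real c z a < 0 := by
      have h1 := hbot.eventually (gt_mem_nhds (show 0 < -lam by linarith))
      obtain ⟨a, ha1, ha2⟩ := (h1.and (eventually_lt_atBot xc)).exists
      exact ⟨a, ha2, by linarith⟩
    obtain ⟨b, hbx, hb⟩ : ∃ b > xc, lam + u0Real c z b < 0 := by
      have h1 := htop.eventually (gt_mem_nhds (show 0 < -lam by linarith))
      obtain ⟨a, ha1, ha2⟩ := (h1.and (eventually_gt_atTop xc)).exists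
      exact ⟨a, ha2, by linarith⟩
    have hc' : Continuous fun x => lam + u0Real c z x := by fun_prop
    obtain ⟨x₁, hx₁, h1⟩ := intermediate_value_Ioo hax.le hc'.continuousOn ⟨ha, h0⟩
    obtain ⟨x₂, hx₂, h2⟩ := intermediate_value_Ioo' (le_of_lt hbx) hc'.continuousOn ⟨hb, h0⟩
    simp only at h1 h2
    refine .pair x₁ x₂ (hx₁.2.trans hx₂.1) h1 h2 (fun x hx => ?_) (fun x hx => ?_)
      (fun x hx hx' => ?_) (fun h => hx₁.2.ne ((hcrit _).mp h)) (fun h => hx₂.1.ne' ((hcrit _).mp h))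
    · linarith [hl' (show x < xc from hx.trans hx₁.2) hx₁.2 hx]
    · linarith [hr' hx₂.1 (show xc < x from hx₂.1.trans hx) hx]
    · rcases lt_trichotomy x xc with h | rfl | h
      · linarith [hl' hx₁.2 h hx]
      · exact h0
      · linarith [hr' h hx₂.1 hx']

/-- Lower bound for the number of critical points in the upper half-plane. -/
theorem le_card_critical (hA : IsAdmissible c z lam) (hS : RealSigns c z lam)
    (hsimple : ∀ w : ℂ, IsCritical c z lam w → 0 < w.im → deriv (u0 c z) w ≠ 0) :
    P ≤ {w | IsCritical c z lam w ∧ 0 < w.im}.ncard +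
      (open Classical in if ∃ x : ℝ, lam + u0Real c z x = 0 then 1 else 0) := by
  classical
  set N := criticalPoly c z lam with hN
  have hN0 : N ≠ 0 := hA.criticalPoly_ne_zero
  -- Upper roots are simple and so, by conjugation, are lower ones. With real multiplicity at most
  -- 2, the total 2P is at most 2·(number of upper roots) + 2, without the last term if no real root
  -- exists.
  have hcard : N.roots.card = 2 * P := by
    rw [← Polynomial.Splits.natDegree_eq_card_roots (IsAlgClosed.splits N), hN, criticalPoly,
      natDegree_numerator (by exact_mod_cast hA.lam_neg.ne)]
    simp [two_mul]
  rw [← Multiset.toFinset_sum_count_eq] at hcard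
  simp only [Polynomial.count_roots] at hcard
  set S := N.roots.toFinset with hS'
  have hmem : ∀ w, w ∈ S ↔ IsCritical c z lam w := fun w => by
    rw [hS', Multiset.mem_toFinset, Polynomial.mem_roots hN0, hA.isCritical_iff_isRoot]
  set U := S.filter fun w => 0 < w.im with hU
  set Lo := S.filter fun w => w.im < 0 with hLo
  set Re := S.filter fun w => w.im = 0 with hRe
  have hsplit : ∑ w ∈ S, N.rootMultiplicity w = ∑ w ∈ U, N.rootMultiplicity w +
      ∑ w ∈ Lo, N.rootMultiplicity w + ∑ w ∈ Re, N.rootMultiplicity w := by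
    rw [hU, hLo, hRe, Finset.sum_filter, Finset.sum_filter, Finset.sum_filter,
      ← Finset.sum_add_distrib, ← Finset.sum_add_distrib]
    refine Finset.sum_congr rfl fun w _ => ?_
    rcases lt_trichotomy w.im 0 with h | h | h
    · simp [h, h.ne, h.le]
    · simp [h]
    · simp [h, h.ne', h.le]
  have hUsum : ∑ w ∈ U, N.rootMultiplicity w = U.card := by
    rw [Finset.card_eq_sum_ones]
    refine Finset.sum_congr rfl fun w hw => ?_
    rw [hU, Finset.mem_filter, hmem] at hw
    exact hA.rootMultiplicity_eq_one hw.1 (hsimple w hw.1 hw.2)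
  have hderiv_conj : ∀ w, deriv (u0 c z) (conj w) = conj (deriv (u0 c z) w) := fun w => by
    have h1 : (conj ∘ u0 c z ∘ conj : ℂ → ℂ) = u0 c z := funext fun w => by
      simp [u0_conj]
    have h2 := congrFun (deriv_conj_conj (𝕜 := ℂ) (f := u0 c z)) (conj w)
    rw [h1] at h2
    simpa using h2
  have hLsum : ∑ w ∈ Lo, N.rootMultiplicity w = Lo.card := by
    rw [Finset.card_eq_sum_ones]
    refine Finset.sum_congr rfl fun w hw => ?_
    rw [hLo, Finset.mem_filter, hmem] at hw
    refine hA.rootMultiplicity_eq_one hw.1 fun h0 => hsimple _ hw.1.conj (by simpa using hw.2) ?_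
    rw [hderiv_conj, h0, map_zero]
  have hLU : Lo.card ≤ U.card := by
    refine Finset.card_le_card_of_injOn conj (fun w hw => ?_) (starRingEnd ℂ).injective.injOn
    have hw' := Finset.mem_filter.mp hw
    rw [hmem] at hw'
    simp only [hU, Finset.coe_filter, hmem, mem_ofPred_eq]
    exact ⟨hw'.1.conj, by simpa using hw'.2⟩
  have hUncard : {w | IsCritical c z lam w ∧ 0 < w.im}.ncard = U.card := by
    rw [← Set.ncard_coe_finset]
    congr 1
    ext w
    simp [hU, hmem]
  have hReal : ∀ w ∈ Re, ∃ x : ℝ, w = x ∧ lam + u0Real c z x = 0 := fun w hw => by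
    have hw' := Finset.mem_filter.mp hw
    rw [hmem] at hw'
    have : w = (w.re : ℂ) := by apply Complex.ext <;> simp [hw'.2]
    refine ⟨w.re, this, ?_⟩
    rw [← hA.isCritical_ofReal_iff, ← this]
    exact hw'.1
  have hRsum : ∑ w ∈ Re, N.rootMultiplicity w ≤
      2 * (if ∃ x : ℝ, lam + u0Real c z x = 0 then 1 else 0) := by
    cases hS with
    | none h =>
      rw [Finset.sum_eq_zero]
      · simp
      · intro w hw
        obtain ⟨x, -, hx⟩ := hReal w hw
        exact absurd hx (h x).ne
    | double x₀ h0 h h1 h2 =>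
      rw [if_pos ⟨x₀, h0⟩]
      have hsub : Re ⊆ {(x₀ : ℂ)} := fun w hw => by
        obtain ⟨x, rfl, hx⟩ := hReal w hw
        by_cases hxx : x = x₀
        · simp [hxx]
        · exact absurd hx (h x hxx).ne
      refine (Finset.sum_le_sum_of_subset hsub).trans ?_
      rw [Finset.sum_singleton, mul_one]
      refine hA.rootMultiplicity_le_two ((hA.isCritical_ofReal_iff x₀).mpr h0) ?_ ?_
      · rw [hA.deriv_u0_ofReal, h1, ofReal_zero]
      · rw [hA.deriv_deriv_u0_ofReal]; exact_mod_cast h2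
    | pair x₁ x₂ hlt h1 h2 hl hr hm hd1 hd2 =>
      rw [if_pos ⟨x₁, h1⟩]
      have hsub : Re ⊆ {(x₁ : ℂ), (x₂ : ℂ)} := fun w hw => by
        obtain ⟨x, rfl, hx⟩ := hReal w hw
        rcases lt_trichotomy x x₁ with h | rfl | h
        · exact absurd hx (hl x h).ne
        · simp
        rcases lt_trichotomy x x₂ with h' | rfl | h'
        · exact absurd hx (hm x h h').ne'
        · simp
        · exact absurd hx (hr x h').ne
      refine (Finset.sum_le_sum_of_subset hsub).trans ?_
      rw [Finset.sum_pair (by exact_mod_cast hlt.ne), mul_one,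
        hA.rootMultiplicity_eq_one ((hA.isCritical_ofReal_iff x₁).mpr h1),
        hA.rootMultiplicity_eq_one ((hA.isCritical_ofReal_iff x₂).mpr h2)]
      · rw [hA.deriv_u0_ofReal]; exact_mod_cast hd2
      · rw [hA.deriv_u0_ofReal]; exact_mod_cast hd1
  rw [hUncard]
  omega

end Data

/-! ### Components of superlevel and sublevel sets, by the maximum and minimum principles. -/

theorem notMem_of_mem_frontier_connectedComponentIn {O : Set ℂ} (hO : IsOpen O) {x q : ℂ}
    (hq : q ∈ frontier (connectedComponentIn O x)) : q ∉ O := fun hqO => by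
  have hV : IsOpen (connectedComponentIn O x) := hO.connectedComponentIn
  have hW : IsOpen (connectedComponentIn O q) := hO.connectedComponentIn
  rw [hV.frontier_eq] at hq
  obtain ⟨y, hyW, hyV⟩ := mem_closure_iff.mp hq.1 _ hW (mem_connectedComponentIn hqO)
  apply hq.2
  rw [connectedComponentIn_eq hyV, ← connectedComponentIn_eq hyW]
  exact mem_connectedComponentIn hqO

theorem subset_connectedComponentIn_of_inter {O S : Set ℂ} {x y : ℂ} (hS : IsPreconnected S)
    (hSO : S ⊆ O) (hy : y ∈ connectedComponentIn O x) (hyS : y ∈ S) :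
    S ⊆ connectedComponentIn O x := by
  rw [connectedComponentIn_eq hy]
  exact hS.subset_connectedComponentIn hyS hSO

/-- Polar coordinates present it as the image of a connected product. -/
theorem isPreconnected_punctured_ball (q : ℂ) (r : ℝ) :
    IsPreconnected (Metric.ball q r \ {q}) := by
  have h1 : Metric.ball q r \ {q} =
      (fun x : ℝ × ℝ => q + x.1 * exp (x.2 * I)) '' (Ioo 0 r ×ˢ univ) := by
    ext w
    constructor
    · rintro ⟨hw, hne⟩
      refine ⟨(‖w - q‖, arg (w - q)), ⟨⟨norm_pos_iff.mpr (sub_ne_zero.mpr hne), ?_⟩, mem_univ _⟩, ?_⟩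
      · rwa [← dist_eq_norm]
      · simp [norm_mul_exp_arg_mul_I]
    · rintro ⟨⟨s, t⟩, ⟨⟨hs0, hsr⟩, -⟩, rfl⟩
      refine ⟨?_, ?_⟩
      · rw [Metric.mem_ball, dist_eq_norm]
        simpa [norm_exp_ofReal_mul_I, abs_of_pos hs0] using hsr
      · simpa using (ne_of_gt hs0)
  rw [h1]
  exact (isPreconnected_Ioo.prod isPreconnected_univ).image _ (by fun_prop)

section Data

variable {c z : Fin P → ℂ} {lam : ℝ}

theorem R_ofReal_add_zero (hA : IsAdmissible c z lam) (x : ℝ) :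
    R c z lam (x + ((0 : ℝ) : ℂ) * I) = 0 := R_of_im_eq_zero hA (by simp)

/-- Local constancy would make a whole neighbourhood critical, whereas the critical points are
finite in number. -/
theorem not_eventually_const_exp (hA : IsAdmissible c z lam) {w : ℂ} {r : ℝ} (hr : 0 < r)
    {k : ℂ → ℂ} {k' : ℂ → ℂ} (hk : ∀ ζ ∈ Metric.ball w r, HasDerivAt k (k' ζ) ζ)
    (hk' : ∀ ζ ∈ Metric.ball w r, k' ζ = 0 → IsCritical c z lam ζ) :
    ¬ ∀ᶠ ζ in 𝓝 w, exp (k ζ) = exp (k w) := fun hev => by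
  refine infinite_of_mem_nhds w (?_ : {ζ | IsCritical c z lam ζ} ∈ 𝓝 w) hA.finite_isCritical
  filter_upwards [hev.eventually_nhds, Metric.ball_mem_nhds w hr] with ζ hζ hζr
  refine hk' ζ hζr ?_
  have h1 := (hk ζ hζr).cexp
  have h2 : HasDerivAt (fun ζ => exp (k ζ)) 0 ζ :=
    (hasDerivAt_const ζ (exp (k w))).congr_of_eventuallyEq hζ
  exact (mul_eq_zero.mp (h1.unique h2)).resolve_left (exp_ne_zero _)

/-- Locally e^R is the modulus of the holomorphic function e^k, so the maximum modulus principle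
applies. -/
theorem not_isLocalMax_R (hA : IsAdmissible c z lam) {w : ℂ} (hw : Regular z w) :
    ¬ IsLocalMax (R c z lam) w := fun hmax => by
  obtain ⟨r, hr, k, hk⟩ := exists_local_primitive hA hw
  refine not_eventually_const_exp hA hr (fun ζ hζ => (hk ζ hζ).2.1)
    (fun ζ hζ h0 => ⟨(hk ζ hζ).1, by simpa using h0⟩) ?_
  refine eventually_eq_of_isLocalMax_norm (f := fun ζ => exp (k ζ)) ?_ ?_
  · filter_upwards [Metric.ball_mem_nhds w hr] with ζ hζ
    exact (hk ζ hζ).2.1.cexp.differentiableAt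
  · filter_upwards [hmax, Metric.ball_mem_nhds w hr] with ζ hζ hζr
    simp only [Function.comp_apply, norm_exp, (hk ζ hζr).2.2,
      (hk w (Metric.mem_ball_self hr)).2.2]
    exact Real.exp_le_exp.mpr hζ

theorem not_isLocalMin_R (hA : IsAdmissible c z lam) {w : ℂ} (hw : Regular z w) :
    ¬ IsLocalMin (R c z lam) w := fun hmin => by
  obtain ⟨r, hr, k, hk⟩ := exists_local_primitive hA hw
  refine not_eventually_const_exp hA hr (k := fun ζ => - k ζ) (fun ζ hζ => (hk ζ hζ).2.1.neg)
    (fun ζ hζ h0 => ⟨(hk ζ hζ).1, by simpa using h0⟩) ?_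
  refine eventually_eq_of_isLocalMax_norm (f := fun ζ => exp (- k ζ)) ?_ ?_
  · filter_upwards [Metric.ball_mem_nhds w hr] with ζ hζ
    exact (hk ζ hζ).2.1.neg.cexp.differentiableAt
  · filter_upwards [hmin, Metric.ball_mem_nhds w hr] with ζ hζ hζr
    simp only [Function.comp_apply, norm_exp, neg_re, (hk ζ hζr).2.2,
      (hk w (Metric.mem_ball_self hr)).2.2]
    exact Real.exp_le_exp.mpr (neg_le_neg hζ)

theorem closure_eq_union_frontier_of_isOpen {V : Set ℂ} {q : ℂ} (hq : q ∈ closure V) :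
    q ∈ V ∨ q ∈ frontier V := by
  rw [closure_eq_self_union_frontier] at hq
  exact hq

/-- Maximum principle for `R`. -/
theorem max_principle (hA : IsAdmissible c z lam) {v : ℝ} {V : Set ℂ} (hVo : IsOpen V)
    (hne : V.Nonempty) (hb : Bornology.IsBounded V) (hV : ∀ w ∈ V, Regular z w ∧ v < R c z lam w)
    (hfr : ∀ w ∈ frontier V, Regular z w ∧ R c z lam w ≤ v) : False := by
  have hreg : ∀ w ∈ closure V, Regular z w := fun w hw =>
    (closure_eq_union_frontier_of_isOpen hw).elim (fun h => (hV w h).1) fun h => (hfr w h).1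
  obtain ⟨q, hq, hmax⟩ := hb.isCompact_closure.exists_isMaxOn hne.closure
    (fun w hw => (continuousAt_R hA (hreg w hw)).continuousWithinAt)
  obtain ⟨a, ha⟩ := hne
  have hqv : v < R c z lam q := (hV a ha).2.trans_le (hmax (subset_closure ha))
  rcases closure_eq_union_frontier_of_isOpen hq with h | h
  · exact not_isLocalMax_R hA (hreg q hq)
      (hmax.isLocalMax (mem_of_superset (hVo.mem_nhds h) subset_closure))
  · exact absurd (hfr q h).2 (not_le.mpr hqv)

/-- Minimum principle for `R`. -/
theorem min_principle (hA : IsAdmissible c z lam) {v : ℝ} {V : Set ℂ} (hVo : IsOpen V)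
    (hne : V.Nonempty) (hb : Bornology.IsBounded V) (hV : ∀ w ∈ V, Regular z w ∧ R c z lam w < v)
    (hfr : ∀ w ∈ frontier V, Regular z w ∧ (v ≤ R c z lam w ∨ closure V ∈ 𝓝 w)) : False := by
  have hreg : ∀ w ∈ closure V, Regular z w := fun w hw =>
    (closure_eq_union_frontier_of_isOpen hw).elim (fun h => (hV w h).1) fun h => (hfr w h).1
  obtain ⟨q, hq, hmin⟩ := hb.isCompact_closure.exists_isMinOn hne.closure
    (fun w hw => (continuousAt_R hA (hreg w hw)).continuousWithinAt)
  obtain ⟨a, ha⟩ := hne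
  have hqv : R c z lam q < v := (hmin (subset_closure ha)).trans_lt (hV a ha).2
  -- A boundary point with a full neighbourhood in the closure of V is as good as an interior point.
  -- This admits isolated punctures of V, as produced by removing critical points.
  have hnhds : closure V ∈ 𝓝 q := by
    rcases closure_eq_union_frontier_of_isOpen hq with h | h
    · exact mem_of_superset (hVo.mem_nhds h) subset_closure
    · exact (hfr q h).2.resolve_left (not_le.mpr hqv)
  exact not_isLocalMin_R hA (hreg q hq) (hmin.isLocalMin hnhds)

/-- The superlevel sets of `R` in the upper half-plane, including the poles; the lower half-plane is
added for negative levels. -/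
def superlevel (c z : Fin P → ℂ) (lam v : ℝ) : Set ℂ :=
  {w | (0 < w.im ∧ (w ∈ range z ∨ v < R c z lam w)) ∨ (v < 0 ∧ w.im ≤ 0)}

theorem isOpen_superlevel (hA : IsAdmissible c z lam) (v : ℝ) :
    IsOpen (superlevel c z lam v) := by
  rw [isOpen_iff_mem_nhds]
  rintro w (⟨him, hw⟩ | ⟨hv, him⟩)
  · have hup : ∀ᶠ ζ : ℂ in 𝓝 w, 0 < ζ.im := continuous_im.continuousAt.eventually (lt_mem_nhds him)
    by_cases hp : w ∈ range z
    · obtain ⟨p, rfl⟩ := hp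
      have h1 := (tendsto_R_pole hA p).eventually (eventually_gt_atTop v)
      rw [eventually_nhdsWithin_iff] at h1
      filter_upwards [hup, h1] with ζ h2 h3
      by_cases hζ : ζ = z p
      · exact Or.inl ⟨h2, Or.inl ⟨p, hζ.symm⟩⟩
      · exact Or.inl ⟨h2, Or.inr (h3 hζ)⟩
    · have hreg := hA.regular_of_im_pos him fun p h => hp ⟨p, h.symm⟩
      filter_upwards [hup, (continuousAt_R hA hreg).eventually (lt_mem_nhds (hw.resolve_left hp))]
        with ζ h2 h3
      exact Or.inl ⟨h2, Or.inr h3⟩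
  · rcases him.lt_or_eq with him | him
    · filter_upwards [continuous_im.continuousAt.eventually (gt_mem_nhds him)] with ζ hζ
      exact Or.inr ⟨hv, le_of_lt hζ⟩
    · have hw : w = (w.re : ℂ) := by apply Complex.ext <;> simp [him]
      have hreg : Regular z w := by rw [hw]; exact hA.regular_real _
      filter_upwards [(continuousAt_R hA hreg).eventually
        (lt_mem_nhds (show v < R c z lam w by rwa [R_of_im_eq_zero hA him]))] with ζ hζ
      rcases le_or_gt ζ.im 0 with h | h
      · exact Or.inr ⟨hv, h⟩
      · exact Or.inl ⟨h, Or.inr hζ⟩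

/-- A component without poles would be a bounded open set with R > v inside and R ≤ v on the
boundary, against the maximum principle. -/
theorem exists_pole_mem_component (hA : IsAdmissible c z lam) {v : ℝ} {ζ : ℂ}
    (hζ : ζ ∈ superlevel c z lam v) :
    ∃ p, z p ∈ connectedComponentIn (superlevel c z lam v) ζ ∨
      conj (z p) ∈ connectedComponentIn (superlevel c z lam v) ζ := by
  by_contra hno
  push Not at hno
  set O := superlevel c z lam v with hO
  set V := connectedComponentIn O ζ with hV
  have hOo : IsOpen O := isOpen_superlevel hA v
  have hVO : V ⊆ O := connectedComponentIn_subset _ _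
  -- A component meeting the closed lower half-plane swallows all of it, including the conjugate
  -- poles.
  have hup : ∀ w ∈ V, 0 < w.im := by
    intro w hw
    by_contra him
    have hv : v < 0 := (hVO hw).elim (fun h => absurd h.1 him) fun h => h.1
    have hsub : {w : ℂ | w.im ≤ 0} ⊆ V := subset_connectedComponentIn_of_inter
      (convex_halfSpace_im_le 0).isPreconnected (fun w hw => Or.inr ⟨hv, hw⟩) hw (not_lt.mp him)
    refine (hno ⟨0, hA.size_pos⟩).2 (hsub ?_)
    have := hA.im_pos ⟨0, hA.size_pos⟩
    simp [this.le]
  have hreg : ∀ w ∈ V, Regular z w := fun w hw => hA.regular_of_im_pos (hup w hw) fun p h =>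
    (hno p).1 (h ▸ hw)
  have hR : ∀ w ∈ V, v < R c z lam w := fun w hw => by
    rcases hVO hw with ⟨h1, ⟨p, h2⟩ | h2⟩ | h1
    · exact absurd hw (h2 ▸ (hno p).1)
    · exact h2
    · exact absurd (hup w hw) (not_lt.mpr h1.2)
  obtain ⟨K, hK0, -, hK⟩ := exists_radius hA
  obtain ⟨K', hK'0, C, hC, hK'⟩ := exists_R_le hA
  have hlam := hA.lam_neg
  refine max_principle hA hOo.connectedComponentIn ⟨ζ, mem_connectedComponentIn hζ⟩ ?_
    (fun w hw => ⟨hreg w hw, hR w hw⟩) fun q hq => ?_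
  · refine (Metric.isBounded_closedBall (x := (0 : ℂ)) (r := max K' (K + |(v - C) / lam|))).subset
      fun w hw => ?_
    rw [mem_closedBall_zero_iff]
    by_contra hlt
    rw [not_le, max_lt_iff] at hlt
    have h1 := (hR w hw).trans_le (hK' w hlt.1.le)
    have him : w.im < (v - C) / lam := by rw [lt_div_iff_of_neg hlam]; linarith
    have hw0 := hup w hw
    have hre : K ≤ |w.re| := by
      have h2 := norm_le_abs_re_add_abs_im w
      rw [abs_of_pos hw0] at h2
      linarith [le_abs_self ((v - C) / lam)]
    have hw' : w = w.re + w.im * I := (re_add_im w).symm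
    -- Far to the side `R` only grows on the way down. For v ≥ 0 this contradicts R = 0 on the real
    -- line; for v < 0 the component would reach the real line.
    have hmono : ∀ s ∈ Icc 0 w.im, R c z lam w ≤ R c z lam (w.re + s * I) := fun s hs => by
      have h3 := R_vertical_le hA hK (x := w.re) hs.2 fun s _ => le_norm_of_le_abs_re hre
      rw [← hw'] at h3
      nlinarith [hs.2]
    rcases le_or_gt 0 v with hv | hv
    · have h3 := hmono 0 ⟨le_rfl, hw0.le⟩
      rw [R_ofReal_add_zero hA] at h3
      linarith [hR w hw]
    · have hsub : (fun s : ℝ => (w.re + s * I : ℂ)) '' Icc 0 w.im ⊆ V := by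
        refine subset_connectedComponentIn_of_inter (isPreconnected_Icc.image _ (by fun_prop)) ?_ hw
          ⟨w.im, ⟨hw0.le, le_rfl⟩, hw'.symm⟩
        rintro _ ⟨s, hs, rfl⟩
        rcases hs.1.eq_or_lt with h0 | h0
        · exact Or.inr ⟨hv, by simp [← h0]⟩
        · exact Or.inl ⟨by simpa using h0, Or.inr ((hR w hw).trans_le (hmono s hs))⟩
      have := hup _ (hsub ⟨0, ⟨le_rfl, hw0.le⟩, rfl⟩)
      simp at this
  · have hqO := notMem_of_mem_frontier_connectedComponentIn hOo hq
    have him : 0 ≤ q.im := by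
      have hcl : closure V ⊆ {w : ℂ | 0 ≤ w.im} :=
        closure_minimal (fun w hw => (hup w hw).le) (isClosed_le continuous_const continuous_im)
      exact hcl hq.1
    rcases him.eq_or_lt with him | him
    · have hq' : q = (q.re : ℂ) := by apply Complex.ext <;> simp [← him]
      refine ⟨by rw [hq']; exact hA.regular_real _, ?_⟩
      rw [R_of_im_eq_zero hA him.symm]
      by_contra hv
      exact hqO (Or.inr ⟨not_le.mp hv, him.symm.le⟩)
    · refine ⟨hA.regular_of_im_pos him fun p h => hqO (Or.inl ⟨him, Or.inl ⟨p, h.symm⟩⟩), ?_⟩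
      by_contra hv
      exact hqO (Or.inl ⟨him, Or.inr (not_le.mp hv)⟩)

/-- Sublevel sets of `R` in the upper half-plane, without poles and critical points. -/
def sublevel (c z : Fin P → ℂ) (lam v : ℝ) : Set ℂ :=
  {w | 0 < w.im ∧ Regular z w ∧ ¬ IsCritical c z lam w ∧ R c z lam w < v}

theorem isOpen_lt_R (hA : IsAdmissible c z lam) (v : ℝ) :
    IsOpen {w | Regular z w ∧ R c z lam w < v} := by
  rw [isOpen_iff_mem_nhds]
  rintro w ⟨hw, hR⟩
  filter_upwards [(isOpen_regular z).mem_nhds hw, (continuousAt_R hA hw).eventually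
    (gt_mem_nhds hR)] with ζ h1 h2
  exact ⟨h1, h2⟩

theorem isOpen_sublevel (hA : IsAdmissible c z lam) (v : ℝ) : IsOpen (sublevel c z lam v) := by
  have h1 : IsOpen {w : ℂ | 0 < w.im} := isOpen_lt continuous_const continuous_im
  have h2 := hA.finite_isCritical.isClosed.isOpen_compl
  convert h1.inter (h2.inter (isOpen_lt_R hA v)) using 1
  ext w
  simp only [sublevel, mem_ofPred_eq, mem_inter_iff, mem_compl_iff]
  tauto

theorem not_isCritical_of_far (hA : IsAdmissible c z lam) {w : ℂ} (h : ‖u0 c z w‖ ≤ -lam / 2) :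
    ¬ IsCritical c z lam w := fun hc => by
  have h1 : u0 c z w = -(lam : ℂ) := by linear_combination hc.2
  have hlam := hA.lam_neg
  rw [h1, norm_neg, norm_real, Real.norm_eq_abs, abs_of_neg hlam] at h
  linarith

/-- Every component of a sublevel set reaches all points high up. -/
theorem exists_height_subset_component (hA : IsAdmissible c z lam) (v : ℝ) : ∃ Y : ℝ,
    ∀ a ∈ sublevel c z lam v, {w : ℂ | Y < w.im} ⊆ connectedComponentIn (sublevel c z lam v) a := by
  obtain ⟨K, hK0, -, hK⟩ := exists_radius hA
  obtain ⟨K', hK'0, C, hC, hK'⟩ := exists_R_le hA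
  have hlam := hA.lam_neg
  set O := sublevel c z lam v with hO
  have hOo : IsOpen O := isOpen_sublevel hA v
  set Y := max (max K K') ((v - C) / lam) with hY
  have hYO : {w : ℂ | Y < w.im} ⊆ O := fun w (hw : Y < w.im) => by
    rw [hY, max_lt_iff, max_lt_iff] at hw
    have hn := (le_abs_self _).trans (abs_im_le_norm w)
    have h1 := hK w (by linarith)
    refine ⟨by linarith, h1.1, not_isCritical_of_far hA h1.2,
      (hK' w (by linarith)).trans_lt ?_⟩
    have := (div_lt_iff_of_neg hlam).mp hw.2
    linarith
  refine ⟨Y, fun a ha => ?_⟩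
  set V := connectedComponentIn O a with hV
  have hVO : V ⊆ O := connectedComponentIn_subset _ _
  by_contra hcon
  have hlow : ∀ w ∈ V, w.im ≤ Y := fun w hw => by
    by_contra h
    exact hcon (subset_connectedComponentIn_of_inter
      (convex_halfSpace_im_gt Y).isPreconnected hYO hw (not_le.mp h))
  -- From a point far to the side the upward vertical ray stays in the sublevel set, so the
  -- component would exceed the height Y.
  have hnear : ∀ w ∈ V, |w.re| < K := fun w hw => by
    by_contra hre
    rw [not_lt] at hre
    have hw' : w = w.re + w.im * I := (re_add_im w).symm
    have hsub : (fun s : ℝ => (w.re + s * I : ℂ)) '' Ici w.im ⊆ V := by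
      refine subset_connectedComponentIn_of_inter (isPreconnected_Ici.image _ (by fun_prop)) ?_ hw
        ⟨w.im, mem_Ici.mpr le_rfl, hw'.symm⟩
      rintro _ ⟨s, hs, rfl⟩
      have h1 := hK _ (le_norm_of_le_abs_re (s := s) hre)
      have h3 := R_vertical_le hA hK (x := w.re) hs fun s _ => le_norm_of_le_abs_re hre
      rw [← hw'] at h3
      have h4 := (hVO hw)
      refine ⟨by simpa using h4.1.trans_le hs, h1.1, not_isCritical_of_far hA h1.2, ?_⟩
      have h5 : lam / 2 * (s - w.im) ≤ 0 :=
        mul_nonpos_of_nonpos_of_nonneg (by linarith) (sub_nonneg.mpr hs)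
      linarith [h4.2.2.2]
    have := hlow _ (hsub ⟨max w.im (Y + 1), mem_Ici.mpr (le_max_left _ _), rfl⟩)
    simp at this
    linarith [this.2]
  refine min_principle hA hOo.connectedComponentIn ⟨a, mem_connectedComponentIn ha⟩ (v := v) ?_
    (fun w hw => ⟨(hVO hw).2.1, (hVO hw).2.2.2⟩) fun q hq => ?_
  · refine (Metric.isBounded_closedBall (x := (0 : ℂ)) (r := K + Y)).subset fun w hw => ?_
    rw [mem_closedBall_zero_iff]
    refine (norm_le_abs_re_add_abs_im w).trans ?_
    rw [abs_of_pos (hVO hw).1]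
    linarith [hnear w hw, hlow w hw]
  · have hqO := notMem_of_mem_frontier_connectedComponentIn hOo hq
    have hqcl : q ∈ closure V := hq.1
    have him : 0 ≤ q.im := by
      have hcl : closure V ⊆ {w : ℂ | 0 ≤ w.im} :=
        closure_minimal (fun w hw => (hVO hw).1.le) (isClosed_le continuous_const continuous_im)
      exact hcl hqcl
    rcases him.eq_or_lt with him | him
    · have hq' : q = (q.re : ℂ) := by apply Complex.ext <;> simp [← him]
      refine ⟨by rw [hq']; exact hA.regular_real _, Or.inl ?_⟩
      rw [R_of_im_eq_zero hA him.symm]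
      by_contra hv
      rw [not_le] at hv
      -- A boundary point on the real line is harmful only for v > 0. Then a thin strip above the
      -- whole real line lies in the sublevel set: by compactness over [-K, K], and by the vertical
      -- descent of `R` elsewhere. A component touching the strip contains it, and so has points
      -- with real part K.
      set G := {w | Regular z w ∧ R c z lam w < v} ∩ ({w | IsCritical c z lam w} ∩ {w | 0 < w.im})ᶜ
        with hG
      have hGo : IsOpen G := (isOpen_lt_R hA v).inter
        (hA.finite_isCritical.subset inter_subset_left).isClosed.isOpen_compl
      have hKc : IsCompact ((fun x : ℝ => (x : ℂ)) '' Icc (-K) K) :=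
        isCompact_Icc.image continuous_ofReal
      obtain ⟨δ, hδ, hthick⟩ := hKc.exists_thickening_subset_open hGo (by
        rintro _ ⟨x, -, rfl⟩
        exact ⟨⟨hA.regular_real x, by rwa [R_ofReal hA]⟩, fun h => by simpa using h.2⟩)
      have hTO : {w : ℂ | 0 < w.im} ∩ {w : ℂ | w.im < δ} ⊆ O := by
        rintro w ⟨hw0 : 0 < w.im, hwδ : w.im < δ⟩
        have hw' : w = w.re + w.im * I := (re_add_im w).symm
        rcases le_or_gt |w.re| K with h | h
        · have hwG : w ∈ G := hthick (Metric.mem_thickening_iff.mpr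
            ⟨w.re, ⟨w.re, abs_le.mp h, rfl⟩, by
              rw [dist_eq_norm]
              nth_rewrite 1 [hw']
              rwa [add_sub_cancel_left, norm_mul, norm_I, mul_one, norm_real, Real.norm_eq_abs,
                abs_of_pos hw0]⟩)
          exact ⟨hw0, hwG.1.1, fun hc => hwG.2 ⟨hc, hw0⟩, hwG.1.2⟩
        · have h1 := hK w (h.le.trans (abs_re_le_norm w))
          refine ⟨hw0, h1.1, not_isCritical_of_far hA h1.2, ?_⟩
          have h3 := R_vertical_le hA hK (x := w.re) hw0.le fun s _ => le_norm_of_le_abs_re h.le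
          rw [← hw', R_ofReal_add_zero hA] at h3
          have : lam / 2 * (w.im - 0) < 0 := mul_neg_of_neg_of_pos (by linarith) (by linarith)
          linarith
      have hconv := ((convex_halfSpace_im_gt 0).inter (convex_halfSpace_im_lt δ)).isPreconnected
      obtain ⟨w, hwδ, hwV⟩ := mem_closure_iff.mp hqcl {w : ℂ | w.im < δ}
        (isOpen_lt continuous_im continuous_const) (by simpa [← him] using hδ)
      have hTV := subset_connectedComponentIn_of_inter hconv hTO hwV ⟨(hVO hwV).1, hwδ⟩
      have := hnear _ (hTV (show (K + (δ / 2 : ℝ) * I : ℂ) ∈ _ from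
        ⟨by simpa using hδ, by simpa using half_lt_self hδ⟩))
      simp only [add_re, ofReal_re, mul_re, I_re, mul_zero, ofReal_im, I_im, mul_one, sub_self,
        add_zero] at this
      exact absurd this (not_lt.mpr (le_abs_self K))
    · have hreg : Regular z q := by
        refine hA.regular_of_im_pos him fun p h => ?_
        -- Poles stay away from the closure, as `R` tends to +∞ there.
        subst h
        have h1 := (tendsto_R_pole hA p).eventually (eventually_gt_atTop v)
        rw [eventually_nhdsWithin_iff] at h1
        obtain ⟨w, hw1, hw2⟩ := mem_closure_iff_nhds.mp hqcl _ h1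
        have h2 := hVO hw2
        have h3 := hw1 (fun h => (h2.2.1 p).1 h)
        linarith [h2.2.2.2]
      refine ⟨hreg, ?_⟩
      by_contra! hcon2
      obtain ⟨hv, hcl⟩ := hcon2
      -- A boundary point below the level can only be one of the removed critical points; a
      -- punctured disk around it then lies in V.
      have hcr : IsCritical c z lam q := by
        by_contra h; exact hqO ⟨him, hreg, h, hv⟩
      apply hcl
      have hfin : ({w | IsCritical c z lam w} \ {q})ᶜ ∈ 𝓝 q :=
        (hA.finite_isCritical.subset sdiff_subset).isClosed.isOpen_compl.mem_nhds (by simp)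
      have hev : ∀ᶠ w in 𝓝 q, w ≠ q → w ∈ O := by
        filter_upwards [hfin, continuous_im.continuousAt.eventually (lt_mem_nhds him),
          (isOpen_lt_R hA v).mem_nhds ⟨hreg, hv⟩] with w h1 h2 h3 h4
        exact ⟨h2, h3.1, fun h5 => h1 ⟨h5, h4⟩, h3.2⟩
      obtain ⟨r, hr, hball⟩ := Metric.eventually_nhds_iff_ball.mp hev
      have hsub : Metric.ball q r \ {q} ⊆ V := by
        obtain ⟨w, hw1, hw2⟩ := mem_closure_iff.mp hqcl _ Metric.isOpen_ball
          (Metric.mem_ball_self hr)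
        refine subset_connectedComponentIn_of_inter ?_ (fun w hw => hball w hw.1 hw.2) hw2
          ⟨hw1, fun h => hqO (h ▸ hVO hw2)⟩
        exact isPreconnected_punctured_ball q r
      refine mem_of_superset (Metric.ball_mem_nhds q hr) fun w hw => ?_
      by_cases h : w = q
      · exact h ▸ hqcl
      · exact subset_closure (hsub ⟨hw, h⟩)

end Data

/-! ### Piecewise C¹ paths to i∞ and their concatenation. -/

/-- Lipschitz, piecewise `C¹` curves. -/
def IsPW (γ : ℝ → ℂ) : Prop :=
  (∃ K : NNReal, LipschitzWith K γ) ∧ ∃ B : Finset ℝ, ∀ t, t ∉ B → ContDiffAt ℝ 1 γ t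

theorem isPW_line (a b : ℂ) : IsPW fun t => a + t * b := by
  refine ⟨⟨‖b‖₊, LipschitzWith.of_dist_le_mul fun s t => ?_⟩, ∅, fun t _ => ?_⟩
  · rw [dist_eq_norm, dist_eq_norm, add_sub_add_left_eq_sub, ← sub_mul, norm_mul, mul_comm,
      ← ofReal_sub, norm_real, coe_nnnorm]
  · have : ContDiff ℝ 1 (fun t : ℝ => (t : ℂ)) := ofRealCLM.contDiff
    fun_prop

theorem IsPW.comp_affine {γ : ℝ → ℂ} (hγ : IsPW γ) {e : ℝ} (he : |e| = 1) (a : ℝ) :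
    IsPW fun t => γ (e * t + a) := by
  classical
  obtain ⟨⟨K, hK⟩, B, hB⟩ := hγ
  have he0 : e ≠ 0 := fun h => by simp [h] at he
  refine ⟨⟨K, LipschitzWith.of_dist_le_mul fun s t => (hK.dist_le_mul _ _).trans_eq ?_⟩,
    B.image fun b => (b - a) / e, fun t ht => ?_⟩
  · rw [Real.dist_eq, Real.dist_eq, add_sub_add_right_eq_sub, ← mul_sub, abs_mul, he, one_mul]
  · have h1 : e * t + a ∉ B := fun h => ht (Finset.mem_image.mpr ⟨_, h, by field_simp; ring⟩)
    exact (hB _ h1).comp t (by fun_prop)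

/-- Concatenation at time `s`. -/
noncomputable def glue (s : ℝ) (γ₁ γ₂ : ℝ → ℂ) (t : ℝ) : ℂ := if t ≤ s then γ₁ t else γ₂ t

theorem glue_of_le {s t : ℝ} (h : t ≤ s) (γ₁ γ₂ : ℝ → ℂ) : glue s γ₁ γ₂ t = γ₁ t := if_pos h

theorem glue_of_ge {s t : ℝ} {γ₁ γ₂ : ℝ → ℂ} (hs : γ₁ s = γ₂ s) (h : s ≤ t) :
    glue s γ₁ γ₂ t = γ₂ t := by
  rcases h.eq_or_lt with rfl | h
  · rw [glue_of_le le_rfl, hs]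
  · exact if_neg (not_le.mpr h)

theorem IsPW.glue {γ₁ γ₂ : ℝ → ℂ} (h₁ : IsPW γ₁) (h₂ : IsPW γ₂) {s : ℝ} (hs : γ₁ s = γ₂ s) :
    IsPW (glue s γ₁ γ₂) := by
  classical
  obtain ⟨⟨K₁, hK₁⟩, B₁, hB₁⟩ := h₁
  obtain ⟨⟨K₂, hK₂⟩, B₂, hB₂⟩ := h₂
  have h1 := hK₁.weaken (le_max_left K₁ K₂)
  have h2 := hK₂.weaken (le_max_right K₁ K₂)
  refine ⟨⟨max K₁ K₂, LipschitzWith.of_dist_le_mul fun t u => ?_⟩, insert s (B₁ ∪ B₂), fun t ht => ?_⟩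
  · wlog htu : t ≤ u generalizing t u
    · rw [dist_comm, dist_comm t u]; exact this u t (le_of_not_ge htu)
    rcases le_total u s with hu | hu
    · rw [glue_of_le hu, glue_of_le (htu.trans hu)]; exact h1.dist_le_mul _ _
    rcases le_total s t with ht | ht
    · rw [glue_of_ge hs hu, glue_of_ge hs ht]; exact h2.dist_le_mul _ _
    rw [glue_of_ge hs hu, glue_of_le ht]
    refine (dist_triangle _ (γ₁ s) _).trans ?_
    have h3 := h1.dist_le_mul t s
    have h4 := h2.dist_le_mul s u
    rw [← hs] at h4
    rw [Real.dist_eq, abs_of_nonpos (by linarith)] at h3 h4 ⊢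
    nlinarith
  · simp only [Finset.mem_insert, Finset.mem_union, not_or] at ht
    rcases lt_or_gt_of_ne ht.1 with h | h
    · refine (hB₁ t ht.2.1).congr_of_eventuallyEq ?_
      filter_upwards [gt_mem_nhds h] with u hu
      exact glue_of_le hu.le _ _
    · refine (hB₂ t ht.2.2).congr_of_eventuallyEq ?_
      filter_upwards [lt_mem_nhds h] with u hu
      exact glue_of_ge hs hu.le

/-- There is a piecewise `C¹` path in `O` from `a` to `i∞`, eventually vertical. -/
def UpPath (O : Set ℂ) (a : ℂ) : Prop :=
  ∃ γ, IsPW γ ∧ γ 0 = a ∧ (∀ t ≥ 0, γ t ∈ O) ∧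
    ∃ x b T : ℝ, ∀ t ≥ T, γ t = x + ((t + b : ℝ) : ℂ) * I

theorem upPath_of_vertical {O : Set ℂ} {a : ℂ} (h : ∀ s ≥ a.im, (a.re + s * I : ℂ) ∈ O) :
    UpPath O a := by
  refine ⟨fun t => a + t * I, isPW_line a I, by simp, fun t ht => ?_, a.re, a.im, 0, fun t _ => ?_⟩
  · have := h (a.im + t) (by linarith)
    convert this using 1
    apply Complex.ext <;> simp
  · apply Complex.ext <;> simp [add_comm]

theorem UpPath.prepend {O : Set ℂ} {a b : ℂ} (hb : UpPath O b) (hseg : segment ℝ a b ⊆ O) :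
    UpPath O a := by
  obtain ⟨γ, hγ, h0, hO, x, d, T, hT⟩ := hb
  have hglue : (fun t : ℝ => a + t * (b - a)) 1 = (fun t => γ (1 * t + (-1))) 1 := by simp [h0]
  refine ⟨glue 1 (fun t => a + t * (b - a)) fun t => γ (1 * t + (-1)),
    (isPW_line a (b - a)).glue (hγ.comp_affine (by simp) _) hglue, ?_, fun t ht => ?_,
    x, d - 1, max 1 (T + 1), fun t ht => ?_⟩
  · rw [glue_of_le zero_le_one]; simp
  · rcases le_total t 1 with h1 | h1
    · rw [glue_of_le h1]
      refine hseg ((segment_eq_image' ℝ a b) ▸ ⟨t, ⟨ht, h1⟩, ?_⟩)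
      simp
    · rw [glue_of_ge hglue h1]
      exact hO _ (by linarith)
  · rw [glue_of_ge hglue ((le_max_left _ _).trans ht), hT _ (by linarith [(le_max_right _ _).trans ht])]
    push_cast; ring

/-- The tails of a `UContour` must have height equal to the parameter; this removes the height
offset and moves the starting time to `s`. -/
theorem UpPath.normalize {O : Set ℂ} {a : ℂ} (ha : UpPath O a) (s : ℝ) :
    ∃ γ, IsPW γ ∧ γ s = a ∧ (∀ t ≥ s, γ t ∈ O) ∧ ∃ x T : ℝ, ∀ t ≥ T, γ t = x + t * I := by
  obtain ⟨γ, hγ, h0, hO, x, b, T, hT⟩ := ha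
  set T₁ := max (T + s) s with hT₁
  set e := b - s with he
  set T₂ := T₁ + 1 + |e| with hT₂
  have hpos : 0 < T₂ - T₁ := by rw [hT₂]; linarith [abs_nonneg e]
  have hpos' : 0 < T₂ - T₁ - e := by rw [hT₂]; linarith [le_abs_self e]
  have htail : ∀ t ≥ T₁, γ (1 * t + -s) = x + ((t + e : ℝ) : ℂ) * I := fun t ht => by
    rw [hT _ (by linarith [(le_max_left (T + s) s).trans ht]), he]; push_cast; ring
  have hTO : ∀ y ≥ T₁ + e, (x + y * I : ℂ) ∈ O := fun y hy => by
    have h1 := htail (y - e) (by linarith)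
    have h2 := hO (1 * (y - e) + -s) (by linarith [le_max_right (T + s) s])
    rw [h1] at h2
    simpa using h2
  -- On [T₁, T₂] the path climbs from height T₁ + e to T₂, so that the offset e is gone at T₂. The
  -- choice of T₂ makes the speed positive.
  let γ₂ : ℝ → ℂ := fun t => ((x : ℂ) + ((T₁ + e - T₁ * ((T₂ - T₁ - e) / (T₂ - T₁)) : ℝ) : ℂ) * I) +
    t * ((((T₂ - T₁ - e) / (T₂ - T₁) : ℝ) : ℂ) * I)
  let γ₃ : ℝ → ℂ := fun t => (x : ℂ) + t * I
  have hγ₂ : ∀ t : ℝ, γ₂ t =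
      x + ((T₁ + e + (t - T₁) * ((T₂ - T₁ - e) / (T₂ - T₁)) : ℝ) : ℂ) * I := fun t => by
    simp only [γ₂]; push_cast; ring
  have hg1 : γ₂ T₂ = γ₃ T₂ := by
    rw [hγ₂, mul_div_cancel₀ _ hpos.ne']
    simp only [γ₃]; push_cast; ring
  have hPW2 : IsPW (BenjaminOno.glue T₂ γ₂ γ₃) := (isPW_line _ _ : IsPW γ₂).glue (isPW_line _ _ : IsPW γ₃) hg1
  have hg2 : (fun t => γ (1 * t + -s)) T₁ = glue T₂ γ₂ γ₃ T₁ := by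
    rw [glue_of_le (by linarith), hγ₂]
    simp only [htail T₁ le_rfl, sub_self, zero_mul, add_zero]
  refine ⟨_, (hγ.comp_affine (by simp : |(1 : ℝ)| = 1) (-s)).glue hPW2 hg2, ?_, fun t ht => ?_, x,
    T₂, fun t ht => ?_⟩
  · rw [glue_of_le (le_max_right _ _)]; simp [h0]
  · rcases le_total t T₁ with h1 | h1
    · rw [glue_of_le h1]; exact hO _ (by linarith)
    rw [glue_of_ge hg2 h1]
    rcases le_total t T₂ with h2 | h2
    · rw [glue_of_le h2, hγ₂]
      refine hTO _ ?_
      have := mul_nonneg (sub_nonneg.mpr h1) (div_pos hpos' hpos).le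
      linarith
    · rw [glue_of_ge hg1 h2]
      exact hTO _ (by linarith)
  · rw [glue_of_ge hg2 (by linarith), glue_of_ge hg1 ht]

/-- Completing a curve over `[a, b]` to a contour by paths to `i∞`. -/
theorem exists_contour {O : Set ℂ} {σ : ℝ → ℂ} (hσ : IsPW σ) {a b : ℝ} (hab : a ≤ b)
    (ha : UpPath O (σ a)) (hb : UpPath O (σ b)) :
    ∃ γ : UContour, (∀ t ∈ Icc a b, γ t = σ t) ∧ ∀ t, t ≤ a ∨ b ≤ t → γ t ∈ O := by
  obtain ⟨γr, hr, hr0, hrO, xr, Tr, hTr⟩ := hb.normalize b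
  obtain ⟨γl, hl, hl0, hlO, xl, Tl, hTl⟩ := ha.normalize (-a)
  have hg1 : σ b = γr b := hr0.symm
  -- The left tail is an upward path run backwards, hence the normalization at time -a.
  have hg2 : (fun t => γl (-1 * t + 0)) a = glue b σ γr a := by
    rw [glue_of_le hab]; simp [hl0]
  have hPW := (hl.comp_affine (by simp : |(-1 : ℝ)| = 1) 0).glue (hσ.glue hr hg1) hg2
  obtain ⟨hLip, B, hB⟩ := hPW
  refine ⟨⟨_, B, xl, xr, hLip, hB, max (max Tr b) (max Tl (-a)), fun t ht => ?_, fun t ht => ?_⟩,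
    fun t ht => ?_, fun t ht => ?_⟩
  · have h1 := (le_max_left _ _).trans ht
    have h2 := (le_max_left _ _).trans h1
    have h3 := (le_max_right _ _).trans h1
    rw [glue_of_ge hg2 (hab.trans h3), glue_of_ge hg1 h3, hTr t h2]
  · have h1 := (le_max_right _ _).trans (le_neg.mp ht)
    have h2 := (le_max_left _ _).trans h1
    have h3 := (le_max_right _ _).trans h1
    rw [glue_of_le (by linarith), hTl _ (by linarith)]
    push_cast; ring
  · change glue a (fun t => γl (-1 * t + 0)) (glue b σ γr) t = _
    rw [glue_of_ge hg2 ht.1, glue_of_le ht.2]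
  · change glue a (fun t => γl (-1 * t + 0)) (glue b σ γr) t ∈ _
    rcases ht with ht | ht
    · rw [glue_of_le ht]; exact hlO _ (by linarith)
    · rw [glue_of_ge hg2 (hab.trans ht), glue_of_ge hg1 ht]; exact hrO _ ht

/-! ### Contours over a saddle and along the real line. -/

section Data

variable {c z : Fin P → ℂ} {lam : ℝ}

/-- Within a component, the points joined to i∞ form a relatively open and closed set. It is
nonempty because the component contains a whole half-plane high up, where vertical rays serve. -/
theorem upPath_of_mem_sublevel (hA : IsAdmissible c z lam) {v : ℝ} {a : ℂ}
    (ha : a ∈ sublevel c z lam v) : UpPath (sublevel c z lam v) a := by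
  set O := sublevel c z lam v with hO
  have hOo : IsOpen O := isOpen_sublevel hA v
  obtain ⟨Y, hY⟩ := exists_height_subset_component hA v
  set V := connectedComponentIn O a
  have hVO : V ⊆ O := connectedComponentIn_subset _ _
  have hloc : ∀ b ∈ O, ∃ r > 0, Metric.ball b r ⊆ O ∧
      ∀ a₁ ∈ Metric.ball b r, ∀ a₂ ∈ Metric.ball b r, UpPath O a₂ → UpPath O a₁ := fun b hb => by
    obtain ⟨r, hr, hball⟩ := Metric.isOpen_iff.mp hOo b hb
    exact ⟨r, hr, hball, fun a₁ h₁ a₂ h₂ h =>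
      h.prepend (((convex_ball b r).segment_subset h₁ h₂).trans hball)⟩
  have hAo : IsOpen {b | b ∈ O ∧ UpPath O b} := by
    rw [Metric.isOpen_iff]
    rintro b ⟨hb, hbU⟩
    obtain ⟨r, hr, hball, hU⟩ := hloc b hb
    exact ⟨r, hr, fun a₁ h₁ => ⟨hball h₁, hU a₁ h₁ b (Metric.mem_ball_self hr) hbU⟩⟩
  have hsub : V ⊆ {b | b ∈ O ∧ UpPath O b} := by
    refine isPreconnected_connectedComponentIn.subset_of_closure_inter_subset hAo ?_ ?_
    · have hmem : ∀ s ≥ Y + 1, ((0 : ℝ) + s * I : ℂ) ∈ V := fun s hs =>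
        hY a ha (show Y < _ by simp; linarith)
      refine ⟨(0 : ℝ) + ((Y + 1 : ℝ) : ℂ) * I, hmem _ le_rfl, hVO (hmem _ le_rfl),
        upPath_of_vertical fun s hs => hVO ?_⟩
      have h2 := hmem s (by simpa using hs)
      simpa using h2
    · rintro b ⟨hbcl, hbV⟩
      obtain ⟨r, hr, hball, hU⟩ := hloc b (hVO hbV)
      obtain ⟨a₂, ha₂, -, h⟩ := mem_closure_iff.mp hbcl _ Metric.isOpen_ball (Metric.mem_ball_self hr)
      exact ⟨hVO hbV, hU b (Metric.mem_ball_self hr) a₂ ha₂ h⟩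
  exact (hsub (mem_connectedComponentIn ha)).2

/-- The quadratic normal form of `R` at a simple critical point. -/
theorem exists_quadratic_form (hA : IsAdmissible c z lam) {w : ℂ} (hw : IsCritical c z lam w)
    (hd : deriv (u0 c z) w ≠ 0) : ∃ q : ℂ → ℂ, ContinuousAt q w ∧ q w ≠ 0 ∧
      ∀ᶠ ζ in 𝓝 w, R c z lam ζ = R c z lam w + ((ζ - w) ^ 2 * q ζ).re := by
  obtain ⟨r, hr, k, hk⟩ := exists_local_primitive hA hw.1
  have hball := Metric.ball_mem_nhds w hr
  have hkd : DifferentiableOn ℂ k (Metric.ball w r) := fun ζ hζ =>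
    (hk ζ hζ).2.1.differentiableAt.differentiableWithinAt
  have hud : DifferentiableOn ℂ (dslope k w) (Metric.ball w r) :=
    (Complex.differentiableOn_dslope hball).mpr hkd
  have hqd : DifferentiableOn ℂ (dslope (dslope k w) w) (Metric.ball w r) :=
    (Complex.differentiableOn_dslope hball).mpr hud
  set q := dslope (dslope k w) w with hq
  have hkw : dslope k w w = 0 := by
    rw [dslope_same, (hk w (Metric.mem_ball_self hr)).2.1.deriv, hw.2, mul_zero]
  have hkq : ∀ ζ, k ζ = k w + (ζ - w) ^ 2 * q ζ := fun ζ => by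
    have h1 := sub_smul_dslope k w ζ
    have h2 := sub_smul_dslope (dslope k w) w ζ
    rw [hkw, sub_zero] at h2
    rw [smul_eq_mul] at h1 h2
    rw [← hq] at h2
    linear_combination -h1 - (ζ - w) * h2
  have hqa : AnalyticAt ℂ q w := hqd.analyticAt hball
  refine ⟨q, hqa.continuousAt, fun h0 => hd ?_, ?_⟩
  -- If q vanished at w, the derivative of the right-hand side would be 0 there, contradicting the
  -- simplicity of the critical point.
  · have h1 : ∀ᶠ ζ in 𝓝 w, -I * (lam + u0 c z ζ) = 2 * (ζ - w) * q ζ + (ζ - w) ^ 2 * deriv q ζ := by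
      filter_upwards [hqa.eventually_analyticAt, hball] with ζ h3 h4
      have h5 : HasDerivAt (fun ζ => k w + (ζ - w) ^ 2 * q ζ)
          (2 * (ζ - w) * q ζ + (ζ - w) ^ 2 * deriv q ζ) ζ := by
        have := ((((hasDerivAt_id ζ).sub_const w).pow 2).mul
          h3.differentiableAt.hasDerivAt).const_add (k w)
        refine this.congr_deriv ?_
        simp
      exact (hk ζ h4).2.1.unique (h5.congr_of_eventuallyEq (Eventually.of_forall hkq))
    have h2 : HasDerivAt (fun ζ => 2 * (ζ - w) * q ζ + (ζ - w) ^ 2 * deriv q ζ) 0 w := by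
      have := ((((hasDerivAt_id w).sub_const w).const_mul 2).mul
        hqa.differentiableAt.hasDerivAt).add ((((hasDerivAt_id w).sub_const w).pow 2).mul
          hqa.deriv.differentiableAt.hasDerivAt)
      refine this.congr_deriv ?_
      simp [h0]
    have h3 := ((differentiableAt_u0 (c := c) hw.1).hasDerivAt.const_add (lam : ℂ)).const_mul (-I)
    have h4 := h3.unique (h2.congr_of_eventuallyEq h1)
    exact (mul_eq_zero.mp h4).resolve_left (by simp)
  · filter_upwards [hball] with ζ hζ
    rw [← (hk ζ hζ).2.2, ← (hk w (Metric.mem_ball_self hr)).2.2, ← add_re, ← hkq]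

/-- A contour through a simple critical point in the upper half-plane, along which `R` is otherwise
smaller than at this point. -/
theorem exists_saddle_contour (hA : IsAdmissible c z lam) {w : ℂ} (hw : IsCritical c z lam w)
    (him : 0 < w.im) (hd : deriv (u0 c z) w ≠ 0) :
    ∃ (γ : UContour) (θ : ℂ) (δ : ℝ), θ ≠ 0 ∧ 0 < δ ∧ (∀ t : ℝ, |t| ≤ δ → γ t = w + t * θ) ∧
      (∀ t : ℝ, t ≠ 0 → γ t ∈ sublevel c z lam (R c z lam w)) ∧
      ∀ᶠ s : ℝ in 𝓝[≠] 0, R c z lam w < R c z lam (w + s * (I * θ)) := by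
  obtain ⟨q, hqc, hq0, hq⟩ := exists_quadratic_form hA hw hd
  set v := R c z lam w with hv
  -- This makes θ² q(w) negative real, so ±θ are the directions of steepest descent and ±iθ those of
  -- steepest ascent.
  obtain ⟨θ, hθ⟩ := IsAlgClosed.exists_pow_nat_eq (-((‖q w‖ : ℂ) / q w)) two_pos
  have hqn : (‖q w‖ : ℂ) ≠ 0 := by exact_mod_cast norm_ne_zero_iff.mpr hq0
  have hθ0 : θ ≠ 0 := by
    rintro rfl
    rw [zero_pow two_ne_zero, eq_comm, neg_eq_zero] at hθ
    exact div_ne_zero hqn hq0 hθ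
  have hθq : θ ^ 2 * q w = -(‖q w‖ : ℂ) := by rw [hθ]; field_simp
  have hdir : ∀ η : ℂ, Tendsto (fun t : ℝ => w + t * η) (𝓝 0) (𝓝 w) := fun η => by
    have : Continuous fun t : ℝ => w + t * η := by fun_prop
    simpa using this.tendsto 0
  have hval : ∀ η : ℂ, ∀ᶠ t : ℝ in 𝓝 0,
      R c z lam (w + t * η) = v + t ^ 2 * (η ^ 2 * q (w + t * η)).re := fun η => by
    filter_upwards [(hdir η).eventually hq] with t ht
    rw [ht, add_sub_cancel_left, ← re_ofReal_mul]
    congr 2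
    push_cast; ring
  have hlim : ∀ η : ℂ, Tendsto (fun t : ℝ => (η ^ 2 * q (w + t * η)).re) (𝓝 0)
      (𝓝 (η ^ 2 * q w).re) := fun η =>
    (continuous_re.tendsto _).comp ((hqc.tendsto.comp (hdir η)).const_mul _)
  have hqpos : 0 < ‖q w‖ := norm_pos_iff.mpr hq0
  have hdown : ∀ᶠ t : ℝ in 𝓝 0, t ≠ 0 → w + t * θ ∈ sublevel c z lam v := by
    have hfin : ({w | IsCritical c z lam w} \ {w})ᶜ ∈ 𝓝 w :=
      (hA.finite_isCritical.subset sdiff_subset).isClosed.isOpen_compl.mem_nhds (by simp)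
    have hneg : (θ ^ 2 * q w).re < 0 := by rw [hθq]; simpa using hq0
    filter_upwards [(hdir θ).eventually hfin, (hdir θ).eventually
      (continuous_im.continuousAt.eventually (lt_mem_nhds him)),
      (hdir θ).eventually ((isOpen_regular z).mem_nhds hw.1), hval θ,
      (hlim θ).eventually (gt_mem_nhds hneg)] with t h1 h2 h3 h4 h5 ht
    refine ⟨h2, h3, fun h6 => h1 ⟨h6, ?_⟩, ?_⟩
    · simp [ht, hθ0]
    · rw [h4]
      have := mul_neg_of_pos_of_neg (pow_pos (abs_pos.mpr ht) 2) h5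
      rw [sq_abs] at this
      linarith
  obtain ⟨ε, hε, hball⟩ := Metric.eventually_nhds_iff_ball.mp hdown
  have hmem : ∀ t : ℝ, |t| ≤ ε / 2 → t ≠ 0 → w + t * θ ∈ sublevel c z lam v := fun t ht ht0 =>
    hball t (by rw [mem_ball_zero_iff, Real.norm_eq_abs]; linarith) ht0
  have hδ : 0 < ε / 2 := by linarith
  obtain ⟨γ, hγ1, hγ2⟩ := exists_contour (isPW_line w θ) (by linarith : -(ε / 2) ≤ ε / 2)
    (upPath_of_mem_sublevel hA (hmem (-(ε / 2)) (by rw [abs_neg, abs_of_pos hδ]) (by linarith)))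
    (upPath_of_mem_sublevel hA (hmem (ε / 2) (by rw [abs_of_pos hδ]) (by linarith)))
  refine ⟨γ, θ, ε / 2, hθ0, hδ, fun t ht => hγ1 t (abs_le.mp ht), fun t ht => ?_, ?_⟩
  · rcases le_or_gt |t| (ε / 2) with h | h
    · rw [hγ1 t (abs_le.mp h)]; exact hmem t h ht
    · refine hγ2 t ?_
      rcases lt_abs.mp h with h | h
      · exact Or.inr h.le
      · exact Or.inl (by linarith)
  · rw [eventually_nhdsWithin_iff]
    have hpos : 0 < ((I * θ) ^ 2 * q w).re := by
      rw [mul_pow, I_sq, mul_assoc, hθq]; simpa using hq0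
    filter_upwards [hval (I * θ), (hlim (I * θ)).eventually (lt_mem_nhds hpos)] with s h4 h5 hs
    rw [h4]
    have := mul_pos (pow_pos (abs_pos.mpr hs) 2) h5
    rw [sq_abs] at this
    linarith

theorem exists_strip_width (hA : IsAdmissible c z lam) : ∃ ρ > 0, ∀ p, 2 * ρ ≤ (z p).im := by
  have : Nonempty (Fin P) := ⟨⟨0, hA.size_pos⟩⟩
  obtain ⟨p, hp⟩ := Finite.exists_min fun p => (z p).im
  exact ⟨(z p).im / 2, half_pos (hA.im_pos p), fun q => by linarith [hp q]⟩

theorem regular_of_strip {ρ : ℝ} (hρ0 : 0 < ρ) (hρ : ∀ p, 2 * ρ ≤ (z p).im) {w : ℂ}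
    (hw : |w.im| ≤ ρ) : Regular z w := fun p => by
  have h1 := abs_le.mp hw
  refine ⟨?_, ?_⟩ <;> rintro rfl
  · linarith [hρ p]
  · have := hρ p
    simp only [conj_im] at h1
    linarith

theorem norm_div_sub_div_le {ρ : ℝ} (hρ : 0 < ρ) {a w w' q : ℂ} (h : ρ ≤ ‖w - q‖)
    (h' : ρ ≤ ‖w' - q‖) : ‖a / (w - q) - a / (w' - q)‖ ≤ ‖a‖ / ρ ^ 2 * ‖w - w'‖ := by
  have h0 : w - q ≠ 0 := norm_pos_iff.mp (hρ.trans_le h)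
  have h0' : w' - q ≠ 0 := norm_pos_iff.mp (hρ.trans_le h')
  have : a / (w - q) - a / (w' - q) = a * (w' - w) / ((w - q) * (w' - q)) := by
    field_simp; ring
  rw [this, norm_div, norm_mul, norm_mul, norm_sub_rev, div_mul_eq_mul_div]
  gcongr
  nlinarith

theorem exists_lipschitz_strip {ρ : ℝ} (hρ0 : 0 < ρ)
    (hρ : ∀ p, 2 * ρ ≤ (z p).im) : ∃ C > 0, ∀ w w' : ℂ, |w.im| ≤ ρ → |w'.im| ≤ ρ →
      ‖u0 c z w - u0 c z w'‖ ≤ C * ‖w - w'‖ := by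
  have hfar : ∀ w : ℂ, |w.im| ≤ ρ → ∀ p, ρ ≤ ‖w - z p‖ ∧ ρ ≤ ‖w - conj (z p)‖ := fun w hw p => by
    have h1 := abs_im_le_norm (w - z p)
    have h2 := abs_im_le_norm (w - conj (z p))
    have h3 := abs_le.mp hw
    simp only [sub_im, conj_im] at h1 h2
    exact ⟨by linarith [neg_abs_le (w.im - (z p).im), hρ p],
      by linarith [le_abs_self (w.im - -(z p).im), hρ p]⟩
  refine ⟨∑ p, (‖c p‖ / ρ ^ 2 + ‖conj (c p)‖ / ρ ^ 2) + 1, by positivity, fun w w' hw hw' => ?_⟩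
  have h1 : ‖u0 c z w - u0 c z w'‖ ≤
      (∑ p, (‖c p‖ / ρ ^ 2 + ‖conj (c p)‖ / ρ ^ 2)) * ‖w - w'‖ := by
    rw [u0, u0, ← Finset.sum_sub_distrib, Finset.sum_mul]
    refine norm_sum_le_of_le _ fun p _ => ?_
    rw [add_sub_add_comm, add_mul]
    exact norm_add_le_of_le (norm_div_sub_div_le hρ0 (hfar w hw p).1 (hfar w' hw' p).1)
      (norm_div_sub_div_le hρ0 (hfar w hw p).2 (hfar w' hw' p).2)
  linarith [norm_nonneg (w - w')]

/-- First order expansion of `R` at the real line. -/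
theorem abs_R_sub_le (hA : IsAdmissible c z lam) {ρ C : ℝ} (hρ0 : 0 < ρ)
    (hρ : ∀ p, 2 * ρ ≤ (z p).im) (hC : ∀ w w' : ℂ, |w.im| ≤ ρ → |w'.im| ≤ ρ →
      ‖u0 c z w - u0 c z w'‖ ≤ C * ‖w - w'‖) (hC0 : 0 < C) (x : ℝ) {y : ℝ} (hy : |y| ≤ ρ) :
    |R c z lam (x + y * I) - y * (lam + u0Real c z x)| ≤ C * y ^ 2 := by
  have habs : ∀ s ∈ uIcc 0 y, |s| ≤ |y| := fun s hs => by
    have := abs_sub_left_of_mem_uIcc hs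
    simpa using this
  have hd : ∀ s ∈ uIcc 0 y, HasDerivWithinAt
      (fun s : ℝ => R c z lam (x + s * I) - s * (lam + u0Real c z x))
      ((lam + (u0 c z (x + s * I)).re) - 1 * (lam + u0Real c z x)) (uIcc 0 y) s := fun s hs => by
    refine (HasDerivAt.sub (hasDerivAt_R_vertical hA ?_) ((hasDerivAt_id s).mul_const _)).hasDerivWithinAt
    refine regular_of_strip hρ0 hρ ?_
    simpa using (habs s hs).trans hy
  -- The vertical derivative of `R` at height s differs from its value at height 0 by at most C|s|;
  -- the mean value inequality gives the quadratic error.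
  have := Convex.norm_image_sub_le_of_norm_hasDerivWithin_le (C := C * |y|) hd (fun s hs => ?_)
    (convex_uIcc 0 y) left_mem_uIcc right_mem_uIcc
  · rw [R_ofReal_add_zero hA] at this
    simp only [zero_mul, sub_zero, Real.norm_eq_abs] at this
    rwa [mul_assoc, ← sq, sq_abs] at this
  · have h1 := hC (x + s * I) x (by simpa using (habs s hs).trans hy) (by simpa using hρ0.le)
    rw [add_sub_cancel_left, norm_mul, norm_I, mul_one, norm_real] at h1
    have h2 := (abs_re_le_norm _).trans h1
    rw [u0_ofReal, sub_re, ofReal_re] at h2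
    rw [Real.norm_eq_abs, one_mul, add_sub_add_left_eq_sub]
    exact h2.trans (mul_le_mul_of_nonneg_left (habs s hs) hC0.le)

theorem exists_u0Real_bound (hA : IsAdmissible c z lam) : ∃ M > 0, ∀ x,
    |lam + u0Real c z x| ≤ M := by
  obtain ⟨K, hK, hK'⟩ := mem_cocompact.mp
    ((tendsto_u0Real (c := c) (z := z)) (Metric.closedBall_mem_nhds 0 one_pos))
  obtain ⟨M, hM⟩ := hK.exists_bound_of_continuousOn hA.continuous_u0Real.continuousOn
  refine ⟨|lam| + max M 1, by positivity, fun x => (abs_add_le _ _).trans ?_⟩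
  gcongr
  by_cases hx : x ∈ K
  · exact (hM x hx).trans (le_max_left _ _)
  · exact le_trans (by simpa using hK' hx) (le_max_right M 1)

/-- A contour crossing the real line exactly in the real critical points, along which `R` is
otherwise negative. -/
theorem exists_real_contour (hA : IsAdmissible c z lam) :
    ∃ (γ : UContour) (μ X : ℝ), 0 < μ ∧ 0 < X ∧
      (∀ t : ℝ, |t| ≤ X → γ t = t + (-(μ * (lam + u0Real c z t)) : ℝ) * I) ∧
      (∀ t : ℝ, X ≤ |t| → γ t ∈ sublevel c z lam 0 ∧ lam + u0Real c z t < 0) ∧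
      (∀ (t : ℝ) (p : Fin P), μ * |lam + u0Real c z t| < (z p).im) ∧
      ∀ t : ℝ, lam + u0Real c z t ≠ 0 → |t| ≤ X →
        ¬ IsCritical c z lam (γ t) ∧ R c z lam (γ t) < 0 := by
  have hlam := hA.lam_neg
  obtain ⟨ρ, hρ0, hρ⟩ := exists_strip_width hA
  obtain ⟨C, hC0, hC⟩ := exists_lipschitz_strip (c := c) hρ0 hρ
  obtain ⟨M, hM0, hM⟩ := exists_u0Real_bound hA
  obtain ⟨X, hX0, -, hX⟩ := exists_radius hA
  -- A graph lying below height η in modulus can meet only real critical points.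
  obtain ⟨η, hη0, hη⟩ : ∃ η > 0, ∀ w, IsCritical c z lam w → w.im ≠ 0 → η ≤ |w.im| := by
    have hfin : {w | IsCritical c z lam w ∧ w.im ≠ 0}.Finite :=
      hA.finite_isCritical.subset fun w hw => hw.1
    rcases {w | IsCritical c z lam w ∧ w.im ≠ 0}.eq_empty_or_nonempty with he | hne
    · refine ⟨1, one_pos, fun w h1 h2 => ?_⟩
      have : w ∈ ({w | IsCritical c z lam w ∧ w.im ≠ 0} : Set ℂ) := ⟨h1, h2⟩
      rw [he] at this; exact this.elim
    · obtain ⟨w₀, h₀, hmin⟩ := Set.exists_min_image _ (fun w : ℂ => |w.im|) hfin hne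
      exact ⟨|w₀.im|, abs_pos.mpr h₀.2, fun w h1 h2 => hmin w ⟨h1, h2⟩⟩
  -- The three bounds keep the graph inside the pole-free strip, below the nonreal critical points,
  -- and low enough for the quadratic error in `R` to be at most half of the main term.
  set μ := min (min (ρ / (2 * M)) (η / (2 * M))) (1 / (2 * C)) with hμ
  have hμ0 : 0 < μ := by positivity
  have hμρ : μ * M ≤ ρ / 2 := by
    have : μ ≤ ρ / (2 * M) := (min_le_left _ _).trans (min_le_left _ _)
    rw [le_div_iff₀ (by positivity)] at this
    linarith
  have hμη : μ * M ≤ η / 2 := by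
    have : μ ≤ η / (2 * M) := (min_le_left _ _).trans (min_le_right _ _)
    rw [le_div_iff₀ (by positivity)] at this
    linarith
  have hμC : μ * C ≤ 1 / 2 := by
    have : μ ≤ 1 / (2 * C) := min_le_right _ _
    rw [le_div_iff₀ (by positivity)] at this
    linarith
  have hheight : ∀ t, |-(μ * (lam + u0Real c z t))| ≤ μ * M := fun t => by
    rw [abs_neg, abs_mul, abs_of_pos hμ0]
    exact mul_le_mul_of_nonneg_left (hM t) hμ0.le
  set σ : ℝ → ℂ := fun t => t + (-(μ * (lam + u0Real c z t)) : ℝ) * I with hσ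
  have hσPW : IsPW σ := by
    have hsmooth : ContDiff ℝ 1 (u0Real c z) := by
      rw [contDiff_one_iff_deriv]
      refine ⟨fun x => (hA.hasDerivAt_u0Real x).differentiableAt, ?_⟩
      have : deriv (u0Real c z) = fun x : ℝ => (deriv (u0 c z) x).re :=
        funext fun x => (hA.hasDerivAt_u0Real x).deriv
      rw [this]
      refine continuous_re.comp (continuous_iff_continuousAt.mpr fun x => ?_)
      exact (analyticAt_u0 (hA.regular_real x)).deriv.continuousAt.comp continuous_ofReal.continuousAt
    refine ⟨⟨Real.toNNReal (1 + μ * C), LipschitzWith.of_dist_le_mul fun s t => ?_⟩, ∅, fun t _ => ?_⟩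
    · have h1 := hC s t (by simpa using hρ0.le) (by simpa using hρ0.le)
      rw [u0_ofReal, u0_ofReal, ← ofReal_sub, ← ofReal_sub, norm_real, norm_real] at h1
      have h2 : σ s - σ t = ((s - t : ℝ) : ℂ) + (-(μ * (u0Real c z s - u0Real c z t)) : ℝ) * I := by
        simp only [hσ]; push_cast; ring
      rw [dist_eq_norm, h2, dist_eq_norm]
      refine (norm_add_le _ _).trans ?_
      rw [norm_mul, norm_I, mul_one, norm_real, norm_real, norm_neg, norm_mul, Real.norm_eq_abs μ,
        abs_of_pos hμ0, Real.coe_toNNReal _ (by positivity)]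
      nlinarith
    · have h1 : ContDiff ℝ 1 (fun t : ℝ => (t : ℂ)) := ofRealCLM.contDiff
      have h2 : ContDiff ℝ 1 (fun t : ℝ => ((-(μ * (lam + u0Real c z t)) : ℝ) : ℂ)) :=
        
        ofRealCLM.contDiff.comp ((contDiff_const.mul (contDiff_const.add hsmooth)).neg)
      exact (h1.add (h2.mul contDiff_const)).contDiffAt
  have hneg : ∀ t, X ≤ |t| → lam + u0Real c z t < 0 := fun t ht => by
    have h1 := (hX t (by rwa [norm_real])).2
    rw [u0_ofReal, norm_real] at h1
    linarith [(le_abs_self _).trans h1]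
  have hup : ∀ t, X ≤ |t| → UpPath (sublevel c z lam 0) (σ t) := fun t ht => by
    refine upPath_of_vertical fun s hs => ?_
    have him : (σ t).im = -(μ * (lam + u0Real c z t)) := by simp [hσ]
    have hre : (σ t).re = t := by simp [hσ]
    have hs0 : 0 < s := by
      have := mul_pos_of_neg_of_neg (neg_lt_zero.mpr hμ0) (hneg t ht)
      rw [him] at hs
      linarith
    rw [hre]
    have h1 := hX (t + s * I) (le_norm_of_le_abs_re ht)
    have h2 := R_vertical_le hA hX (x := t) hs0.le fun s _ => le_norm_of_le_abs_re ht
    rw [R_ofReal_add_zero hA] at h2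
    refine ⟨by simpa using hs0, h1.1, not_isCritical_of_far hA h1.2, ?_⟩
    nlinarith
  obtain ⟨γ, hγ1, hγ2⟩ := exists_contour hσPW (by linarith : -X ≤ X)
    (hup (-X) (by rw [abs_neg, abs_of_pos hX0])) (hup X (by rw [abs_of_pos hX0]))
  refine ⟨γ, μ, X, hμ0, hX0, fun t ht => hγ1 t (abs_le.mp ht), fun t ht => ⟨hγ2 t ?_, hneg t ht⟩,
    fun t p => ?_, fun t ht htX => ?_⟩
  · rcases le_abs.mp ht with h | h
    · exact Or.inr h
    · exact Or.inl (by linarith)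
  · have h1 := hheight t
    rw [abs_neg, abs_mul, abs_of_pos hμ0] at h1
    linarith [hρ p]
  · rw [hγ1 t (abs_le.mp htX)]
    have him : (σ t).im = -(μ * (lam + u0Real c z t)) := by simp [hσ]
    refine ⟨fun hcr => ?_, ?_⟩
    · have h1 := hη _ hcr (by rw [him]; exact neg_ne_zero.mpr (mul_ne_zero hμ0.ne' ht))
      rw [him] at h1
      linarith [hheight t]
    · have h1 := abs_R_sub_le hA hρ0 hρ hC hC0 t ((hheight t).trans (by linarith))
      -- With φ = lam + u₀ and y = -μφ, the main term is -μφ² and the error at most (μC)μφ² ≤ μφ²/2.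
      have h2 := (abs_le.mp h1).2
      have h3 : 0 < (lam + u0Real c z t) ^ 2 := by positivity
      have h4 : C * (-(μ * (lam + u0Real c z t))) ^ 2 =
        (μ * C) * (μ * (lam + u0Real c z t) ^ 2) := by ring
      have h5 : 0 < μ * (lam + u0Real c z t) ^ 2 := by positivity
      rw [h4] at h2
      simp only [hσ]
      nlinarith

end Data

/-! ### Branches of h along contours and integration against test functions. -/

theorem hasDerivAt_of_exp_eq {l φ : ℝ → ℂ} {φ' : ℂ} {t : ℝ} (hl : ContinuousAt l t)
    (hexp : ∀ s, exp (l s) = φ s) (hφ : HasDerivAt φ φ' t) : HasDerivAt l (φ' / φ t) t := by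
  have h0 : φ t ≠ 0 := by rw [← hexp]; exact exp_ne_zero _
  have h1 : φ t / φ t ∈ slitPlane := by rw [div_self h0]; exact one_mem_slitPlane
  have h2 := ((hφ.div_const (φ t)).clog_real h1).const_add (l t)
  rw [div_self h0, div_one] at h2
  refine h2.congr_of_eventuallyEq ?_
  -- By continuity the increment of l has imaginary part in (-π, π) near t, so it is the principal
  -- logarithm of φ(s)/φ(t).
  have h3 : Tendsto (fun s => (l s - l t).im) (𝓝 t) (𝓝 0) := by
    have : ContinuousAt (fun s => (l s - l t).im) t :=
      continuous_im.continuousAt.comp (hl.sub continuousAt_const)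
    simpa [ContinuousAt] using this
  filter_upwards [h3.eventually (lt_mem_nhds (neg_lt_zero.mpr Real.pi_pos)),
    h3.eventually (gt_mem_nhds Real.pi_pos)] with s hs1 hs2
  rw [← hexp s, ← hexp t, ← exp_sub, log_exp hs1 hs2.le]
  ring

theorem exists_continuous_log {φ : ℝ → ℂ} (hφ : Continuous φ) (h0 : ∀ t, φ t ≠ 0) :
    ∃ l : ℝ → ℂ, Continuous l ∧ ∀ t, exp (l t) = φ t := by
  obtain ⟨l, ⟨-, hl⟩, -⟩ := isCoveringMapOn_exp.existsUnique_continuousMap_lifts ⟨φ, hφ⟩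
    (a₀ := 0) (exp_log (h0 0)) h0
  exact ⟨l, l.continuous, fun t => congrFun hl t⟩

theorem UContour.continuous (γ : UContour) : Continuous γ := by
  obtain ⟨K, hK⟩ := γ.lipschitz
  exact hK.continuous

theorem UContour.differentiableAt (γ : UContour) {t : ℝ} (ht : t ∉ γ.breaks) :
    DifferentiableAt ℝ γ t := (γ.contDiffAt t ht).differentiableAt one_ne_zero

/-- The properties of branches of `h` along contours that matter for integration. -/
structure IsPhase (c z : Fin P → ℂ) (lam : ℝ) (γ : UContour) (H : ℝ → ℂ) : Prop where
  regular : ∀ t, Regular z (γ t)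
  continuous : Continuous H
  hasDerivAt : ∀ t v, HasDerivAt γ v t → HasDerivAt H ((lam + u0 c z (γ t)) * v) t
  re_eq : ∀ t, (-I * H t).re = R c z lam (γ t)

section Data

variable {c z : Fin P → ℂ} {lam : ℝ}

theorem IsBranchAlong.isPhase (hA : IsAdmissible c z lam) {γ : UContour} {H : ℝ → ℂ}
    (hH : IsBranchAlong c z lam γ H) : IsPhase c z lam γ H := by
  obtain ⟨l, l', hl, hl', hH⟩ := hH
  have hne : ∀ p t, I * (γ t - z p) ≠ 0 := fun p t => by
    rw [← (hl p).2 t]; exact exp_ne_zero _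
  have hne' : ∀ p t, -I * (γ t - conj (z p)) ≠ 0 := fun p t => by
    rw [← (hl' p).2 t]; exact exp_ne_zero _
  have hreg : ∀ t, Regular z (γ t) := fun t p =>
    ⟨fun h => hne p t (by rw [h, sub_self, mul_zero]), fun h => hne' p t (by rw [h, sub_self, mul_zero])⟩
  have hH' : H = fun t => lam * γ t + ∑ p, (c p * (l p t + Real.pi * I / 2) +
      conj (c p) * (l' p t - Real.pi * I / 2)) := funext hH
  refine ⟨hreg, ?_, fun t v hv => ?_, fun t => ?_⟩
  · rw [hH']
    have h1 := γ.continuous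
    have h2 := fun p => (hl p).1
    have h3 := fun p => (hl' p).1
    fun_prop
  · rw [hH']
    have h1 : ∀ p, HasDerivAt (l p) (v / (γ t - z p)) t := fun p => by
      refine (hasDerivAt_of_exp_eq (hl p).1.continuousAt (hl p).2
        ((hv.sub_const (z p)).const_mul I)).congr_deriv ?_
      rw [mul_div_mul_left _ _ I_ne_zero]
    have h2 : ∀ p, HasDerivAt (l' p) (v / (γ t - conj (z p))) t := fun p => by
      refine (hasDerivAt_of_exp_eq (hl' p).1.continuousAt (hl' p).2
        ((hv.sub_const (conj (z p))).const_mul (-I))).congr_deriv ?_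
      rw [mul_div_mul_left _ _ (neg_ne_zero.mpr I_ne_zero)]
    refine ((hv.const_mul (lam : ℂ)).add (HasDerivAt.fun_sum fun p _ =>
      (((h1 p).add_const (Real.pi * I / 2)).const_mul (c p)).add
        (((h2 p).sub_const (Real.pi * I / 2)).const_mul (conj (c p))))).congr_deriv ?_
    rw [u0, add_mul, Finset.sum_mul]
    congr 1
    exact Finset.sum_congr rfl fun p _ => by ring
  · have key : -I * H t = -I * (lam * γ t) + ∑ p, (((-(c p).im : ℝ) : ℂ) * (l' p t - l p t) +
        ((c p).im * Real.pi : ℝ) * I) := by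
      rw [hH, mul_add, Finset.mul_sum]
      congr 1
      refine Finset.sum_congr rfl fun p _ => ?_
      rw [hA.conj_coeff p, hA.coeff_eq p]
      push_cast
      simp only [mul_im, ofReal_re, I_im, ofReal_im, I_re, mul_one, mul_zero, add_zero]
      linear_combination (-((c p).im : ℂ)) * (l p t + Real.pi * I - l' p t) * I_mul_I
    have hlog : ∀ {a b : ℂ}, exp a = b → a.re = Real.log ‖b‖ := fun {a b} h => by
      rw [← h, norm_exp, Real.log_exp]
    rw [key, R_eq hA, add_re, re_sum]
    congr 1
    · simp
    · refine Finset.sum_congr rfl fun p _ => ?_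
      rw [add_re, re_ofReal_mul, sub_re, hlog ((hl p).2 t), hlog ((hl' p).2 t)]
      simp

theorem exists_isBranchAlong {γ : UContour} (hγ : ∀ t, Regular z (γ t)) :
    ∃ H, IsBranchAlong c z lam γ H := by
  have h1 : ∀ p, ∃ l : ℝ → ℂ, Continuous l ∧ ∀ t, exp (l t) = I * (γ t - z p) := fun p =>
    exists_continuous_log (by have := γ.continuous; fun_prop)
      fun t => mul_ne_zero I_ne_zero (sub_ne_zero.mpr (hγ t p).1)
  have h2 : ∀ p, ∃ l : ℝ → ℂ, Continuous l ∧ ∀ t, exp (l t) = -I * (γ t - conj (z p)) := fun p =>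
    exists_continuous_log (by have := γ.continuous; fun_prop)
      fun t => mul_ne_zero (neg_ne_zero.mpr I_ne_zero) (sub_ne_zero.mpr (hγ t p).2)
  choose l hl using h1
  choose l' hl' using h2
  exact ⟨_, l, l', hl, hl', fun t => rfl⟩

theorem regular_of_mem_slitDomain {w : ℂ} (hw : w ∈ slitDomain z) : Regular z w := fun p =>
  ⟨fun h => slitPlane_ne_zero (hw p).1 (by rw [h, sub_self, mul_zero]),
   fun h => slitPlane_ne_zero (hw p).2 (by rw [h, sub_self, mul_zero])⟩

theorem isPhase_h {γ : UContour} (hγ : ∀ t, γ t ∈ slitDomain z) :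
    IsPhase c z lam γ fun t => h c z lam (γ t) := by
  refine ⟨fun t => regular_of_mem_slitDomain (hγ t), continuous_iff_continuousAt.mpr fun t =>
    (hasDerivAt_h c z lam (hγ t)).continuousAt.comp γ.continuous.continuousAt, fun t v hv =>
    (hasDerivAt_h c z lam (hγ t)).comp t hv, fun t => rfl⟩

/-- Functions holomorphic away from the poles and bounded near infinity. -/
def testSpace (z : Fin P → ℂ) : Submodule ℂ (ℂ → ℂ) where
  carrier := {g | DifferentiableOn ℂ g {w | Regular z w} ∧ ∃ M K : ℝ, ∀ w, K ≤ ‖w‖ → ‖g w‖ ≤ M}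
  add_mem' := by
    rintro g₁ g₂ ⟨h₁, M₁, K₁, b₁⟩ ⟨h₂, M₂, K₂, b₂⟩
    exact ⟨h₁.add h₂, M₁ + M₂, max K₁ K₂, fun w hw => norm_add_le_of_le
      (b₁ w ((le_max_left _ _).trans hw)) (b₂ w ((le_max_right _ _).trans hw))⟩
  zero_mem' := ⟨differentiableOn_const 0, 0, 0, fun w _ => by simp⟩
  smul_mem' := by
    rintro a g ⟨h, M, K, b⟩
    refine ⟨h.const_smul a, ‖a‖ * M, K, fun w hw => ?_⟩
    rw [Pi.smul_apply, norm_smul]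
    exact mul_le_mul_of_nonneg_left (b w hw) (norm_nonneg a)

/-- k = 1 gives the matrix entries, k ≥ 1 the Taylor coefficients of Cauchy transforms, and k = 0
the integrability of the weight itself. -/
theorem inv_pow_mem_testSpace {q : ℂ} (hq : ¬ Regular z q) (k : ℕ) :
    (fun w => ((w - q) ^ k)⁻¹) ∈ testSpace z := by
  refine ⟨fun w hw => ?_, 1, ‖q‖ + 1, fun w hw => ?_⟩
  · have : w - q ≠ 0 := sub_ne_zero.mpr fun h => hq (h ▸ hw)
    exact (DifferentiableAt.inv (𝕜 := ℂ) (h := fun w => (w - q) ^ k) (by fun_prop) (pow_ne_zero _ this)).differentiableWithinAt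
  · have h1 : 1 ≤ ‖w - q‖ := by linarith [norm_sub_norm_le w q]
    rw [norm_inv, norm_pow]
    exact inv_le_one_of_one_le₀ (one_le_pow₀ h1)

/-- The weight `e^{-iH/ε}`. -/
noncomputable def weight (ε : ℝ) (H : ℝ → ℂ) (t : ℝ) : ℂ := exp (-I * H t / ε)

theorem norm_weight {ε : ℝ} {γ : UContour} {H : ℝ → ℂ} (hH : IsPhase c z lam γ H) (t : ℝ) :
    ‖weight ε H t‖ = Real.exp (R c z lam (γ t) / ε) := by
  rw [weight, norm_exp, div_ofReal_re, hH.re_eq]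

theorem continuous_weight {ε : ℝ} {H : ℝ → ℂ} (hH : Continuous H) : Continuous (weight ε H) := by
  unfold weight; fun_prop

theorem UContour.eventually_far (γ : UContour) (K : ℝ) :
    (∀ᶠ t in atTop, K ≤ ‖γ t‖ ∧ (γ t).im = t) ∧ ∀ᶠ t in atBot, K ≤ ‖γ t‖ ∧ (γ t).im = -t := by
  obtain ⟨T, hT, hT'⟩ := γ.tails
  constructor
  · filter_upwards [eventually_ge_atTop T, eventually_ge_atTop K] with t h1 h2
    have : (γ t).im = t := by rw [hT t h1]; simp
    refine ⟨?_, this⟩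
    have h3 := (le_abs_self _).trans (abs_im_le_norm (γ t))
    linarith
  · filter_upwards [eventually_le_atBot (-T), eventually_le_atBot (-K)] with t h1 h2
    have : (γ t).im = -t := by rw [hT' t h1]; simp
    refine ⟨?_, this⟩
    have h3 := (le_abs_self _).trans (abs_im_le_norm (γ t))
    linarith

/-- Exponential decay of the weights at both ends. -/
theorem weight_isBigO (hA : IsAdmissible c z lam) {ε : ℝ} (hε : 0 < ε) {γ : UContour} {H : ℝ → ℂ}
    (hH : IsPhase c z lam γ H) :
    weight ε H =O[atTop] (fun t => Real.exp (lam / ε * t)) ∧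
      weight ε H =O[atBot] (fun t => Real.exp (-lam / ε * t)) := by
  obtain ⟨K, hK0, C, hC, hK⟩ := exists_R_le hA
  obtain ⟨h1, h2⟩ := γ.eventually_far K
  have key : ∀ t s, K ≤ ‖γ t‖ ∧ (γ t).im = s → ‖weight ε H t‖ ≤
      Real.exp (C / ε) * Real.exp (lam / ε * s) := fun t s ht => by
    rw [norm_weight hH, ← Real.exp_add, Real.exp_le_exp, ← ht.2]
    have := hK _ ht.1
    rw [div_mul_eq_mul_div, ← add_div]
    gcongr
    linarith
  constructor
  · refine Asymptotics.IsBigO.of_bound (Real.exp (C / ε)) ?_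
    filter_upwards [h1] with t ht
    rw [Real.norm_eq_abs, Real.abs_exp]
    exact key t t ht
  · refine Asymptotics.IsBigO.of_bound (Real.exp (C / ε)) ?_
    filter_upwards [h2] with t ht
    rw [Real.norm_eq_abs, Real.abs_exp]
    refine (key t (-t) ht).trans_eq ?_
    congr 2
    ring

theorem continuous_comp_testSpace {g : ℂ → ℂ} (hg : g ∈ testSpace z) {γ : UContour}
    (hγ : ∀ t, Regular z (γ t)) : Continuous fun t => g (γ t) :=
  continuous_iff_continuousAt.mpr fun t =>
    ((hg.1.differentiableAt ((isOpen_regular z).mem_nhds (hγ t))).continuousAt).comp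
      γ.continuous.continuousAt

theorem testSpace_isBigO {g : ℂ → ℂ} (hg : g ∈ testSpace z) (γ : UContour) :
    (fun t => g (γ t)) =O[atTop] (fun _ => (1 : ℝ)) ∧
      (fun t => g (γ t)) =O[atBot] (fun _ => (1 : ℝ)) := by
  obtain ⟨-, M, K, hM⟩ := hg
  obtain ⟨h1, h2⟩ := γ.eventually_far K
  constructor
  · refine Asymptotics.IsBigO.of_bound M ?_
    filter_upwards [h1] with t ht
    simpa using hM _ ht.1
  · refine Asymptotics.IsBigO.of_bound M ?_
    filter_upwards [h2] with t ht
    simpa using hM _ ht.1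

theorem integrable_weight_mul (hA : IsAdmissible c z lam) {ε : ℝ} (hε : 0 < ε) {γ : UContour}
    {H : ℝ → ℂ} (hH : IsPhase c z lam γ H) {g : ℂ → ℂ} (hg : g ∈ testSpace z) :
    Integrable fun t => weight ε H t * g (γ t) := by
  have hcont := (continuous_weight (ε := ε) hH.continuous).mul (continuous_comp_testSpace hg hH.regular)
  have hk : 0 < -lam / ε := div_pos (neg_pos.mpr hA.lam_neg) hε
  obtain ⟨w1, w2⟩ := weight_isBigO hA hε hH
  obtain ⟨g1, g2⟩ := testSpace_isBigO hg γ
  refine hcont.locallyIntegrable.integrable_of_isBigO_atBot_atTop (w2.mul g2) ?_ (w1.mul g1) ?_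
  · simp only [mul_one]
    exact ⟨Iic 0, Iic_mem_atBot 0, integrableOn_exp_mul_Iic hk 0⟩
  · simp only [mul_one]
    refine ⟨Ioi 0, Ioi_mem_atTop 0, ?_⟩
    exact integrableOn_exp_mul_Ioi (by rw [neg_div] at hk; linarith) 0

theorem UContour.exists_norm_deriv_le (γ : UContour) : ∃ K : ℝ, ∀ t, ‖deriv γ t‖ ≤ K := by
  obtain ⟨K, hK⟩ := γ.lipschitz
  exact ⟨K, fun t => norm_deriv_le_of_lipschitz hK⟩

/-- The integrand over a contour with a general test function. -/
noncomputable def pullback (ε : ℝ) (γ : UContour) (H : ℝ → ℂ) (g : ℂ → ℂ) (t : ℝ) : ℂ :=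
  weight ε H t * g (γ t) * deriv γ t

theorem integrable_pullback (hA : IsAdmissible c z lam) {ε : ℝ} (hε : 0 < ε) {γ : UContour}
    {H : ℝ → ℂ} (hH : IsPhase c z lam γ H) {g : ℂ → ℂ} (hg : g ∈ testSpace z) :
    Integrable (pullback ε γ H g) := by
  obtain ⟨K, hK⟩ := γ.exists_norm_deriv_le
  exact (integrable_weight_mul hA hε hH hg).mul_bdd (c := K)
    (measurable_deriv γ).aestronglyMeasurable (Eventually.of_forall hK)

theorem integrand_eq_pullback (ε : ℝ) (γ : UContour) (H : ℝ → ℂ) (p : Fin P) :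
    integrand z ε γ H p = pullback ε γ H fun w => ((w - z p) ^ 1)⁻¹ := by
  funext t
  rw [integrand, pullback, weight, pow_one, div_eq_mul_inv]

/-- Integration of a primitive along a contour. -/
theorem integral_pullback_eq (hA : IsAdmissible c z lam) {ε : ℝ} (hε : 0 < ε) {γ : UContour}
    {H : ℝ → ℂ} (hH : IsPhase c z lam γ H) {g : ℂ → ℂ} (hg : g ∈ testSpace z) {Φ : ℝ → ℂ}
    (hΦ : Continuous Φ) (hd : ∀ t v, HasDerivAt γ v t → HasDerivAt Φ (weight ε H t * g (γ t) * v) t)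
    {a b : ℂ} (ha : Tendsto Φ atBot (𝓝 a)) (hb : Tendsto Φ atTop (𝓝 b)) :
    ∫ t, pullback ε γ H g t = b - a := by
  have hint := integrable_pullback hA hε hH hg
  -- The finitely many breaks are excluded in the fundamental theorem of calculus; continuity of Φ
  -- carries it across them.
  have h1 : ∀ T : ℝ, ∫ t in (-T)..T, pullback ε γ H g t = Φ T - Φ (-T) := fun T =>
    MeasureTheory.integral_eq_of_hasDerivAt_off_countable Φ _ (s := ↑γ.breaks)
      γ.breaks.countable_toSet hΦ.continuousOn
      (fun t ht => hd t _ (γ.differentiableAt fun h => ht.2 h).hasDerivAt)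
      hint.intervalIntegrable
  have h2 := intervalIntegral_tendsto_integral hint tendsto_neg_atTop_atBot tendsto_id
  simp only [id, h1] at h2
  exact tendsto_nhds_unique h2 (hb.sub (ha.comp tendsto_neg_atTop_atBot))

end Data

/-! ### Primitives of the weighted test functions and their continuation across the cuts. -/

theorem mem_ball_of_between {w₀ : ℂ} {r : ℝ} {w ζ : ℂ} (hw : w ∈ Metric.ball w₀ r)
    (hre : |ζ.re - w₀.re| ≤ |w.re - w₀.re|) (him : |ζ.im - w₀.im| ≤ |w.im - w₀.im|) :
    ζ ∈ Metric.ball w₀ r := by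
  rw [Metric.mem_ball, dist_eq_norm] at hw ⊢
  refine lt_of_le_of_lt ?_ hw
  rw [norm_def, norm_def]
  apply Real.sqrt_le_sqrt
  rw [normSq_apply, normSq_apply, sub_re, sub_im, sub_re, sub_im]
  have h1 := sq_le_sq.mpr hre
  have h2 := sq_le_sq.mpr him
  nlinarith

/-- Primitives on domains which are convex towards a horizontal line. -/
theorem exists_primitive {U : Set ℂ} (hU : IsOpen U) {ψ : ℂ → ℂ} (hψ : DifferentiableOn ℂ ψ U)
    (x₀ y₀ : ℝ) (hv : ∀ w ∈ U, ∀ y ∈ uIcc y₀ w.im, (w.re + y * I : ℂ) ∈ U)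
    (hh : ∀ w ∈ U, ∀ x ∈ uIcc x₀ w.re, (x + y₀ * I : ℂ) ∈ U) :
    ∃ F : ℂ → ℂ, ∀ w ∈ U, HasDerivAt F (ψ w) w := by
  -- The integral runs along the line Im = y₀ and then vertically. Near w₀ it differs from a
  -- primitive on a disk by a constant, by Cauchy's theorem on the rectangle between the line and
  -- the height of w₀.
  refine ⟨fun w => (∫ x in x₀..w.re, ψ (x + y₀ * I)) + I * ∫ y in y₀..w.im, ψ (w.re + y * I),
    fun w₀ hw₀ => ?_⟩
  obtain ⟨r, hr, hball⟩ := Metric.isOpen_iff.mp hU w₀ hw₀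
  obtain ⟨g, hg⟩ := (hψ.mono hball).isExactOn_ball
  have hcont : ∀ {α : ℝ → ℂ} {a b : ℝ}, Continuous α → (∀ t ∈ uIcc a b, α t ∈ U) →
      IntervalIntegrable (fun t => ψ (α t)) volume a b := fun {α a b} hα hm =>
    (hψ.continuousOn.comp hα.continuousOn hm).intervalIntegrable
  refine ((hg w₀ (Metric.mem_ball_self hr)).add_const
    (((∫ x in x₀..w₀.re, ψ (x + y₀ * I)) + I * ∫ y in y₀..w₀.im, ψ (w₀.re + y * I)) -
      g w₀)).congr_of_eventuallyEq ?_
  filter_upwards [Metric.ball_mem_nhds w₀ hr] with w hw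
  have hhor : ∀ x ∈ uIcc w₀.re w.re, (x + w₀.im * I : ℂ) ∈ Metric.ball w₀ r := fun x hx =>
    mem_ball_of_between hw (by simpa using abs_sub_left_of_mem_uIcc hx) (by simp)
  have hver : ∀ y ∈ uIcc w₀.im w.im, (w.re + y * I : ℂ) ∈ Metric.ball w₀ r := fun y hy =>
    mem_ball_of_between hw (by simp) (by simpa using abs_sub_left_of_mem_uIcc hy)
  have hrect : uIcc w₀.re w.re ×ℂ uIcc y₀ w₀.im ⊆ U := by
    rintro ζ ⟨h1, h2⟩
    have h3 := hball (hhor ζ.re h1)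
    have := hv _ h3 ζ.im (by simpa using h2)
    simpa using this
  have e1 := integral_boundary_rect_eq_zero_of_differentiableOn ψ (w₀.re + y₀ * I)
    (w.re + w₀.im * I) (by simpa using hψ.mono hrect)
  simp only [add_re, ofReal_re, mul_re, I_re, mul_zero, ofReal_im, I_im, mul_one, sub_self, add_zero,
    add_im, mul_im, zero_add, smul_eq_mul] at e1
  have hw1 : (w.re + w₀.im * I : ℂ) ∈ U := hball (hhor w.re right_mem_uIcc)
  have e2 : (∫ x in x₀..w.re, ψ (x + y₀ * I)) = (∫ x in x₀..w₀.re, ψ (x + y₀ * I)) +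
      ∫ x in w₀.re..w.re, ψ (x + y₀ * I) :=
    (intervalIntegral.integral_add_adjacent_intervals
      (hcont (α := fun x : ℝ => x + y₀ * I) (by fun_prop) (hh w₀ hw₀))
      (hcont (α := fun x : ℝ => x + y₀ * I) (by fun_prop) fun x hx => hrect
        ⟨by simpa using hx, by simp⟩)).symm
  have e3 : (∫ y in y₀..w.im, ψ (w.re + y * I)) = (∫ y in y₀..w₀.im, ψ (w.re + y * I)) +
      ∫ y in w₀.im..w.im, ψ (w.re + y * I) :=
    (intervalIntegral.integral_add_adjacent_intervals
      (hcont (α := fun y : ℝ => w.re + y * I) (by fun_prop) fun y hy => by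
        simpa using hv _ hw1 y (by simpa using hy))
      (hcont (α := fun y : ℝ => w.re + y * I) (by fun_prop) fun y hy => hball (hver y hy))).symm
  have e4 : ∫ x in w₀.re..w.re, ψ (x + w₀.im * I) = g (w.re + w₀.im * I) - g w₀ := by
    have := intervalIntegral.integral_eq_sub_of_hasDerivAt
      (f := fun x : ℝ => g (x + w₀.im * I)) (f' := fun x : ℝ => ψ (x + w₀.im * I))
      (a := w₀.re) (b := w.re) (fun x hx => by
        have h1 : HasDerivAt (fun x : ℝ => (x : ℂ) + w₀.im * I) 1 x := by
          simpa using (hasDerivAt_id x).ofReal_comp.add_const (w₀.im * I : ℂ)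
        have h2 := (hg _ (hhor x hx)).comp x h1
        rw [mul_one] at h2
        exact h2)
      (hcont (α := fun x : ℝ => x + w₀.im * I) (by fun_prop) fun x hx => hball (hhor x hx))
    rw [this]
    simp
  have e5 : I * ∫ y in w₀.im..w.im, ψ (w.re + y * I) = g w - g (w.re + w₀.im * I) := by
    have := intervalIntegral.integral_eq_sub_of_hasDerivAt
      (f := fun y : ℝ => g (w.re + y * I)) (f' := fun y : ℝ => I * ψ (w.re + y * I))
      (a := w₀.im) (b := w.im) (fun y hy => by
        have h1 : HasDerivAt (fun y : ℝ => (w.re : ℂ) + y * I) I y := by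
          simpa using ((hasDerivAt_id y).ofReal_comp.mul_const I).const_add (w.re : ℂ)
        have h2 := (hg _ (hver y hy)).comp y h1
        rw [mul_comm] at h2
        exact h2)
      ((hcont (α := fun y : ℝ => w.re + y * I) (by fun_prop) fun y hy =>
        hball (hver y hy)).const_mul I)
    rw [← intervalIntegral.integral_const_mul, this]
    simp
  rw [e2, e3]
  linear_combination e1 + e4 + e5

theorem eq_add_const_of_hasDerivAt {U : Set ℂ} (hU : Convex ℝ U) {F G : ℂ → ℂ} {ψ : ℂ → ℂ}
    (hF : ∀ w ∈ U, HasDerivAt F (ψ w) w) (hG : ∀ w ∈ U, HasDerivAt G (ψ w) w) :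
    ∃ κ, ∀ w ∈ U, F w = G w + κ := by
  rcases U.eq_empty_or_nonempty with rfl | ⟨a, ha⟩
  · exact ⟨0, fun w hw => hw.elim⟩
  refine ⟨F a - G a, fun w hw => ?_⟩
  have h := hU.norm_image_sub_le_of_norm_hasDerivWithin_le (f := fun w => F w - G w)
    (f' := fun _ => 0) (C := 0) (fun x hx => by
      have := ((hF x hx).sub (hG x hx)).hasDerivWithinAt (s := U)
      rw [sub_self] at this
      exact this) (by simp) ha hw
  rw [zero_mul, norm_le_zero_iff] at h
  linear_combination h

/-- The upper part of a vertical strip. -/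
def upStrip (J : Set ℝ) (Y : ℝ) : Set ℂ := {w | w.re ∈ J ∧ Y < w.im}

theorem convex_upStrip {J : Set ℝ} (hJ : Convex ℝ J) (Y : ℝ) : Convex ℝ (upStrip J Y) :=
  (hJ.linear_preimage reLm).inter (convex_halfSpace_im_gt Y)

theorem isOpen_upStrip {J : Set ℝ} (hJ : IsOpen J) (Y : ℝ) : IsOpen (upStrip J Y) :=
  (hJ.preimage continuous_re).inter (isOpen_lt continuous_const continuous_im)

section Data

variable {c z : Fin P → ℂ} {lam : ℝ}

/-- `(k, F)` consists of a branch `k` of `h` on `U`, and a primitive `F` of `e^{-ik/ε} g`. -/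
structure IsLocalSolution (c z : Fin P → ℂ) (lam ε : ℝ) (g : ℂ → ℂ) (U : Set ℂ) (k F : ℂ → ℂ) :
    Prop where
  regular : ∀ w ∈ U, Regular z w
  phase : ∀ w ∈ U, HasDerivAt k (lam + u0 c z w) w
  re_eq : ∀ w ∈ U, (-I * k w).re = R c z lam w
  primitive : ∀ w ∈ U, HasDerivAt F (exp (-I * k w / ε) * g w) w

theorem IsLocalSolution.mono {ε : ℝ} {g : ℂ → ℂ} {U V : Set ℂ} {k F : ℂ → ℂ}
    (hs : IsLocalSolution c z lam ε g U k F) (hV : V ⊆ U) : IsLocalSolution c z lam ε g V k F :=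
  ⟨fun w hw => hs.1 w (hV hw), fun w hw => hs.2 w (hV hw), fun w hw => hs.3 w (hV hw),
    fun w hw => hs.4 w (hV hw)⟩

theorem IsLocalSolution.sub_const {ε : ℝ} {g : ℂ → ℂ} {U : Set ℂ} {k F : ℂ → ℂ}
    (hs : IsLocalSolution c z lam ε g U k F) (ℓ : ℂ) :
    IsLocalSolution c z lam ε g U k fun w => F w - ℓ :=
  ⟨hs.1, hs.2, hs.3, fun w hw => (hs.4 w hw).sub_const ℓ⟩

theorem differentiableAt_testSpace {g : ℂ → ℂ} (hg : g ∈ testSpace z) {w : ℂ} (hw : Regular z w) :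
    DifferentiableAt ℂ g w := hg.1.differentiableAt ((isOpen_regular z).mem_nhds hw)

theorem differentiableOn_weighted {ε : ℝ} {g : ℂ → ℂ} (hg : g ∈ testSpace z) {U : Set ℂ} {k : ℂ → ℂ}
    (hreg : ∀ w ∈ U, Regular z w) (hk : ∀ w ∈ U, HasDerivAt k (lam + u0 c z w) w) :
    DifferentiableOn ℂ (fun w => exp (-I * k w / ε) * g w) U := fun w hw =>
  ((((hk w hw).differentiableAt.const_mul (-I)).div_const (ε : ℂ)).cexp.mul
    (differentiableAt_testSpace hg (hreg w hw))).differentiableWithinAt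

theorem isOpen_slitDomain (z : Fin P → ℂ) : IsOpen (slitDomain z) := by
  have : slitDomain z = ⋂ p, ({w | I * (w - z p) ∈ slitPlane} ∩
      {w | -I * (w - conj (z p)) ∈ slitPlane}) := by ext w; simp [slitDomain]
  rw [this]
  exact isOpen_iInter_of_finite fun p => (isOpen_slitPlane.preimage (by fun_prop)).inter
    (isOpen_slitPlane.preimage (by fun_prop))

/-- The slit domain contains the real line, and with each point the vertical segment down or up to
it. -/
theorem exists_solution_slitDomain (ε : ℝ) {g : ℂ → ℂ}
    (hA : IsAdmissible c z lam) (hg : g ∈ testSpace z) :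
    ∃ F, IsLocalSolution c z lam ε g (slitDomain z) (h c z lam) F := by
  have hopen := isOpen_slitDomain z
  have hd : ∀ w ∈ slitDomain z, HasDerivAt (h c z lam) (lam + u0 c z w) w := fun w hw =>
    hasDerivAt_h c z lam hw
  have hchar : ∀ w : ℂ, w ∈ slitDomain z ↔ ∀ p, (w.re = (z p).re → w.im < (z p).im ∧
      -(z p).im < w.im) := fun w => by
    refine forall_congr' fun p => ?_
    simp only [mem_slitPlane_iff, mul_re, I_re, sub_re, zero_mul, I_im, sub_im, one_mul, zero_sub,
      mul_im, neg_mul, neg_re, conj_re, conj_im, neg_im, zero_add]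
    constructor
    · rintro ⟨h1, h2⟩ h3
      exact ⟨by rcases h1 with h1 | h1 <;> [linarith; exact absurd (by linarith) h1],
        by rcases h2 with h2 | h2 <;> [linarith; exact absurd (by linarith) h2]⟩
    · intro h1
      by_cases h3 : w.re = (z p).re
      · exact ⟨Or.inl (by linarith [(h1 h3).1]), Or.inl (by linarith [(h1 h3).2])⟩
      · exact ⟨Or.inr fun h => h3 (by linarith), Or.inr fun h => h3 (by linarith)⟩
  obtain ⟨F, hF⟩ := exists_primitive hopen (differentiableOn_weighted (ε := ε) hg
    (fun w hw => regular_of_mem_slitDomain hw) hd) 0 0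
    (fun w hw y hy => by
      rw [hchar] at hw ⊢
      intro p hp
      have h1 := hw p (by simpa using hp)
      have h2 := hA.im_pos p
      rw [mem_uIcc] at hy
      simp only [add_im, ofReal_im, mul_im, ofReal_re, I_im, mul_one, I_re, mul_zero, add_zero,
        zero_add]
      rcases hy with hy | hy <;> constructor <;> linarith)
    (fun w _ x _ => by
      rw [hchar]
      intro p hp
      have h2 := hA.im_pos p
      simpa using h2)
  exact ⟨F, fun w hw => regular_of_mem_slitDomain hw, hd, fun w _ => rfl, hF⟩

/-- The real parts between the poles with indices `a, b` (exclusive bounds). -/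
def gap (z : Fin P → ℂ) (a b : ℕ) : Set ℝ :=
  {x | ∀ p : Fin P, ((p : ℕ) < a → (z p).re < x) ∧ (b ≤ (p : ℕ) → x < (z p).re)}

theorem isOpen_gap (z : Fin P → ℂ) (a b : ℕ) : IsOpen (gap z a b) := by
  have : gap z a b = ⋂ p : Fin P, ({x | (p : ℕ) < a → (z p).re < x} ∩
      {x | b ≤ (p : ℕ) → x < (z p).re}) := by ext x; simp [gap]
  rw [this]
  refine isOpen_iInter_of_finite fun p => IsOpen.inter ?_ ?_
  · by_cases h : (p : ℕ) < a
    · simp only [h, true_imp_iff]; exact isOpen_Ioi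
    · simp [h]
  · by_cases h : b ≤ (p : ℕ)
    · simp only [h, true_imp_iff]; exact isOpen_Iio
    · simp [h]

theorem convex_gap (z : Fin P → ℂ) (a b : ℕ) : Convex ℝ (gap z a b) := by
  have : OrdConnected (gap z a b) := ⟨fun x hx y hy w hw p =>
    ⟨fun h => ((hx p).1 h).trans_le hw.1, fun h => hw.2.trans_lt ((hy p).2 h)⟩⟩
  exact this.convex

theorem upStrip_gap_subset_slitDomain (n : ℕ) (Y : ℝ) :
    upStrip (gap z n n) Y ⊆ slitDomain z := fun w hw p => by
  have hne : w.re ≠ (z p).re := by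
    rcases lt_or_ge (p : ℕ) n with h | h
    · exact ((hw.1 p).1 h).ne'
    · exact ((hw.1 p).2 h).ne
  rw [mem_slitPlane_iff, mem_slitPlane_iff]
  simp only [mul_re, I_re, sub_re, zero_mul, I_im, sub_im, one_mul, zero_sub,
      mul_im, neg_mul, neg_re, conj_re, conj_im, neg_im, zero_add]
  exact ⟨Or.inr fun h => hne (by linarith), Or.inr fun h => hne (by linarith)⟩

/-- Common vertical limits of local solutions on strips. -/
theorem IsLocalSolution.exists_limit (hA : IsAdmissible c z lam) {ε : ℝ} (hε : 0 < ε) {g : ℂ → ℂ}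
    (hg : g ∈ testSpace z) {J : Set ℝ} (hJ : Convex ℝ J) {Y : ℝ} {k F : ℂ → ℂ}
    (hs : IsLocalSolution c z lam ε g (upStrip J Y) k F) :
    ∃ ℓ, ∀ x ∈ J, Tendsto (fun y : ℝ => F (x + y * I)) atTop (𝓝 ℓ) := by
  obtain ⟨K, hK0, C, hC, hK⟩ := exists_R_le hA
  obtain ⟨-, M, K', hM⟩ := id hg
  set a := lam / ε with ha
  have ha0 : a < 0 := div_neg_of_neg_of_pos hA.lam_neg hε
  have hM0 : 0 ≤ M := (norm_nonneg _).trans (hM ((|K'| : ℝ) : ℂ) (by simp [le_abs_self]))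
  set Y' := max (max K K') (Y + 1) with hY'
  -- The bound depends on the height only. Integrated along one vertical line it gives a limit;
  -- along horizontal segments it shows that the limit is the same on every line.
  have hbound : ∀ w ∈ upStrip J Y, Y' ≤ w.im → ‖exp (-I * k w / ε) * g w‖ ≤
      Real.exp (C / ε) * M * Real.exp (a * w.im) := fun w hw hwY => by
    have hn := (le_abs_self _).trans (abs_im_le_norm w)
    rw [hY', max_le_iff, max_le_iff] at hwY
    have h1 := hK w (by linarith)
    have h2 := hM w (by linarith)
    have h3 : ‖exp (-I * k w / ε)‖ ≤ Real.exp (C / ε) * Real.exp (a * w.im) := by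
      rw [norm_exp, div_ofReal_re, hs.re_eq w hw, ← Real.exp_add, Real.exp_le_exp, ha,
        div_mul_eq_mul_div, ← add_div]
      gcongr
      linarith
    rw [norm_mul, mul_right_comm]
    exact mul_le_mul h3 h2 (norm_nonneg _) (by positivity)
  have hmem : ∀ x ∈ J, ∀ y ≥ Y', (x + y * I : ℂ) ∈ upStrip J Y := fun x hx y hy => by
    refine ⟨by simpa using hx, ?_⟩
    have := (le_max_right _ _).trans hy
    simp only [add_im, ofReal_im, mul_im, ofReal_re, I_im, mul_one, I_re, mul_zero, add_zero,
      zero_add]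
    linarith
  have hlim0 : Tendsto (fun y : ℝ => Real.exp (a * y)) atTop (𝓝 0) :=
    Real.tendsto_exp_atBot.comp (tendsto_id.const_mul_atTop_of_neg ha0)
  rcases J.eq_empty_or_nonempty with rfl | ⟨x₀, hx₀⟩
  · exact ⟨0, fun x hx => hx.elim⟩
  have hd : ∀ y ∈ Ioi Y', HasDerivAt (fun y : ℝ => F (x₀ + y * I))
      (exp (-I * k (x₀ + y * I) / ε) * g (x₀ + y * I) * I) y := fun y hy => by
    have h1 : HasDerivAt (fun y : ℝ => (x₀ : ℂ) + y * I) I y := by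
      simpa using ((hasDerivAt_id y).ofReal_comp.mul_const I).const_add (x₀ : ℂ)
    exact (hs.primitive _ (hmem x₀ hx₀ y (le_of_lt hy))).comp y h1
  have hint : IntegrableOn (fun y : ℝ => exp (-I * k (x₀ + y * I) / ε) * g (x₀ + y * I) * I)
      (Ioi Y') := by
    have hgexp := (integrableOn_exp_mul_Ioi ha0 Y').const_mul (Real.exp (C / ε) * M)
    refine Integrable.mono' hgexp ?_ ?_
    · refine ContinuousOn.aestronglyMeasurable (fun y hy => ?_) measurableSet_Ioi
      have hw := hmem x₀ hx₀ y (le_of_lt hy)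
      have h1 := (hs.phase _ hw).continuousAt
      have h2 := (differentiableAt_testSpace hg (hs.regular _ hw)).continuousAt
      have h3 : ContinuousAt (fun y : ℝ => (x₀ : ℂ) + y * I) y := by fun_prop
      have h4 := h1.comp (f := fun y : ℝ => (x₀ : ℂ) + y * I) h3
      have h5 := h2.comp (f := fun y : ℝ => (x₀ : ℂ) + y * I) h3
      exact ((((h4.const_mul (-I)).div_const (ε : ℂ)).cexp.mul h5).mul
        continuousAt_const).continuousWithinAt
    · refine (ae_restrict_mem measurableSet_Ioi).mono fun y hy => ?_
      have := hbound _ (hmem x₀ hx₀ y (le_of_lt hy)) (by simpa using le_of_lt hy)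
      rw [norm_mul, norm_I, mul_one]
      simpa using this
  obtain ⟨ℓ, hl⟩ : ∃ ℓ, Tendsto (fun y : ℝ => F (x₀ + y * I)) atTop (𝓝 ℓ) :=
    ⟨_, tendsto_limUnder_of_hasDerivAt_of_integrableOn_Ioi hd hint⟩
  refine ⟨ℓ, fun x hx => ?_⟩
  have hdiff : Tendsto (fun y : ℝ => F (x + y * I) - F (x₀ + y * I)) atTop (𝓝 0) := by
    have hz : Tendsto (fun y : ℝ => Real.exp (C / ε) * M * Real.exp (a * y) * ‖(x : ℂ) - x₀‖) atTop
        (𝓝 0) := by simpa using (hlim0.const_mul (Real.exp (C / ε) * M)).mul_const ‖(x : ℂ) - x₀‖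
    refine squeeze_zero_norm' ?_ hz
    filter_upwards [eventually_ge_atTop Y'] with y hy
    have hconv : Convex ℝ ({w : ℂ | w.re ∈ J} ∩ {w : ℂ | w.im = y}) :=
      (hJ.linear_preimage reLm).inter (convex_hyperplane (f := Complex.im) ⟨by simp, by simp⟩ y)
    have hw : ∀ w ∈ ({w : ℂ | w.re ∈ J} ∩ {w : ℂ | w.im = y}), w ∈ upStrip J Y ∧ w.im = y :=
      fun w hw => ⟨⟨hw.1, by
        rw [show w.im = y from hw.2]
        have := (le_max_right _ _).trans hy
        linarith⟩, hw.2⟩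
    have := hconv.norm_image_sub_le_of_norm_hasDerivWithin_le (f := F)
      (f' := fun w => exp (-I * k w / ε) * g w) (C := Real.exp (C / ε) * M * Real.exp (a * y))
      (fun w h => (hs.primitive w (hw w h).1).hasDerivWithinAt)
      (fun w h => by
        have := hbound w (hw w h).1 ((hw w h).2 ▸ hy)
        rwa [(hw w h).2] at this)
      (show (x₀ + y * I : ℂ) ∈ _ from ⟨by simpa using hx₀, by simp⟩)
      (show (x + y * I : ℂ) ∈ _ from ⟨by simpa using hx, by simp⟩)
    simpa using this
  simpa using hdiff.add hl

/-- Decaying local solutions agree. -/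
theorem IsLocalSolution.eq_of_decay {ε : ℝ} {g : ℂ → ℂ} {J : Set ℝ} (hJ : Convex ℝ J) {Y : ℝ}
    {k F k' F' : ℂ → ℂ} (hs : IsLocalSolution c z lam ε g (upStrip J Y) k F)
    (hs' : IsLocalSolution c z lam ε g (upStrip J Y) k' F')
    (hF : ∀ x ∈ J, Tendsto (fun y : ℝ => F (x + y * I)) atTop (𝓝 0))
    (hF' : ∀ x ∈ J, Tendsto (fun y : ℝ => F' (x + y * I)) atTop (𝓝 0)) {w : ℂ}
    (hw : w ∈ upStrip J Y) : exp (I * k w / ε) * F w = exp (I * k' w / ε) * F' w := by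
  have hconv := convex_upStrip hJ Y
  -- Changing the branch by κ multiplies the decaying primitive by e^{-iκ/ε}, and the prefactor
  -- e^{ik/ε} compensates for it.
  obtain ⟨κ, hκ⟩ := eq_add_const_of_hasDerivAt hconv hs.phase hs'.phase
  have hG : ∀ w ∈ upStrip J Y, HasDerivAt (fun w => exp (-I * κ / ε) * F' w)
      (exp (-I * k w / ε) * g w) w := fun w hw => by
    refine ((hs'.primitive w hw).const_mul (exp (-I * κ / ε))).congr_deriv ?_
    rw [hκ w hw, ← mul_assoc, ← exp_add]
    congr 2
    ring
  obtain ⟨κ', hκ'⟩ := eq_add_const_of_hasDerivAt hconv hs.primitive hG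
  have hx := hw.1
  have h0 : κ' = 0 := by
    have h1 := (hF w.re hx).sub ((hF' w.re hx).const_mul (exp (-I * κ / ε)))
    rw [mul_zero, sub_zero] at h1
    refine tendsto_nhds_unique (tendsto_const_nhds.congr' ?_) h1
    filter_upwards [eventually_gt_atTop Y] with y hy
    have := hκ' (w.re + y * I) ⟨by simpa using hx, by simpa using hy⟩
    rw [this]; ring
  rw [hκ' w hw, h0, add_zero, hκ w hw, ← mul_assoc, ← exp_add]
  congr 2
  ring

/-- Local solutions on half-strips above a pole. -/
theorem exists_solution_above_pole (hA : IsAdmissible c z lam) (ε : ℝ) {g : ℂ → ℂ}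
    (hg : g ∈ testSpace z) (p : Fin P) :
    ∃ k F, IsLocalSolution c z lam ε g (upStrip (gap z p (p + 1)) (z p).im) k F := by
  set U := upStrip (gap z p (p + 1)) (z p).im with hU
  have hUo : IsOpen U := isOpen_upStrip (isOpen_gap _ _ _) _
  have hUc : Convex ℝ U := convex_upStrip (convex_gap _ _ _) _
  have hpJ : (z p).re ∈ gap z p (p + 1) := fun q =>
    ⟨fun hq => hA.re_strictMono (Fin.lt_def.mpr hq), fun hq => hA.re_strictMono (Fin.lt_def.mpr hq)⟩
  have hreg : ∀ w ∈ U, Regular z w := fun w hw => by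
    refine hA.regular_of_im_pos ((hA.im_pos p).trans hw.2) fun q hq => ?_
    subst hq
    rcases lt_trichotomy q p with h | rfl | h
    · exact lt_irrefl _ ((hw.1 q).1 h)
    · exact lt_irrefl _ hw.2
    · exact lt_irrefl _ ((hw.1 q).2 h)
  have hv : ∀ w ∈ U, ∀ y ∈ uIcc ((z p).im + 1) w.im, (w.re + y * I : ℂ) ∈ U := fun w hw y hy => by
    refine ⟨by simpa using hw.1, ?_⟩
    have := hw.2
    rw [mem_uIcc] at hy
    simp only [add_im, ofReal_im, mul_im, ofReal_re, I_im, mul_one, I_re, mul_zero, add_zero,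
      zero_add]
    rcases hy with hy | hy <;> linarith
  have hh : ∀ w ∈ U, ∀ x ∈ uIcc (z p).re w.re, (x + ((z p).im + 1 : ℝ) * I : ℂ) ∈ U :=
    fun w hw x hx => ⟨by
      simpa using (convex_gap z p (p + 1)).ordConnected.uIcc_subset hpJ hw.1 hx, by simp⟩
  have hdu : DifferentiableOn ℂ (fun w => (lam : ℂ) + u0 c z w) U := fun w hw =>
    ((differentiableAt_u0 (hreg w hw)).const_add _).differentiableWithinAt
  obtain ⟨k, hk⟩ := exists_primitive hUo hdu (z p).re ((z p).im + 1) hv hh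
  set a : ℂ := (z p).re + ((z p).im + 1 : ℝ) * I with ha
  have haU : a ∈ U := ⟨by simpa [ha] using hpJ, by simp [ha]⟩
  -- A primitive of h' matches `R` only up to a real constant; subtracting iκ from k removes it.
  have hconst : ∀ w ∈ U, (-I * k w).re - R c z lam w = (-I * k a).re - R c z lam a := fun w hw => by
    let σ : ℝ → ℂ := fun t => a + t * (w - a)
    have hσ : ∀ t ∈ Icc (0 : ℝ) 1, σ t ∈ U := fun t ht => by
      have := hUc.add_smul_sub_mem haU hw ht
      simpa [σ] using this
    have hσd : ∀ t, HasDerivAt σ (w - a) t := fun t => by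
      simpa [σ] using ((hasDerivAt_id t).ofReal_comp.mul_const (w - a)).const_add a
    have hd : ∀ t ∈ Icc (0 : ℝ) 1, HasDerivAt (fun t => (-I * k (σ t)).re - R c z lam (σ t)) 0 t :=
      fun t ht => by
        have h1 := (((hk _ (hσ t ht)).comp t (hσd t)).const_mul (-I))
        have h2 := reCLM.hasFDerivAt.comp_hasDerivAt t h1
        have h3 := hasDerivAt_R_comp hA (hreg _ (hσ t ht)) (hσd t)
        refine (h2.sub h3).congr_deriv ?_
        simp only [reCLM_apply]
        rw [← mul_assoc, sub_self]
    have := constant_of_has_deriv_right_zero (f := fun t => (-I * k (σ t)).re - R c z lam (σ t))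
      (fun t ht => (hd t ht).continuousAt.continuousWithinAt)
      (fun t ht => (hd t (Ico_subset_Icc_self ht)).hasDerivWithinAt) 1 (right_mem_Icc.mpr zero_le_one)
    simpa [σ] using this
  set κ : ℝ := (-I * k a).re - R c z lam a with hκ
  have hk' : ∀ w ∈ U, HasDerivAt (fun w => k w - I * κ) (lam + u0 c z w) w := fun w hw =>
    (hk w hw).sub_const _
  obtain ⟨F, hF⟩ := exists_primitive hUo (differentiableOn_weighted (ε := ε) hg hreg hk')
    (z p).re ((z p).im + 1) hv hh
  refine ⟨_, F, hreg, hk', fun w hw => ?_, hF⟩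
  have h1 := hconst w hw
  have h2 : -I * (k w - I * κ) = -I * k w - κ := by linear_combination (κ : ℂ) * I_mul_I
  rw [h2, sub_re, ofReal_re]
  linarith

theorem UContour.tendsto_comp (γ : UContour) {α : Type*} {l : Filter α} {F : ℂ → α} :
    (Tendsto (fun y : ℝ => F (γ.right + y * I)) atTop l → Tendsto (fun t => F (γ t)) atTop l) ∧
    (Tendsto (fun y : ℝ => F (γ.left + y * I)) atTop l → Tendsto (fun t => F (γ t)) atBot l) := by
  obtain ⟨T, hT, hT'⟩ := γ.tails
  constructor
  · intro h
    refine h.congr' ?_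
    filter_upwards [eventually_ge_atTop T] with t ht
    rw [hT t ht]
  · intro h
    refine (h.comp tendsto_neg_atBot_atTop).congr' ?_
    filter_upwards [eventually_le_atBot (-T)] with t ht
    rw [hT' t ht]
    simp [sub_eq_add_neg]

theorem gap_subset_left (p : Fin P) : gap z p p ⊆ gap z p (p + 1) := fun _ hx q =>
  ⟨(hx q).1, fun h => (hx q).2 (Nat.le_of_succ_le h)⟩

theorem gap_subset_right (p : Fin P) : gap z (p + 1) (p + 1) ⊆ gap z p (p + 1) := fun _ hx q =>
  ⟨fun h => (hx q).1 (Nat.lt_succ_of_lt h), (hx q).2⟩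

theorem mem_gap_cases {p : Fin P} {x : ℝ} (hx : x ∈ gap z p (p + 1)) (hne : x ≠ (z p).re) :
    ∃ n ≤ P, (n = p ∨ n = p + 1) ∧ x ∈ gap z n n := by
  rcases hne.lt_or_gt with h | h
  · refine ⟨p, p.2.le, Or.inl rfl, fun q => ⟨(hx q).1, fun hq => ?_⟩⟩
    rcases hq.eq_or_lt with h1 | h1
    · rwa [← Fin.ext h1]
    · exact (hx q).2 h1
  · refine ⟨p + 1, p.2, Or.inr rfl, fun q => ⟨fun hq => ?_, (hx q).2⟩⟩
    rcases (Nat.le_of_lt_succ hq).eq_or_lt with h1 | h1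
    · rwa [Fin.ext h1]
    · exact (hx q).1 h1

theorem IsAdmissible.exists_mem_gap (hA : IsAdmissible c z lam) {x : ℝ}
    (hx : ∀ p, x ≠ (z p).re) : ∃ n ≤ P, x ∈ gap z n n := by
  classical
  rcases (Finset.univ.filter fun p => (z p).re < x).eq_empty_or_nonempty with he | hne
  · refine ⟨0, Nat.zero_le _, fun p => ⟨fun h => absurd h (Nat.not_lt_zero _), fun _ => ?_⟩⟩
    refine lt_of_le_of_ne (not_lt.mp fun h => ?_) (hx p)
    have : p ∈ Finset.univ.filter fun p => (z p).re < x := by simpa using h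
    rw [he] at this
    simp at this
  · obtain ⟨p, hp, hmax⟩ := Finset.exists_max_image _ id hne
    simp only [Finset.mem_filter, Finset.mem_univ, true_and, id] at hp hmax
    refine ⟨p + 1, p.2, fun q => ⟨fun h => ?_, fun h => ?_⟩⟩
    · exact (hA.re_strictMono.monotone (Fin.le_def.mpr (Nat.le_of_lt_succ h))).trans_lt hp
    · refine lt_of_le_of_ne (not_lt.mp fun h' => ?_) (hx q)
      exact absurd (Fin.le_def.mp (hmax q h')) (not_le.mpr h)

/-- Integrals over contours in the slit domain depend only on their ends. -/
theorem integral_eq_of_isU (hA : IsAdmissible c z lam) {ε : ℝ} (hε : 0 < ε) {g : ℂ → ℂ}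
    (hg : g ∈ testSpace z) {F : ℂ → ℂ} (hF : IsLocalSolution c z lam ε g (slitDomain z) (h c z lam) F)
    {ℓ : ℕ → ℂ} (hℓ : ∀ n, ∀ x ∈ gap z n n, Tendsto (fun y : ℝ => F (x + y * I)) atTop (𝓝 (ℓ n)))
    {m : Fin P} {γ : UContour} (hγ : IsU z m γ) :
    ∫ t, pullback ε γ (fun t => h c z lam (γ t)) g t = ℓ (m + 1) - ℓ 0 := by
  obtain ⟨hγ1, hγ2, hγ3, hγ4⟩ := hγ
  refine integral_pullback_eq hA hε (isPhase_h hγ1) hg (Φ := fun t => F (γ t)) ?_ ?_ ?_ ?_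
  · exact continuous_iff_continuousAt.mpr fun t =>
      (hF.primitive _ (hγ1 t)).continuousAt.comp γ.continuous.continuousAt
  · exact fun t v hv => (hF.primitive _ (hγ1 t)).comp t hv
  · exact γ.tendsto_comp.2 (hℓ 0 _ fun p => ⟨fun h => absurd h (Nat.not_lt_zero _), fun _ => hγ2 p⟩)
  · exact γ.tendsto_comp.1 (hℓ _ _ fun p => ⟨fun h => hγ3 p (Fin.le_def.mpr (Nat.le_of_lt_succ h)),
      fun h => hγ4 p (Fin.lt_def.mpr h)⟩)

theorem exists_limits (hA : IsAdmissible c z lam) {ε : ℝ} (hε : 0 < ε) {g : ℂ → ℂ}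
    (hg : g ∈ testSpace z) {F : ℂ → ℂ}
    (hF : IsLocalSolution c z lam ε g (slitDomain z) (h c z lam) F) : ∃ ℓ : ℕ → ℂ, ∀ n,
    ∀ x ∈ gap z n n, Tendsto (fun y : ℝ => F (x + y * I)) atTop (𝓝 (ℓ n)) := by
  choose ℓ hℓ using fun n => (hF.mono (upStrip_gap_subset_slitDomain n 0)).exists_limit hA hε hg
    (convex_gap z n n)
  exact ⟨ℓ, hℓ⟩

/-- The product G = e^{ik/ε}F solves G' = g + (i/ε)h'G, an equation in which the branch no longer
appears. -/
theorem IsLocalSolution.hasDerivAt {ε : ℝ} {g : ℂ → ℂ} {U : Set ℂ} {k F : ℂ → ℂ}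
    (hs : IsLocalSolution c z lam ε g U k F) {w : ℂ} (hw : w ∈ U) :
    HasDerivAt (fun w => exp (I * k w / ε) * F w)
      (g w + I / ε * (lam + u0 c z w) * (exp (I * k w / ε) * F w)) w := by
  refine (((((hs.phase w hw).const_mul I).div_const (ε : ℂ)).cexp).mul
    (hs.primitive w hw)).congr_deriv ?_
  have : exp (I * k w / ε) * exp (-I * k w / ε) = 1 := by
    rw [← exp_add]; ring_nf; exact exp_zero
  linear_combination g w * this

/-- If the integrals over all contours in the slit domain vanish, then so do those along contours
on other sheets. -/
theorem integral_eq_zero (hA : IsAdmissible c z lam) {ε : ℝ} (hε : 0 < ε) {g : ℂ → ℂ}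
    (hg : g ∈ testSpace z) {C : Fin P → UContour} (hC : ∀ m, IsU z m (C m))
    (hzero : ∀ m, ∫ t, pullback ε (C m) (fun t => h c z lam (C m t)) g t = 0)
    {γ : UContour} {H : ℝ → ℂ} (hH : IsPhase c z lam γ H)
    (hγ : ∀ t p, -(z p).im < (γ t).im) : ∫ t, pullback ε γ H g t = 0 := by
  classical
  obtain ⟨F, hF⟩ := exists_solution_slitDomain (lam := lam) ε hA hg
  obtain ⟨ℓ, hℓ⟩ := exists_limits hA hε hg hF
  -- The integral over `C m` is the difference of the limits of F in gaps m + 1 and 0. As all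
  -- vanish, one normalization makes F decay in all P + 1 gaps.
  have hℓ0 : ∀ n ≤ P, ℓ n = ℓ 0 := fun n hn => by
    rcases n with _ | n
    · rfl
    · have := hzero ⟨n, hn⟩
      rw [integral_eq_of_isU hA hε hg hF hℓ (hC _)] at this
      exact sub_eq_zero.mp this
  have hF0 := hF.sub_const (ℓ 0)
  set F₀ : ℂ → ℂ := fun w => F w - ℓ 0 with hF₀
  have hF0lim : ∀ n ≤ P, ∀ x ∈ gap z n n, Tendsto (fun y : ℝ => F₀ (x + y * I)) atTop (𝓝 0) :=
    fun n hn x hx => by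
      have := (hℓ n x hx).sub_const (ℓ 0)
      rwa [hℓ0 n hn, sub_self] at this
  have hpole : ∀ p : Fin P, ∃ k F, IsLocalSolution c z lam ε g
      (upStrip (gap z p (p + 1)) (z p).im) k F ∧ ∀ x ∈ gap z p (p + 1),
        Tendsto (fun y : ℝ => F (x + y * I)) atTop (𝓝 0) := fun p => by
    obtain ⟨k, F, hs⟩ := exists_solution_above_pole hA ε hg p
    obtain ⟨ℓ', hℓ'⟩ := hs.exists_limit hA hε hg (convex_gap _ _ _)
    refine ⟨k, _, hs.sub_const ℓ', fun x hx => ?_⟩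
    have := (hℓ' x hx).sub_const ℓ'
    rwa [sub_self] at this
  choose k Fp hs hFp using hpole
  -- On an upward cut the sum has the single term of the pole below, as the real parts of the poles
  -- are distinct. Values on the downward cuts are irrelevant.
  set K : ℂ → ℂ := fun w => if w ∈ slitDomain z then exp (I * h c z lam w / ε) * F₀ w
    else ∑ p : Fin P, if w.re = (z p).re then exp (I * k p w / ε) * Fp p w else 0 with hK
  have hKslit : ∀ w ∈ slitDomain z, K w = exp (I * h c z lam w / ε) * F₀ w := fun w hw => if_pos hw
  have hKpole : ∀ p : Fin P, ∀ w ∈ upStrip (gap z p (p + 1)) (z p).im,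
      K w = exp (I * k p w / ε) * Fp p w := fun p w hw => by
    by_cases hre : w.re = (z p).re
    · have hns : w ∉ slitDomain z := fun h => by
        have := (h p).1
        rw [mem_slitPlane_iff] at this
        simp only [mul_re, I_re, sub_re, zero_mul, I_im, sub_im, one_mul, zero_sub, mul_im,
          zero_add, hre, sub_self] at this
        rcases this with h | h
        · linarith [hw.2]
        · exact h rfl
      simp only [hK, if_neg hns]
      rw [Finset.sum_eq_single p, if_pos hre]
      · intro q _ hq
        exact if_neg fun h' => hq (hA.re_strictMono.injective (h'.symm.trans hre))
      · simp
    · obtain ⟨n, hn, hnp, hx⟩ := mem_gap_cases hw.1 hre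
      have hsub : gap z n n ⊆ gap z p (p + 1) := by
        rcases hnp with rfl | rfl
        · exact gap_subset_left p
        · exact gap_subset_right p
      have hw' : w ∈ upStrip (gap z n n) (z p).im := ⟨hx, hw.2⟩
      rw [hKslit w (upStrip_gap_subset_slitDomain n _ hw')]
      -- Uniqueness of decaying solutions on either side of the cut makes K continue across it.
      exact IsLocalSolution.eq_of_decay (convex_gap z n n)
        (hF0.mono (upStrip_gap_subset_slitDomain n _)) ((hs p).mono fun w hw => ⟨hsub hw.1, hw.2⟩)
        (hF0lim n hn) (fun x hx => hFp p x (hsub hx)) hw'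
  have hslito := isOpen_slitDomain z
  have hKd : ∀ w, Regular z w → (∀ p, -(z p).im < w.im) →
      HasDerivAt K (g w + I / ε * (lam + u0 c z w) * K w) w := fun w hw him => by
    by_cases hsl : w ∈ slitDomain z
    · rw [hKslit w hsl]
      exact (hF0.hasDerivAt hsl).congr_of_eventuallyEq
        (mem_of_superset (hslito.mem_nhds hsl) hKslit)
    · have : ∃ p, I * (w - z p) ∉ slitPlane := by
        by_contra! hcon
        refine hsl fun p => ⟨hcon p, mem_slitPlane_iff.mpr (Or.inl ?_)⟩
        simp only [mul_re, I_re, sub_re, I_im, sub_im, neg_re, conj_im, neg_im]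
        linarith [him p]
      obtain ⟨p, hp⟩ := this
      rw [mem_slitPlane_iff] at hp
      push Not at hp
      simp only [mul_re, I_re, sub_re, zero_mul, I_im, sub_im, one_mul, zero_sub, mul_im,
          zero_add] at hp
      have hre : w.re = (z p).re := by linarith [hp.2]
      have hlt : (z p).im < w.im := by
        refine lt_of_le_of_ne (by linarith [hp.1]) fun h' => (hw p).1 ?_
        exact Complex.ext hre h'.symm
      have hmem : w ∈ upStrip (gap z p (p + 1)) (z p).im := ⟨fun q => by
        rw [hre]
        exact ⟨fun hq => hA.re_strictMono (Fin.lt_def.mpr hq),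
          fun hq => hA.re_strictMono (Fin.lt_def.mpr hq)⟩, hlt⟩
      rw [hKpole p w hmem]
      exact ((hs p).hasDerivAt hmem).congr_of_eventuallyEq
        (mem_of_superset ((isOpen_upStrip (isOpen_gap _ _ _) _).mem_nhds hmem) (hKpole p))
  have htail : ∀ x : ℝ, Tendsto (fun y : ℝ => ‖K (x + y * I)‖ * Real.exp (R c z lam (x + y * I) / ε))
      atTop (𝓝 0) := fun x => by
    have key : ∀ {U : Set ℂ} {k' F' : ℂ → ℂ}, IsLocalSolution c z lam ε g U k' F' →
        (∀ w ∈ U, K w = exp (I * k' w / ε) * F' w) →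
        (∀ᶠ y : ℝ in atTop, (x + y * I : ℂ) ∈ U) →
        Tendsto (fun y : ℝ => F' (x + y * I)) atTop (𝓝 0) →
        Tendsto (fun y : ℝ => ‖K (x + y * I)‖ * Real.exp (R c z lam (x + y * I) / ε))
          atTop (𝓝 0) := fun {U k' F'} h1 h2 h3 h4 => by
      refine (tendsto_zero_iff_norm_tendsto_zero.mp h4).congr' ?_
      filter_upwards [h3] with y hy
      have h5 : (I * k' (x + y * I)).re = -R c z lam (x + y * I) := by
        rw [← h1.re_eq _ hy, neg_mul, neg_re, neg_neg]
      rw [h2 _ hy, norm_mul, norm_exp, div_ofReal_re, h5, mul_right_comm, ← Real.exp_add, neg_div,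
        neg_add_cancel, Real.exp_zero, one_mul]
    by_cases hx : ∀ p, x ≠ (z p).re
    · obtain ⟨n, hn, hxn⟩ := hA.exists_mem_gap hx
      refine key hF0 hKslit ?_ (hF0lim n hn x hxn)
      filter_upwards [eventually_gt_atTop 0] with y hy
      exact upStrip_gap_subset_slitDomain n 0 ⟨by simpa using hxn, by simpa using hy⟩
    · push Not at hx
      obtain ⟨p, rfl⟩ := hx
      have hmem : (z p).re ∈ gap z p (p + 1) := fun q =>
        ⟨fun hq => hA.re_strictMono (Fin.lt_def.mpr hq), fun hq => hA.re_strictMono (Fin.lt_def.mpr hq)⟩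
      refine key (hs p) (hKpole p) ?_ (hFp p _ hmem)
      filter_upwards [eventually_gt_atTop (z p).im] with y hy
      exact ⟨by simpa using hmem, by simpa using hy⟩
  have hlim : Tendsto (fun t => K (γ t) * weight ε H t) atTop (𝓝 0) ∧
      Tendsto (fun t => K (γ t) * weight ε H t) atBot (𝓝 0) := by
    have hn : ∀ t, ‖K (γ t) * weight ε H t‖ = ‖K (γ t)‖ * Real.exp (R c z lam (γ t) / ε) :=
      fun t => by rw [norm_mul, norm_weight hH]
    exact ⟨tendsto_zero_iff_norm_tendsto_zero.mpr (by
        simpa only [hn] using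
          (γ.tendsto_comp (F := fun w => ‖K w‖ * Real.exp (R c z lam w / ε))).1 (htail _)),
      tendsto_zero_iff_norm_tendsto_zero.mpr (by
        simpa only [hn] using
          (γ.tendsto_comp (F := fun w => ‖K w‖ * Real.exp (R c z lam w / ε))).2 (htail _))⟩
  -- K times the weight of the given branch is a primitive of the integrand: the terms with h'
  -- cancel. It tends to 0 at both ends.
  rw [integral_pullback_eq hA hε hH hg (Φ := fun t => K (γ t) * weight ε H t) ?_ ?_ hlim.2 hlim.1,
    sub_self]
  · refine Continuous.mul (continuous_iff_continuousAt.mpr fun t => ?_)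
      (continuous_weight hH.continuous)
    exact (hKd _ (hH.regular t) (hγ t)).continuousAt.comp γ.continuous.continuousAt
  · intro t v hv
    have h1 := (hKd _ (hH.regular t) (hγ t)).comp t hv
    have h2 : HasDerivAt (weight ε H)
        (weight ε H t * (-I * ((lam + u0 c z (γ t)) * v) / ε)) t :=
      (((hH.hasDerivAt t v hv).const_mul (-I)).div_const (ε : ℂ)).cexp
    refine (h1.mul h2).congr_deriv ?_
    simp only [Function.comp_apply]
    ring

end Data

/-! ### Cauchy transforms of the weights: holomorphy and Taylor expansion. -/

theorem UContour.tendsto_cocompact (γ : UContour) : Tendsto γ (cocompact ℝ) (cocompact ℂ) := by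
  rw [cocompact_eq_atBot_atTop, ← Metric.cobounded_eq_cocompact, ← tendsto_norm_atTop_iff_cobounded,
    tendsto_atTop]
  intro K
  rw [eventually_sup]
  exact ⟨(γ.eventually_far K).2.mono fun _ h => h.1, (γ.eventually_far K).1.mono fun _ h => h.1⟩

theorem UContour.isClosedMap (γ : UContour) : IsClosedMap γ :=
  (isProperMap_iff_tendsto_cocompact.mpr ⟨γ.continuous, γ.tendsto_cocompact⟩).isClosedMap

theorem UContour.isClosed_range (γ : UContour) : IsClosed (range γ) :=
  γ.isClosedMap.isClosed_range

section Data

variable {c z : Fin P → ℂ} {lam : ℝ}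

theorem integrable_weight_mul_deriv (hA : IsAdmissible c z lam) {ε : ℝ} (hε : 0 < ε) {γ : UContour}
    {H : ℝ → ℂ} (hH : IsPhase c z lam γ H) : Integrable fun t => weight ε H t * deriv γ t := by
  have h1 := integrable_pullback hA hε hH
    (inv_pow_mem_testSpace (z := z) (q := z ⟨0, hA.size_pos⟩) (fun h => (h ⟨0, hA.size_pos⟩).1 rfl) 0)
  have h2 : (pullback ε γ H fun w => ((w - z ⟨0, hA.size_pos⟩) ^ 0)⁻¹) =
      fun t => weight ε H t * deriv γ t := by
    funext t; simp [pullback]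
  rwa [h2] at h1

/-- The Cauchy transform of the weight along a contour. -/
noncomputable def cauchy (ε : ℝ) (γ : UContour) (H : ℝ → ℂ) (ζ : ℂ) : ℂ :=
  ∫ t, weight ε H t * deriv γ t * (γ t - ζ)⁻¹

/-- A contour is a proper map, so its range is closed. -/
theorem exists_dist_le {γ : UContour} {q : ℂ} (hq : q ∉ range γ) : ∃ d > 0, ∀ t, d ≤ ‖γ t - q‖ := by
  obtain ⟨d, hd, hb⟩ := Metric.isOpen_iff.mp γ.isClosed_range.isOpen_compl q hq
  refine ⟨d, hd, fun t => not_lt.mp fun h => ?_⟩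
  exact hb (show γ t ∈ Metric.ball q d by rwa [Metric.mem_ball, dist_eq_norm]) ⟨t, rfl⟩

theorem aestronglyMeasurable_mul_comp (hA : IsAdmissible c z lam) {ε : ℝ} (hε : 0 < ε) {γ : UContour}
    {H : ℝ → ℂ} (hH : IsPhase c z lam γ H) {φ : ℝ → ℂ} (hφ : Continuous φ) :
    AEStronglyMeasurable (fun t => weight ε H t * deriv γ t * φ t) :=
  (integrable_weight_mul_deriv hA hε hH).aestronglyMeasurable.mul hφ.aestronglyMeasurable

theorem integrable_cauchy (hA : IsAdmissible c z lam) {ε : ℝ} (hε : 0 < ε) {γ : UContour}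
    {H : ℝ → ℂ} (hH : IsPhase c z lam γ H) {ζ : ℂ} (hζ : ζ ∉ range γ) :
    Integrable fun t => weight ε H t * deriv γ t * (γ t - ζ)⁻¹ := by
  obtain ⟨d, hd, hdt⟩ := exists_dist_le hζ
  refine (integrable_weight_mul_deriv hA hε hH).mul_bdd (c := d⁻¹) ?_ (Eventually.of_forall fun t => ?_)
  · refine Continuous.aestronglyMeasurable ?_
    exact (γ.continuous.sub continuous_const).inv₀ fun t => norm_pos_iff.mp (hd.trans_le (hdt t))
  · rw [norm_inv]
    exact inv_anti₀ hd (hdt t)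

theorem differentiableOn_cauchy (hA : IsAdmissible c z lam) {ε : ℝ} (hε : 0 < ε) {γ : UContour}
    {H : ℝ → ℂ} (hH : IsPhase c z lam γ H) :
    DifferentiableOn ℂ (cauchy ε γ H) (range γ)ᶜ := by
  intro q hq
  obtain ⟨d, hd, hdt⟩ := exists_dist_le hq
  have hfar : ∀ t, ∀ ζ ∈ Metric.ball q (d / 2), d / 2 ≤ ‖γ t - ζ‖ := fun t ζ hζ => by
    rw [Metric.mem_ball, dist_eq_norm] at hζ
    have := norm_sub_le_norm_sub_add_norm_sub (γ t) ζ q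
    linarith [hdt t]
  have hne : ∀ t, ∀ ζ ∈ Metric.ball q (d / 2), γ t - ζ ≠ 0 := fun t ζ hζ =>
    norm_pos_iff.mp ((half_pos hd).trans_le (hfar t ζ hζ))
  have hcont : ∀ ζ ∈ Metric.ball q (d / 2), Continuous fun t => (γ t - ζ)⁻¹ := fun ζ hζ =>
    (γ.continuous.sub continuous_const).inv₀ fun t => hne t ζ hζ
  have hself := Metric.mem_ball_self (x := q) (half_pos hd)
  refine (hasDerivAt_integral_of_dominated_loc_of_deriv_le (Metric.ball_mem_nhds q (half_pos hd))
    (F' := fun ζ t => weight ε H t * deriv γ t * ((γ t - ζ)⁻¹ * (γ t - ζ)⁻¹))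
    (bound := fun t => ‖weight ε H t * deriv γ t‖ * ((d / 2)⁻¹ * (d / 2)⁻¹))
    ?_ (integrable_cauchy hA hε hH hq) ?_ ?_ ?_ ?_).2.differentiableAt.differentiableWithinAt
  · filter_upwards [Metric.ball_mem_nhds q (half_pos hd)] with ζ hζ
    exact aestronglyMeasurable_mul_comp hA hε hH (hcont ζ hζ)
  · exact aestronglyMeasurable_mul_comp hA hε hH ((hcont q hself).mul (hcont q hself))
  · refine Eventually.of_forall fun t ζ hζ => ?_
    rw [norm_mul, norm_mul (γ t - ζ)⁻¹, norm_inv]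
    have := inv_anti₀ (half_pos hd) (hfar t ζ hζ)
    gcongr
  · exact (integrable_weight_mul_deriv hA hε hH).norm.mul_const _
  · refine Eventually.of_forall fun t ζ hζ => ?_
    refine ((((hasDerivAt_id ζ).const_sub (γ t)).fun_inv (hne t ζ hζ)).const_mul
      (weight ε H t * deriv γ t)).congr_deriv ?_
    simp only [id]
    field_simp

/-- The Taylor expansion of the Cauchy transform. -/
theorem hasSum_cauchy (hA : IsAdmissible c z lam) {ε : ℝ} (hε : 0 < ε) {γ : UContour}
    {H : ℝ → ℂ} (hH : IsPhase c z lam γ H) {q : ℂ} (hq : ¬ Regular z q) :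
    ∀ᶠ ζ in 𝓝 q, HasSum (fun k : ℕ => (ζ - q) ^ k *
      ∫ t, pullback ε γ H (fun w => ((w - q) ^ (k + 1))⁻¹) t) (cauchy ε γ H ζ) := by
  obtain ⟨d, hd, hdt⟩ := exists_dist_le (γ := γ) (q := q) fun ⟨t, ht⟩ => hq (ht ▸ hH.regular t)
  filter_upwards [Metric.ball_mem_nhds q hd] with ζ hζ
  rw [Metric.mem_ball, dist_eq_norm] at hζ
  have hr : ‖ζ - q‖ / d < 1 := (div_lt_one hd).mpr hζ
  have hne : ∀ t, γ t - q ≠ 0 := fun t => norm_pos_iff.mp (hd.trans_le (hdt t))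
  have hint : ∀ k : ℕ, Integrable fun t => (ζ - q) ^ k *
      pullback ε γ H (fun w => ((w - q) ^ (k + 1))⁻¹) t := fun k =>
    (integrable_pullback hA hε hH (inv_pow_mem_testSpace hq _)).const_mul _
  have hsum : Summable fun k : ℕ => ∫ t, ‖(ζ - q) ^ k *
      pullback ε γ H (fun w => ((w - q) ^ (k + 1))⁻¹) t‖ := by
    have hI := (integrable_weight_mul_deriv hA hε hH).norm
    refine Summable.of_nonneg_of_le (fun k => integral_nonneg fun t => norm_nonneg _) (fun k => ?_)
      ((summable_geometric_of_lt_one (by positivity) hr).mul_left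
        ((∫ t, ‖weight ε H t * deriv γ t‖) * d⁻¹))
    have : (∫ t, ‖weight ε H t * deriv γ t‖) * d⁻¹ * (‖ζ - q‖ / d) ^ k =
        ∫ t, ‖weight ε H t * deriv γ t‖ * (d⁻¹ * (‖ζ - q‖ / d) ^ k) := by
      rw [integral_mul_const, mul_assoc]
    rw [this]
    refine integral_mono (hint k).norm (hI.mul_const _) fun t => ?_
    simp only [pullback]
    have h1 : ‖(γ t - q)‖⁻¹ ^ (k + 1) ≤ d⁻¹ ^ (k + 1) := by
      gcongr
      exact hdt t
    calc ‖(ζ - q) ^ k * (weight ε H t * ((γ t - q) ^ (k + 1))⁻¹ * deriv γ t)‖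
        = ‖weight ε H t * deriv γ t‖ * (‖ζ - q‖ ^ k * ‖γ t - q‖⁻¹ ^ (k + 1)) := by
          simp only [norm_mul, norm_pow, norm_inv, inv_pow]; ring
      _ ≤ ‖weight ε H t * deriv γ t‖ * (‖ζ - q‖ ^ k * d⁻¹ ^ (k + 1)) := by gcongr
      _ = _ := by rw [div_pow, pow_succ, inv_pow]; ring
  have key := hasSum_integral_of_summable_integral_norm hint hsum
  simp only [integral_const_mul] at key
  suffices hc : cauchy ε γ H ζ = ∫ t, ∑' k : ℕ, (ζ - q) ^ k *
      pullback ε γ H (fun w => ((w - q) ^ (k + 1))⁻¹) t by rwa [hc]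
  refine integral_congr_ae (Eventually.of_forall fun t => ?_)
  have hlt : ‖(ζ - q) / (γ t - q)‖ < 1 := by
    rw [norm_div, div_lt_one (hd.trans_le (hdt t))]
    exact hζ.trans_le (hdt t)
  have h1 := (hasSum_geometric_of_norm_lt_one hlt).mul_left
    (weight ε H t * deriv γ t * (γ t - q)⁻¹)
  have h2 : γ t - ζ ≠ 0 := fun h => by
    have : γ t - q = ζ - q := by linear_combination h
    rw [this, div_self (this ▸ hne t), norm_one] at hlt
    exact lt_irrefl _ hlt
  have h3 : 1 - (ζ - q) / (γ t - q) = (γ t - ζ) / (γ t - q) := by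
    have := hne t
    field_simp
    ring
  have h4 : (γ t - ζ)⁻¹ = (γ t - q)⁻¹ * (1 - (ζ - q) / (γ t - q))⁻¹ := by
    rw [h3, inv_div]
    have := hne t
    field_simp
  simp only
  rw [h4, ← mul_assoc, ← h1.tsum_eq]
  refine tsum_congr fun k => ?_
  simp only [pullback]
  rw [div_pow, pow_succ (γ t - q), mul_inv]
  ring

/-- The Cauchy transform of a relation between contours vanishes on connected sets which contain a
pole and avoid the contours. -/
theorem sum_cauchy_eq_zero (hA : IsAdmissible c z lam) {ε : ℝ} (hε : 0 < ε) {W : Fin P → UContour}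
    {H : Fin P → ℝ → ℂ} (hH : ∀ m, IsPhase c z lam (W m) (H m)) {b : Fin P → ℂ}
    (hb : ∀ g ∈ testSpace z, ∑ m, b m * ∫ t, pullback ε (W m) (H m) g t = 0)
    {U : Set ℂ} (hU : IsPreconnected U) (hdisj : ∀ m, b m ≠ 0 → ∀ t, W m t ∉ U) {q ζ : ℂ}
    (hq : ¬ Regular z q) (hqU : q ∈ U) (hζ : ζ ∈ U) :
    ∑ m, b m * cauchy ε (W m) (H m) ζ = 0 := by
  have hana : AnalyticOnNhd ℂ (fun ζ => ∑ m, b m * cauchy ε (W m) (H m) ζ) U := fun w hw => by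
    have : ∀ m, AnalyticAt ℂ (fun ζ => b m * cauchy ε (W m) (H m) ζ) w := fun m => by
      by_cases h0 : b m = 0
      · simp only [h0, zero_mul]; exact analyticAt_const
      · exact analyticAt_const.mul ((differentiableOn_cauchy hA hε (hH m)).analyticOnNhd
          (W m).isClosed_range.isOpen_compl w fun ⟨t, ht⟩ => hdisj m h0 t (ht ▸ hw))
    exact Finset.analyticAt_fun_sum _ fun m _ => this m
  -- Near the pole q the transform is the sum of its Taylor series, each coefficient of which is the
  -- relation applied to a test function (w - q)^{-(k+1)}.
  refine hana.eqOn_zero_of_preconnected_of_eventuallyEq_zero hU hqU ?_ hζ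
  filter_upwards [eventually_all.mpr fun m => hasSum_cauchy hA hε (hH m) hq] with ξ hξ
  have h1 := hasSum_sum fun m (_ : m ∈ Finset.univ) => (hξ m).mul_left (b m)
  refine h1.unique ?_
  change HasSum _ 0
  convert hasSum_zero using 2 with k
  have := hb _ (inv_pow_mem_testSpace hq (k + 1))
  rw [← mul_zero ((ξ - q) ^ k), ← this, Finset.mul_sum]
  exact Finset.sum_congr rfl fun m _ => by ring

end Data

/-! ### The jump of the Cauchy transform. -/

theorem tendsto_neg_punctured : Tendsto (fun s : ℝ => -s) (𝓝[≠] 0) (𝓝[≠] 0) := by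
  refine tendsto_nhdsWithin_iff.mpr ⟨?_, ?_⟩
  · have : Tendsto (fun s : ℝ => -s) (𝓝 0) (𝓝 (-0)) := tendsto_id.neg
    rw [neg_zero] at this
    exact this.mono_left nhdsWithin_le_nhds
  · filter_upwards [self_mem_nhdsWithin] with s hs
    exact neg_ne_zero.mpr hs

section Data

variable {c z : Fin P → ℂ} {lam : ℝ}

/-- With a = θ(τ + e) and |e| ≤ |τ|/4, the real part of (τ + e)² + s² is still at least half of τ² +
s². This bounds the denominator of the jump kernel for a nearly straight contour. -/
theorem le_norm_sq_add_sq {θ a : ℂ} {τ s : ℝ} (h : ‖a - θ * τ‖ ≤ 1 / 4 * ‖θ‖ * |τ|) :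
    ‖θ‖ ^ 2 * ((τ ^ 2 + s ^ 2) / 2) ≤ ‖a ^ 2 + (s * θ) ^ 2‖ := by
  rcases eq_or_ne θ 0 with rfl | hθ
  · simp
  have hθ' := norm_pos_iff.mpr hθ
  obtain ⟨e, rfl⟩ : ∃ e, a = θ * (τ + e) := ⟨a / θ - τ, by field_simp; ring⟩
  have he : ‖e‖ ≤ |τ| / 4 := by
    rw [show θ * (τ + e) - θ * τ = θ * e by ring, norm_mul] at h
    have : ‖θ‖ * ‖e‖ ≤ ‖θ‖ * (|τ| / 4) := by linarith
    exact le_of_mul_le_mul_left this hθ'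
  have h1 : (θ * (τ + e)) ^ 2 + (s * θ) ^ 2 = θ ^ 2 * ((τ + e) ^ 2 + s ^ 2) := by ring
  rw [h1, norm_mul, norm_pow]
  refine mul_le_mul_of_nonneg_left ((?_ : _ ≤ _).trans (re_le_norm _)) (by positivity)
  have h2 := sq_le_sq.mpr (((abs_re_le_norm e).trans he).trans (le_abs_self _))
  have h3 := sq_le_sq.mpr (((abs_im_le_norm e).trans he).trans (le_abs_self _))
  have h4 : ((τ + e : ℂ) ^ 2 + (s : ℂ) ^ 2).re = (τ + e.re) ^ 2 - e.im ^ 2 + s ^ 2 := by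
    simp [pow_two]
  rw [h4]
  rw [div_pow, sq_abs] at h2 h3
  have h5 : |τ * e.re| ≤ τ ^ 2 / 4 := by
    rw [abs_mul, ← sq_abs τ]
    have := (abs_re_le_norm e).trans he
    nlinarith [abs_nonneg τ]
  nlinarith [(abs_le.mp h5).1, sq_nonneg s, sq_nonneg e.re]

/-- The jump of the Cauchy transform across the contour. -/
theorem tendsto_cauchy_sub (hA : IsAdmissible c z lam) {ε : ℝ} (hε : 0 < ε) {γ : UContour}
    {H : ℝ → ℂ} (hH : IsPhase c z lam γ H) {t₀ : ℝ} {θ : ℂ} (hθ : θ ≠ 0) (hd : HasDerivAt γ θ t₀)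
    (hc : ContinuousAt (deriv γ) t₀) (hinj : ∀ t, γ t = γ t₀ → t = t₀)
    (hoff : ∀ᶠ s : ℝ in 𝓝[≠] 0, γ t₀ + s * (I * θ) ∉ range γ) :
    Tendsto (fun s : ℝ => cauchy ε γ H (γ t₀ + s * (I * θ)) -
      cauchy ε γ H (γ t₀ + (-s : ℝ) * (I * θ))) (𝓝[>] 0)
      (𝓝 (2 * Real.pi * I * weight ε H t₀)) := by
  set w := γ t₀ with hw
  have hθ' := norm_pos_iff.mpr hθ
  obtain ⟨K, hK⟩ := γ.exists_norm_deriv_le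
  have hK0 : 0 ≤ K := (norm_nonneg _).trans (hK 0)
  have hψ := continuous_weight (ε := ε) hH.continuous
  -- The difference of the Cauchy kernels at w ± isθ is a Poisson-type kernel in s.
  set F : ℝ → ℝ → ℂ := fun s t => weight ε H t * deriv γ t *
    (2 * (s * (I * θ)) / ((γ t - w) ^ 2 + (s * θ) ^ 2)) with hF
  have hFm : ∀ s, Measurable (F s) := fun s =>
    (hψ.measurable.mul (measurable_deriv γ)).mul (measurable_const.div
      (((γ.continuous.sub continuous_const).pow 2).add continuous_const).measurable)
  have hdiff : ∀ᶠ s : ℝ in 𝓝[>] 0, Integrable (F s) ∧ cauchy ε γ H (w + s * (I * θ)) -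
      cauchy ε γ H (w + (-s : ℝ) * (I * θ)) = ∫ t, F s t := by
    have h1 : Tendsto (fun s : ℝ => s) (𝓝[>] 0) (𝓝[≠] 0) := nhdsWithin_mono 0 fun s hs => ne_of_gt hs
    have h2 : Tendsto (fun s : ℝ => -s) (𝓝[>] 0) (𝓝[≠] 0) := tendsto_neg_punctured.comp h1
    filter_upwards [h1.eventually hoff, h2.eventually hoff] with s hs hs'
    have i1 := integrable_cauchy hA hε hH hs
    have i2 := integrable_cauchy hA hε hH hs'
    have heq : F s = fun t => weight ε H t * deriv γ t * (γ t - (w + s * (I * θ)))⁻¹ -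
        weight ε H t * deriv γ t * (γ t - (w + (-s : ℝ) * (I * θ)))⁻¹ := by
      funext t
      have n1 : γ t - (w + s * (I * θ)) ≠ 0 := fun h => hs ⟨t, sub_eq_zero.mp h⟩
      have n2 : γ t - (w + (-s : ℝ) * (I * θ)) ≠ 0 := fun h => hs' ⟨t, sub_eq_zero.mp h⟩
      have n3 : (γ t - w) ^ 2 + (s * θ) ^ 2 =
          (γ t - (w + s * (I * θ))) * (γ t - (w + (-s : ℝ) * (I * θ))) := by
        push_cast
        linear_combination ((s * θ) ^ 2 : ℂ) * I_sq
      simp only [hF]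
      rw [n3, ← mul_sub]
      congr 1
      rw [inv_sub_inv n1 n2]
      push_cast
      ring
    refine ⟨heq ▸ i1.sub i2, ?_⟩
    rw [heq, integral_sub i1 i2]
    rfl
  obtain ⟨δ, hδ, hδ1, hδ2⟩ : ∃ δ > 0, (∀ τ : ℝ, |τ| ≤ δ → ‖γ (t₀ + τ) - w - θ * τ‖ ≤
      1 / 4 * ‖θ‖ * |τ|) ∧ ∀ τ : ℝ, |τ| ≤ δ → ‖weight ε H (t₀ + τ)‖ ≤ ‖weight ε H t₀‖ + 1 := by
    have h1 := (hasDerivAt_iff_isLittleO_nhds_zero.mp hd).bound (c := 1 / 4 * ‖θ‖) (by positivity)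
    have h2 : ∀ᶠ τ : ℝ in 𝓝 0, ‖weight ε H (t₀ + τ)‖ < ‖weight ε H t₀‖ + 1 := by
      have : ContinuousAt (fun τ => ‖weight ε H (t₀ + τ)‖) 0 := by fun_prop
      refine this.eventually_lt continuousAt_const ?_
      simp
    obtain ⟨δ, hδ, hb⟩ := Metric.eventually_nhds_iff.mp (h1.and h2)
    refine ⟨δ / 2, half_pos hδ, fun τ hτ => ?_, fun τ hτ => ?_⟩
    · have := (hb (y := τ) (by rw [Real.dist_0_eq_abs]; linarith)).1
      simpa [mul_comm θ] using this
    · exact (hb (y := τ) (by rw [Real.dist_0_eq_abs]; linarith)).2.le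
  set A : Set ℝ := {t | |t - t₀| ≤ δ} with hAd
  have hAm : MeasurableSet A := measurableSet_le (by fun_prop) (by fun_prop)
  -- Away from t₀ the contour keeps a distance d from w. Once s|θ| < d/2 the denominator is at least
  -- d²/2, and the numerator is of order s.
  have houter : Tendsto (fun s => ∫ t in Aᶜ, F s t) (𝓝[>] 0) (𝓝 0) := by
    obtain ⟨d, hd0, hdt⟩ : ∃ d > 0, ∀ t ∈ Aᶜ, d ≤ ‖γ t - w‖ := by
      have hcl : IsClosed (γ '' {t | δ ≤ |t - t₀|}) :=
        γ.isClosedMap _ (isClosed_le continuous_const (by fun_prop))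
      have hn : w ∈ (γ '' {t | δ ≤ |t - t₀|})ᶜ := by
        rintro ⟨t, ht, hte⟩
        rw [hinj t hte] at ht
        simp at ht
        linarith
      obtain ⟨d, hd0, hb⟩ := Metric.isOpen_iff.mp hcl.isOpen_compl w hn
      refine ⟨d, hd0, fun t ht => not_lt.mp fun h => ?_⟩
      refine hb (show γ t ∈ Metric.ball w d by rwa [Metric.mem_ball, dist_eq_norm]) ⟨t, ?_, rfl⟩
      exact (lt_of_not_ge (show ¬ |t - t₀| ≤ δ from ht)).le
    have hI := (integrable_weight_mul_deriv hA hε hH).norm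
    have hz : Tendsto (fun s : ℝ => ∫ t in Aᶜ, ‖weight ε H t * deriv γ t‖ *
        (2 * (s * ‖θ‖) / (d ^ 2 / 2))) (𝓝[>] 0) (𝓝 0) := by
      simp only [integral_mul_const]
      have : Continuous fun s : ℝ => (∫ t in Aᶜ, ‖weight ε H t * deriv γ t‖) *
        (2 * (s * ‖θ‖) / (d ^ 2 / 2)) := by fun_prop
      have := this.tendsto 0
      simp only [zero_mul, mul_zero, zero_div] at this
      exact this.mono_left nhdsWithin_le_nhds
    refine squeeze_zero_norm' ?_ hz
    have hsmall : ∀ᶠ s : ℝ in 𝓝[>] 0, s * ‖θ‖ < d / 2 := by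
      have : Continuous fun s : ℝ => s * ‖θ‖ := by fun_prop
      refine ((this.tendsto 0).mono_left nhdsWithin_le_nhds).eventually_lt_const ?_
      simpa using hd0
    filter_upwards [hsmall, self_mem_nhdsWithin] with s hs hs0
    have hs0 : 0 < s := hs0
    refine norm_integral_le_of_norm_le (hI.mul_const _).integrableOn
      ((ae_restrict_mem hAm.compl).mono fun t ht => ?_)
    simp only [hF]
    rw [norm_mul, norm_div]
    have h1 : d ^ 2 / 2 ≤ ‖(γ t - w) ^ 2 + (s * θ) ^ 2‖ := by
      have h2 := norm_sub_le_norm_add ((γ t - w) ^ 2) ((s * θ) ^ 2)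
      rw [norm_pow, norm_pow, norm_mul, norm_real, Real.norm_of_nonneg hs0.le] at h2
      have h3 := hdt t ht
      have h4 : 0 ≤ s * ‖θ‖ := by positivity
      nlinarith
    have h2 : ‖(2 * (s * (I * θ)) : ℂ)‖ = 2 * (s * ‖θ‖) := by
      simp [abs_of_pos hs0]
    rw [h2]
    gcongr
  have hinner : Tendsto (fun s => ∫ t in A, F s t) (𝓝[>] 0)
      (𝓝 (2 * Real.pi * I * weight ε H t₀)) := by
    -- The substitution t = t₀ + su turns the kernel into 2i/(1 + u²) in the limit, with integral
    -- 2πi, and a multiple of 1/(1 + u²) dominates.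
    have hsub : ∀ᶠ s : ℝ in 𝓝[>] 0, ∫ u : ℝ, (s : ℂ) * A.indicator (F s) (t₀ + s * u) =
        ∫ t in A, F s t := by
      filter_upwards [self_mem_nhdsWithin] with s hs
      have hs : 0 < s := hs
      rw [integral_const_mul, Measure.integral_comp_mul_left (fun τ => A.indicator (F s) (t₀ + τ)),
        integral_add_left_eq_self, integral_indicator hAm, abs_of_pos (inv_pos.mpr hs), real_smul,
        ← mul_assoc, ofReal_inv, mul_inv_cancel₀ (ofReal_ne_zero.mpr hs.ne'), one_mul]
    refine Tendsto.congr' hsub ?_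
    have hlim : ∫ u : ℝ, 2 * I * weight ε H t₀ * ((1 + u ^ 2)⁻¹ : ℝ) =
        2 * Real.pi * I * weight ε H t₀ := by
      rw [integral_const_mul, integral_complex_ofReal, integral_univ_inv_one_add_sq]
      ring
    rw [← hlim]
    refine tendsto_integral_filter_of_dominated_convergence
      (fun u => ((‖weight ε H t₀‖ + 1) * K * (4 / ‖θ‖)) * (1 + u ^ 2)⁻¹) ?_ ?_
      (integrable_inv_one_add_sq.const_mul _) ?_
    · refine Eventually.of_forall fun s => Measurable.aestronglyMeasurable ?_
      exact (((hFm s).indicator hAm).comp (by fun_prop)).const_mul _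
    · filter_upwards [self_mem_nhdsWithin] with s hs
      have hs : 0 < s := hs
      refine Eventually.of_forall fun u => ?_
      by_cases hu : t₀ + s * u ∈ A
      · rw [indicator_of_mem hu]
        have hu' : |s * u| ≤ δ := by simpa [hAd] using hu
        have h1 := le_norm_sq_add_sq (s := s) (hδ1 _ hu')
        have h2 := hδ2 _ hu'
        have h3 : ‖(2 * (s * (I * θ)) : ℂ)‖ = 2 * (s * ‖θ‖) := by simp [abs_of_pos hs]
        have h4 : 0 < ‖θ‖ ^ 2 * (((s * u) ^ 2 + s ^ 2) / 2) := by positivity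
        simp only [hF]
        rw [norm_mul, norm_mul, norm_mul, norm_div, h3, norm_real, Real.norm_of_nonneg hs.le]
        calc s * (‖weight ε H (t₀ + s * u)‖ * ‖deriv γ (t₀ + s * u)‖ *
              (2 * (s * ‖θ‖) / ‖(γ (t₀ + s * u) - w) ^ 2 + (s * θ) ^ 2‖))
            ≤ s * ((‖weight ε H t₀‖ + 1) * K *
              (2 * (s * ‖θ‖) / (‖θ‖ ^ 2 * (((s * u) ^ 2 + s ^ 2) / 2)))) := by
              gcongr
              exact hK _
          _ = _ := by
              have : 1 + u ^ 2 ≠ 0 := by positivity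
              field_simp
              ring
      · rw [indicator_of_notMem hu, mul_zero, norm_zero]
        positivity
    · refine Eventually.of_forall fun u => ?_
      have hcomp : HasDerivAt (fun s : ℝ => γ (t₀ + s * u)) (u * θ) 0 := by
        have h1 : HasDerivAt (fun s : ℝ => t₀ + s * u) u 0 := by
          simpa using ((hasDerivAt_id (0 : ℝ)).mul_const u).const_add t₀
        have h2 : HasDerivAt γ θ (t₀ + 0 * u) := by simpa using hd
        simpa [Function.comp_def] using h2.scomp (0 : ℝ) h1
      have hq : Tendsto (fun s : ℝ => (γ (t₀ + s * u) - w) / s) (𝓝[>] 0) (𝓝 (u * θ)) := by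
        have := hcomp.tendsto_slope_zero_right
        refine this.congr fun s => ?_
        simp [hw, div_eq_inv_mul]
      have hpt : Tendsto (fun s : ℝ => t₀ + s * u) (𝓝[>] 0) (𝓝 t₀) := by
        have : Continuous fun s : ℝ => t₀ + s * u := by fun_prop
        have := this.tendsto 0
        simp only [zero_mul, add_zero] at this
        exact this.mono_left nhdsWithin_le_nhds
      have hden : ((u * θ) ^ 2 + θ ^ 2 : ℂ) ≠ 0 := by
        rw [show ((u * θ) ^ 2 + θ ^ 2 : ℂ) = θ ^ 2 * ((1 + u ^ 2 : ℝ) : ℂ) by push_cast; ring]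
        exact mul_ne_zero (pow_ne_zero _ hθ) (ofReal_ne_zero.mpr (by positivity))
      have hmain : Tendsto (fun s : ℝ => weight ε H (t₀ + s * u) * deriv γ (t₀ + s * u) *
          (2 * (I * θ) / (((γ (t₀ + s * u) - w) / s) ^ 2 + θ ^ 2))) (𝓝[>] 0)
          (𝓝 (weight ε H t₀ * deriv γ t₀ * (2 * (I * θ) / ((u * θ) ^ 2 + θ ^ 2)))) :=
        ((hψ.continuousAt.tendsto.comp hpt).mul (hc.tendsto.comp hpt)).mul
          (tendsto_const_nhds.div ((hq.pow 2).add tendsto_const_nhds) hden)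
      have hval : weight ε H t₀ * deriv γ t₀ * (2 * (I * θ) / ((u * θ) ^ 2 + θ ^ 2)) =
          2 * I * weight ε H t₀ * ((1 + u ^ 2)⁻¹ : ℝ) := by
        rw [hd.deriv]
        have h1 : (1 + (u : ℂ) ^ 2) ≠ 0 := by
          have : ((1 + u ^ 2 : ℝ) : ℂ) ≠ 0 := ofReal_ne_zero.mpr (by positivity)
          simpa using this
        rw [show ((u * θ) ^ 2 + θ ^ 2 : ℂ) = θ ^ 2 * (1 + u ^ 2) by ring]
        push_cast
        field_simp
      rw [hval] at hmain
      refine hmain.congr' ?_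
      have hsm : ∀ᶠ s : ℝ in 𝓝[>] 0, |t₀ + s * u - t₀| < δ := by
        have : Continuous fun s : ℝ => |t₀ + s * u - t₀| := by fun_prop
        refine ((this.tendsto 0).mono_left nhdsWithin_le_nhds).eventually_lt_const ?_
        simpa using hδ
      filter_upwards [hsm, self_mem_nhdsWithin] with s hs hs0
      have hs0 : (s : ℂ) ≠ 0 := ofReal_ne_zero.mpr (ne_of_gt hs0)
      rw [indicator_of_mem (show t₀ + s * u ∈ A from hs.le)]
      simp only [hF]
      have : (γ (t₀ + s * u) - w) ^ 2 + (s * θ) ^ 2 =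
          s ^ 2 * (((γ (t₀ + s * u) - w) / s) ^ 2 + θ ^ 2) := by field_simp
      rw [this, mul_left_comm (s : ℂ) (weight ε H _ * _)]
      congr 1
      rw [← mul_div_assoc, show (s * (2 * (s * (I * θ))) : ℂ) = s ^ 2 * (2 * (I * θ)) by ring,
        mul_div_mul_left _ _ (pow_ne_zero 2 hs0)]
  have hsum := hinner.add houter
  rw [add_zero] at hsum
  refine hsum.congr' ?_
  filter_upwards [hdiff] with s hs
  rw [hs.2, integral_add_compl hAm hs.1]

/-! ### Crossings and the linear independence of contour functionals. -/

/-- `γ` has its highest level `v` at the parameter `t₀`, and both sides of `γ` near `γ t₀` can be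
joined to poles within the complement of `γ` and of lower sets. -/
structure IsCrossing (c z : Fin P → ℂ) (lam : ℝ) (γ : UContour) (v t₀ : ℝ) (θ : ℂ) : Prop where
  regular : ∀ t, Regular z (γ t)
  le : ∀ t, R c z lam (γ t) ≤ v
  im_pos : v ≠ 0 → ∀ t, 0 < (γ t).im
  value : R c z lam (γ t₀) = v
  ne_zero : θ ≠ 0
  hasDerivAt : HasDerivAt γ θ t₀
  continuousAt : ContinuousAt (deriv γ) t₀
  inj : ∀ t, γ t = γ t₀ → t = t₀
  sides : ∀ E : Set ℂ, IsClosed E → (∀ w ∈ E, w ∉ superlevel c z lam v) →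
    (v = 0 → ∀ w ∈ E, 0 < w.im) → γ t₀ ∉ E → ∀ᶠ s : ℝ in 𝓝[≠] 0, ∃ U : Set ℂ, IsPreconnected U ∧
      (∀ w ∈ U, w ∉ E ∧ w ∉ range γ) ∧ γ t₀ + s * (I * θ) ∈ U ∧ ∃ q ∈ U, ¬ Regular z q

theorem IsCrossing.notMem_superlevel {γ : UContour} {v t₀ : ℝ} {θ : ℂ}
    (hγ : IsCrossing c z lam γ v t₀ θ) {v' : ℝ} (hv : v ≤ v') (t : ℝ) :
    γ t ∉ superlevel c z lam v' := by
  rintro (⟨-, ⟨p, hp⟩ | h⟩ | ⟨h, him⟩)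
  · exact (hγ.regular t p).1 hp.symm
  · exact absurd (hγ.le t) (not_le.mpr (hv.trans_lt h))
  · exact absurd (hγ.im_pos (hv.trans_lt h).ne t) (not_lt.mpr him)

/-- Contours with crossings at different levels define independent functionals. -/
theorem eq_zero_of_sum_eq_zero (hA : IsAdmissible c z lam) {ε : ℝ} (hε : 0 < ε)
    {W : Fin P → UContour} {H : Fin P → ℝ → ℂ} (hH : ∀ m, IsPhase c z lam (W m) (H m))
    {v t₀ : Fin P → ℝ} {θ : Fin P → ℂ} (hW : ∀ m, IsCrossing c z lam (W m) (v m) (t₀ m) (θ m))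
    (hv : Function.Injective v) {b : Fin P → ℂ}
    (hb : ∀ g ∈ testSpace z, ∑ m, b m * ∫ t, pullback ε (W m) (H m) g t = 0) : b = 0 := by
  classical
  by_contra hne
  obtain ⟨m₁, hm₁⟩ := Function.ne_iff.mp hne
  -- The occurring contour of highest level: no other occurring contour enters its superlevel set or
  -- passes through its crossing point.
  obtain ⟨m, hm, hmax⟩ := Finset.exists_max_image (Finset.univ.filter fun m => b m ≠ 0) v
    ⟨m₁, by simpa using hm₁⟩
  simp only [Finset.mem_filter, Finset.mem_univ, true_and] at hm hmax
  have hlt : ∀ n, b n ≠ 0 → n ≠ m → v n < v m := fun n hn hnm =>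
    lt_of_le_of_ne (hmax n hn) fun h => hnm (hv h)
  set E : Set ℂ := ⋃ n : {n // b n ≠ 0 ∧ n ≠ m}, range (W n) with hE
  have hEc : IsClosed E := isClosed_iUnion_of_finite fun n => (W n).isClosed_range
  have hEmem : ∀ w, w ∈ E ↔ ∃ n, (b n ≠ 0 ∧ n ≠ m) ∧ ∃ t, W n t = w := fun w => by
    simp [hE, and_assoc]
  have hw : W m (t₀ m) ∉ E := fun h => by
    obtain ⟨n, hn, t, ht⟩ := (hEmem _).mp h
    have h1 := (hW n).le t
    rw [ht, (hW m).value] at h1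
    exact absurd (hlt n hn.1 hn.2) (not_lt.mpr h1)
  have hsides := (hW m).sides E hEc
    (fun w hw => by
      obtain ⟨n, hn, t, rfl⟩ := (hEmem _).mp hw
      exact (hW n).notMem_superlevel (hmax n hn.1) t)
    (fun h0 w hw => by
      obtain ⟨n, hn, t, rfl⟩ := (hEmem _).mp hw
      exact (hW n).im_pos (h0 ▸ hlt n hn.1 hn.2).ne t) hw
  have hzero : ∀ᶠ s : ℝ in 𝓝[≠] 0,
      ∑ n, b n * cauchy ε (W n) (H n) (W m (t₀ m) + s * (I * θ m)) = 0 := by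
    filter_upwards [hsides] with s ⟨U, hU, hUE, hζ, q, hqU, hq⟩
    refine sum_cauchy_eq_zero hA hε hH hb hU (fun n hn t htU => ?_) hq hqU hζ
    by_cases hnm : n = m
    · exact (hUE _ htU).2 ⟨t, by rw [hnm]⟩
    · exact (hUE _ htU).1 ((hEmem _).mpr ⟨n, ⟨hn, hnm⟩, t, rfl⟩)
  have hpos : Tendsto (fun s : ℝ => s) (𝓝[>] 0) (𝓝[≠] 0) := nhdsWithin_mono 0 fun s hs => ne_of_gt hs
  have hjump := tendsto_cauchy_sub hA hε (hH m) (hW m).ne_zero (hW m).hasDerivAt (hW m).continuousAt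
    (hW m).inj (hsides.mono fun s ⟨U, _, hUE, hζ, _⟩ => (hUE _ hζ).2)
  -- Transforms of the other occurring contours are continuous at the crossing point, so only `W m`
  -- contributes to the jump.
  have hother : ∀ n ∈ Finset.univ.erase m, Tendsto (fun s : ℝ =>
      b n * (cauchy ε (W n) (H n) (W m (t₀ m) + s * (I * θ m)) -
        cauchy ε (W n) (H n) (W m (t₀ m) + (-s : ℝ) * (I * θ m)))) (𝓝[>] 0) (𝓝 0) := fun n hn => by
    by_cases h0 : b n = 0
    · simp only [h0, zero_mul]; exact tendsto_const_nhds
    · have hn' : W m (t₀ m) ∈ (range (W n))ᶜ := fun ⟨t, ht⟩ =>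
        hw ((hEmem _).mpr ⟨n, ⟨h0, Finset.ne_of_mem_erase hn⟩, t, ht⟩)
      have hcont : ContinuousAt (cauchy ε (W n) (H n)) (W m (t₀ m)) :=
        ((differentiableOn_cauchy hA hε (hH n)).differentiableAt
          ((W n).isClosed_range.isOpen_compl.mem_nhds hn')).continuousAt
      have hlin : ∀ e : ℝ, ContinuousAt (fun s : ℝ => cauchy ε (W n) (H n)
          (W m (t₀ m) + (e * s : ℝ) * (I * θ m))) 0 := fun e => by
        have hf : Continuous fun s : ℝ => W m (t₀ m) + (e * s : ℝ) * (I * θ m) := by fun_prop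
        have hc : ContinuousAt (cauchy ε (W n) (H n)) (W m (t₀ m) + (e * 0 : ℝ) * (I * θ m)) := by
          simpa using hcont
        exact ContinuousAt.comp (f := fun s : ℝ => W m (t₀ m) + (e * s : ℝ) * (I * θ m))
          (g := cauchy ε (W n) (H n)) hc hf.continuousAt
      have h1 := (((hlin 1).sub (hlin (-1))).const_mul (b n)).tendsto
      simp only [Pi.sub_apply, one_mul, neg_one_mul, neg_zero, sub_self, mul_zero] at h1
      exact h1.mono_left nhdsWithin_le_nhds
  have hsum := tendsto_finsetSum _ hother
  rw [Finset.sum_const_zero] at hsum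
  have hlim := (hjump.const_mul (b m)).add hsum
  have hlim0 : Tendsto (fun _ : ℝ => (0 : ℂ)) (𝓝[>] 0)
      (𝓝 (b m * (2 * Real.pi * I * weight ε (H m) (t₀ m)) + 0)) := by
    refine hlim.congr' ?_
    filter_upwards [hpos.eventually hzero,
      (tendsto_neg_punctured.comp hpos).eventually hzero] with s h1 h2
    rw [Finset.add_sum_erase _ (fun n => b n * (cauchy ε (W n) (H n) (W m (t₀ m) + s * (I * θ m)) -
        cauchy ε (W n) (H n) (W m (t₀ m) + (-s : ℝ) * (I * θ m)))) (Finset.mem_univ m)]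
    simp only [mul_sub, Finset.sum_sub_distrib]
    simp only [Function.comp_apply] at h2
    rw [h1, h2, sub_self]
  have hfin := tendsto_nhds_unique hlim0 tendsto_const_nhds
  rw [add_zero] at hfin
  refine mul_ne_zero hm (mul_ne_zero ?_ (exp_ne_zero _)) hfin
  simp [Real.pi_ne_zero]

theorem exists_notRegular_mem_component (hA : IsAdmissible c z lam) {v : ℝ} {ζ : ℂ}
    (hζ : ζ ∈ superlevel c z lam v) :
    ∃ q ∈ connectedComponentIn (superlevel c z lam v) ζ, ¬ Regular z q := by
  obtain ⟨p, hp | hp⟩ := exists_pole_mem_component hA hζ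
  · exact ⟨_, hp, fun h => (h p).1 rfl⟩
  · exact ⟨_, hp, fun h => (h p).2 rfl⟩

theorem continuousAt_deriv_of_eventuallyEq {γ φ : ℝ → ℂ} {t : ℝ} (h : γ =ᶠ[𝓝 t] φ)
    (hφ : ContinuousAt (deriv φ) t) : ContinuousAt (deriv γ) t :=
  hφ.congr h.deriv.symm

/-! ### Construction of crossings at upper saddles and on the real line. -/

/-- Contours over a single critical point in the upper half-plane. -/
theorem exists_upper_crossing (hA : IsAdmissible c z lam) {w : ℂ} (hw : IsCritical c z lam w)
    (him : 0 < w.im) (hd : deriv (u0 c z) w ≠ 0) : ∃ (γ : UContour) (θ : ℂ),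
      IsCrossing c z lam γ (R c z lam w) 0 θ ∧ (∀ t, 0 < (γ t).im) ∧ PassesOver c z lam γ {w} := by
  obtain ⟨γ, θ, δ, hθ, hδ, hline, hsub, hup⟩ := exists_saddle_contour hA hw him hd
  have h0 : γ 0 = w := by simpa using hline 0 (by simpa using hδ.le)
  have hz : ∀ t, γ t = w → t = 0 := fun t ht => by
    by_contra h
    have := (hsub t h).2.2.2
    rw [ht] at this
    exact lt_irrefl _ this
  have hev : (γ : ℝ → ℂ) =ᶠ[𝓝 0] fun t : ℝ => w + t * θ := by
    filter_upwards [Metric.ball_mem_nhds (0 : ℝ) hδ] with t ht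
    rw [Metric.mem_ball, Real.dist_0_eq_abs] at ht
    exact hline t ht.le
  have hdl : ∀ t, HasDerivAt (fun t : ℝ => w + t * θ) θ t := fun t => by
    simpa using ((hasDerivAt_id t).ofReal_comp.mul_const θ).const_add w
  have hder : HasDerivAt γ θ 0 := (hdl 0).congr_of_eventuallyEq hev
  have hpos : ∀ t, 0 < (γ t).im := fun t => by
    by_cases h : t = 0
    · rw [h, h0]; exact him
    · exact (hsub t h).1
  have hreg : ∀ t, Regular z (γ t) := fun t => by
    by_cases h : t = 0
    · rw [h, h0]; exact hw.1
    · exact (hsub t h).2.1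
  have hle : ∀ t, R c z lam (γ t) ≤ R c z lam w := fun t => by
    by_cases h : t = 0
    · rw [h, h0]
    · exact (hsub t h).2.2.2.le
  refine ⟨γ, θ, ⟨hreg, hle, fun _ => hpos, by rw [h0], hθ, hder, ?_, fun t ht => hz t (ht.trans h0),
    fun E _ hE _ _ => ?_⟩, hpos, singleton_nonempty _, fun ζ => ⟨?_, ?_⟩, ?_, fun t ht => ?_, ?_⟩
  · exact continuousAt_deriv_of_eventuallyEq hev (by
      rw [funext fun t => (hdl t).deriv]; exact continuousAt_const)
  -- Both ascent directions enter the superlevel set; its component there contains a pole and misses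
  -- the contour, on which R ≤ R(w).
  · have hcont : Continuous fun s : ℝ => (w + s * (I * θ)).im := by fun_prop
    have him' : ∀ᶠ s : ℝ in 𝓝[≠] 0, 0 < (w + s * (I * θ)).im :=
      (hcont.continuousAt.eventually_mem (isOpen_Ioi.mem_nhds (by simpa using him))).filter_mono
        nhdsWithin_le_nhds
    filter_upwards [hup, him'] with s h1 h2
    rw [h0]
    have hmem : w + s * (I * θ) ∈ superlevel c z lam (R c z lam w) := Or.inl ⟨h2, Or.inr h1⟩
    refine ⟨_, isPreconnected_connectedComponentIn, fun ζ hζ => ?_, mem_connectedComponentIn hmem,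
      exists_notRegular_mem_component hA hmem⟩
    have hζ' := connectedComponentIn_subset _ _ hζ
    refine ⟨fun h => hE ζ h hζ', ?_⟩
    rintro ⟨t, rfl⟩
    rcases hζ' with ⟨-, ⟨p, hp⟩ | h⟩ | ⟨-, h⟩
    · exact (hreg t p).1 hp.symm
    · exact absurd (hle t) (not_le.mpr h)
    · exact absurd (hpos t) (not_lt.mpr h)
  · rintro rfl
    exact ⟨hw, 0, h0⟩
  · rintro ⟨hc, t, rfl⟩
    by_cases h : t = 0
    · rw [h]; exact h0
    · exact absurd hc (hsub t h).2.2.1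
  · rintro _ rfl
    exact ⟨0, h0, hz⟩
  · rw [hz t ht]
    exact ⟨θ, hθ, hder⟩
  · rintro t ht _ rfl
    exact (hsub t fun h => ht (by rw [h]; exact h0)).2.2.2

/-- Above a degenerate maximum on the real line, `R` is positive. -/
theorem eventually_R_pos_of_double (hA : IsAdmissible c z lam) {x₀ : ℝ}
    (h0 : lam + u0Real c z x₀ = 0) (hneg : ∀ x, x ≠ x₀ → lam + u0Real c z x < 0)
    (h1 : deriv (u0Real c z) x₀ = 0) (h2 : deriv (deriv (u0Real c z)) x₀ ≠ 0) :
    ∃ r > 0, ∀ y ∈ Ioo (0 : ℝ) r, 0 < R c z lam (x₀ + y * I) := by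
  -- A positive second derivative would give a local minimum, while x₀ is a strict maximum.
  have h2neg : deriv (deriv (u0Real c z)) x₀ < 0 := by
    refine lt_of_le_of_ne (not_lt.mp fun hpos => ?_) h2
    have hmin := isLocalMin_of_deriv_deriv_pos hpos h1 hA.continuous_u0Real.continuousAt
    have hmin' := hmin.filter_mono (nhdsWithin_le_nhds (s := {x₀}ᶜ))
    obtain ⟨x, hx, hne⟩ := (hmin'.and self_mem_nhdsWithin).exists
    linarith [hneg x hne]
  obtain ⟨ρ, hρ0, hρ⟩ := exists_strip_width hA
  set β : ℝ → ℂ := fun y => (x₀ : ℂ) + y * I with hβ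
  have hβ0 : β 0 = x₀ := by simp [hβ]
  have hβd : ∀ y, HasDerivAt β I y := fun y => by
    simpa [hβ] using ((hasDerivAt_id y).ofReal_comp.mul_const I).const_add (x₀ : ℂ)
  have hreg : ∀ y, |y| ≤ ρ → Regular z (β y) := fun y hy =>
    regular_of_strip hρ0 hρ (by simpa [hβ] using hy)
  have hG : ∀ y, |y| ≤ ρ → HasDerivAt (fun y => lam + (u0 c z (β y)).re)
      (deriv (u0 c z) (β y) * I).re y := fun y hy => by
    have := ((differentiableAt_u0 (c := c) (hreg y hy)).hasDerivAt.comp y (hβd y))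
    exact (reCLM.hasFDerivAt.comp_hasDerivAt y this).const_add lam
  -- Along the vertical line the second derivative of lam + Re u₀ at 0 is -u₀'' > 0 and the first
  -- vanishes. So lam + Re u₀, which is the derivative of `R`, increases from 0, and then `R` does
  -- too.
  have hG' : HasDerivAt (fun y => (deriv (u0 c z) (β y) * I).re)
      (-deriv (deriv (u0Real c z)) x₀) 0 := by
    have ha := (analyticAt_u0 (c := c) (hreg 0 (by simpa using hρ0.le))).deriv.differentiableAt
    have := ((ha.hasDerivAt.comp 0 (hβd 0)).mul_const I)
    refine (reCLM.hasFDerivAt.comp_hasDerivAt (0 : ℝ) this).congr_deriv ?_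
    rw [hβ0, hA.deriv_deriv_u0_ofReal, mul_assoc, I_mul_I]
    simp
  have hsign := eventually_nhdsWithin_sign_eq_of_deriv_pos (f := fun y => (deriv (u0 c z) (β y) * I).re)
    (x₀ := 0) (by rw [hG'.deriv]; linarith) (by
      simp only [hβ0, hA.deriv_u0_ofReal, h1]; simp)
  obtain ⟨r, hr, hball⟩ := Metric.eventually_nhds_iff.mp hsign
  set r' := min r ρ with hr'
  have hr'0 : 0 < r' := lt_min hr hρ0
  have hin : ∀ y ∈ Ico (0 : ℝ) r', |y| ≤ ρ := fun y hy => by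
    rw [abs_of_nonneg hy.1]; exact (hy.2.le).trans (min_le_right _ _)
  have hmono1 : StrictMonoOn (fun y => lam + (u0 c z (β y)).re) (Ico 0 r') := by
    refine strictMonoOn_of_deriv_pos (convex_Ico 0 r') (fun y hy =>
      (hG y (hin y hy)).continuousAt.continuousWithinAt) fun y hy => ?_
    rw [interior_Ico] at hy
    rw [(hG y (hin y ⟨hy.1.le, hy.2⟩)).deriv]
    have := hball (y := y) (by
      rw [Real.dist_0_eq_abs, abs_of_pos hy.1]; exact hy.2.trans_le (min_le_left _ _))
    rw [sub_zero, sign_pos hy.1] at this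
    exact sign_eq_one_iff.mp this
  have hmono2 : StrictMonoOn (fun y : ℝ => R c z lam (β y)) (Ico 0 r') := by
    refine strictMonoOn_of_deriv_pos (convex_Ico 0 r') (fun y hy =>
      (hasDerivAt_R_vertical hA (hreg y (hin y hy))).continuousAt.continuousWithinAt) fun y hy => ?_
    rw [interior_Ico] at hy
    rw [(hasDerivAt_R_vertical hA (hreg y (hin y ⟨hy.1.le, hy.2⟩))).deriv]
    have := hmono1 ⟨le_rfl, hr'0⟩ ⟨hy.1.le, hy.2⟩ hy.1
    simp only [hβ0, u0_ofReal, ofReal_re, h0] at this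
    exact this
  refine ⟨r', hr'0, fun y hy => ?_⟩
  have := hmono2 ⟨le_rfl, hr'0⟩ ⟨hy.1.le, hy.2⟩ hy.1
  simp only [hβ0, R_ofReal hA] at this
  exact this

/-- If there are real critical points, then some real critical point is a limit of points where `R`
is positive. -/
theorem RealSigns.exists_upper_point (hA : IsAdmissible c z lam) (hs : RealSigns c z lam)
    (hex : ∃ x : ℝ, lam + u0Real c z x = 0) : ∃ x₀ : ℝ, lam + u0Real c z x₀ = 0 ∧ ∀ r > 0,
      ∃ x y : ℝ, |x - x₀| < r ∧ 0 < y ∧ y < r ∧ 0 ≤ lam + u0Real c z x ∧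
        0 < R c z lam (x + y * I) := by
  rcases hs with h | ⟨x₀, h0, h, h1, h2⟩ | ⟨x₁, x₂, hlt, h1, -, -, -, hm, -, -⟩
  · obtain ⟨x, hx⟩ := hex
    exact absurd hx (h x).ne
  · obtain ⟨r₀, hr₀, hpos⟩ := eventually_R_pos_of_double hA h0 h h1 h2
    refine ⟨x₀, h0, fun r hr => ⟨x₀, min r r₀ / 2, by simpa using hr, ?_, ?_, h0.ge, ?_⟩⟩
    · have := lt_min hr hr₀; positivity
    · linarith [min_le_left r r₀, lt_min hr hr₀]
    · have := lt_min hr hr₀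
      have h3 := min_le_right r r₀
      exact hpos _ ⟨by positivity, by linarith⟩
  · obtain ⟨ρ, hρ0, hρ⟩ := exists_strip_width hA
    obtain ⟨C, hC0, hC⟩ := exists_lipschitz_strip (c := c) hρ0 hρ
    refine ⟨x₁, h1, fun r hr => ?_⟩
    set x := x₁ + min (r / 2) ((x₂ - x₁) / 2) with hx
    have hmin : 0 < min (r / 2) ((x₂ - x₁) / 2) := lt_min (by linarith) (by linarith)
    have hd := hm x (by linarith) (by linarith [min_le_right (r / 2) ((x₂ - x₁) / 2)])
    set d := lam + u0Real c z x with hdd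
    -- The last bound makes the error Cy² at most half of the main term yd.
    set y := min (min ρ (r / 2)) (d / (2 * C)) with hy
    have hy0 : 0 < y := lt_min (lt_min hρ0 (by linarith)) (by positivity)
    have hyρ : y ≤ ρ := (min_le_left _ _).trans (min_le_left _ _)
    have hyr : y ≤ r / 2 := (min_le_left _ _).trans (min_le_right _ _)
    have hyd : C * y ≤ d / 2 := by
      have : y ≤ d / (2 * C) := min_le_right _ _
      rw [le_div_iff₀ (by positivity)] at this
      linarith
    refine ⟨x, y, ?_, hy0, by linarith, hd.le, ?_⟩
    · rw [hx, add_sub_cancel_left, abs_of_pos hmin]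
      linarith [min_le_left (r / 2) ((x₂ - x₁) / 2)]
    · have := (abs_le.mp (abs_R_sub_le hA hρ0 hρ hC hC0 x (y := y)
        (by rwa [abs_of_pos hy0]))).1
      rw [← hdd] at this
      nlinarith

/-- A contour close to the real line over all real critical points. -/
theorem exists_real_crossing (hA : IsAdmissible c z lam) (hs : RealSigns c z lam)
    (hex : ∃ x : ℝ, lam + u0Real c z x = 0) : ∃ (γ : UContour) (t₀ : ℝ) (θ : ℂ),
      IsCrossing c z lam γ 0 t₀ θ ∧ (∀ t p, -(z p).im < (γ t).im) ∧
        PassesOver c z lam γ {w | IsCritical c z lam w ∧ w.im = 0} := by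
  obtain ⟨γ, μ, X, hμ, hX, hgraph, htail, hsmall, hneg⟩ := exists_real_contour hA
  obtain ⟨x₀, hx₀, hup⟩ := hs.exists_upper_point hA hex
  set φ : ℝ → ℝ := fun x => lam + u0Real c z x with hφ
  have hφc : Continuous φ := continuous_const.add hA.continuous_u0Real
  have hφd : ∀ x, HasDerivAt φ (deriv (u0Real c z) x) x := fun x =>
    ((hA.hasDerivAt_u0Real x).differentiableAt.hasDerivAt).const_add lam
  have hin : ∀ t, φ t = 0 → |t| < X := fun t ht => by
    by_contra h
    exact (htail t (not_lt.mp h)).2.ne ht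
  have hfix : ∀ t, φ t = 0 → γ t = t := fun t ht => by
    rw [hgraph t (hin t ht).le, show lam + u0Real c z t = 0 from ht]; simp
  have hcrit : ∀ t, φ t ≠ 0 → ¬ IsCritical c z lam (γ t) ∧ R c z lam (γ t) < 0 := fun t ht => by
    rcases le_total |t| X with h | h
    · exact hneg t ht h
    · exact (htail t h).1.2.2
  have him : ∀ t, |t| ≤ X → (γ t).re = t ∧ (γ t).im = -(μ * φ t) := fun t ht => by
    rw [hgraph t ht]
    constructor <;> simp [hφ]
  have hbd : ∀ t p, |μ * φ t| < (z p).im := fun t p => by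
    rw [abs_mul, abs_of_pos hμ]; exact hsmall t p
  have hreg : ∀ t, Regular z (γ t) := fun t => by
    rcases le_total |t| X with h | h
    · intro p
      have h1 := abs_lt.mp (hbd t p)
      have h2 := (him t h).2
      refine ⟨fun h3 => ?_, fun h3 => ?_⟩
      · rw [h3] at h2; linarith
      · rw [h3, conj_im] at h2; linarith
    · exact (htail t h).1.2.1
  have hlow : ∀ t p, -(z p).im < (γ t).im := fun t p => by
    rcases le_total |t| X with h | h
    · rw [(him t h).2]; linarith [(abs_lt.mp (hbd t p)).2]
    · have := hA.im_pos p
      linarith [(htail t h).1.1]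
  have hle : ∀ t, R c z lam (γ t) ≤ 0 := fun t => by
    by_cases h : φ t = 0
    · rw [hfix t h, R_ofReal hA]
    · exact (hcrit t h).2.le
  have hcφ : ∀ t, IsCritical c z lam (γ t) → φ t = 0 := fun t h => by
    by_contra h'
    exact (hcrit t h').1 h
  have hmemS : ∀ w, w ∈ {w | IsCritical c z lam w ∧ w.im = 0} → φ w.re = 0 ∧ w = w.re :=
    fun w hw => by
      have h1 : w = w.re := by apply Complex.ext <;> simp [hw.2]
      have h2 := hw.1
      rw [h1, hA.isCritical_ofReal_iff] at h2
      exact ⟨h2, h1⟩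
  have hev : ∀ t, φ t = 0 → (γ : ℝ → ℂ) =ᶠ[𝓝 t] fun t => t + (-(μ * φ t) : ℝ) * I := fun t ht => by
    have : ∀ᶠ s in 𝓝 t, |s| < X := continuous_abs.continuousAt.eventually_lt continuousAt_const
      (hin t ht)
    exact this.mono fun s hs => hgraph s hs.le
  set θ : ℝ → ℂ := fun t => 1 + (-(μ * deriv (u0Real c z) t) : ℝ) * I with hθ
  have hgd : ∀ t, HasDerivAt (fun t : ℝ => (t : ℂ) + (-(μ * φ t) : ℝ) * I) (θ t) t := fun t =>
    ((hasDerivAt_id t).ofReal_comp).add ((((hφd t).const_mul μ).neg.ofReal_comp).mul_const I)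
  have hder : ∀ t, φ t = 0 → HasDerivAt γ (θ t) t := fun t ht =>
    (hgd t).congr_of_eventuallyEq (hev t ht)
  have hθ0 : ∀ t, θ t ≠ 0 := fun t h => by
    have := congrArg Complex.re h
    simp [hθ] at this
  have hφx₀ : φ x₀ = 0 := hx₀
  have hγx₀ : γ x₀ = x₀ := hfix x₀ hx₀
  refine ⟨γ, x₀, θ x₀, ⟨hreg, hle, fun h => absurd rfl h, by rw [hγx₀, R_ofReal hA], hθ0 _,
    hder _ hx₀, ?_, fun t ht => ?_, fun E hEc hE hEpos hxE => ?_⟩, hlow,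
    ⟨x₀, (hA.isCritical_ofReal_iff x₀).mpr hx₀, ofReal_im _⟩, fun w => ⟨fun hw => ?_, ?_⟩,
    fun w hw => ?_, fun t ht => ?_, fun t ht w hw => ?_⟩
  · refine continuousAt_deriv_of_eventuallyEq (hev _ hx₀) ?_
    rw [funext fun t => (hgd t).deriv]
    have h1 : ContinuousAt (deriv (u0Real c z)) x₀ := by
      have h2 := (analyticAt_u0 (c := c) (hA.regular_real x₀)).deriv.continuousAt
      have h3 : ContinuousAt (fun x : ℝ => (deriv (u0 c z) x).re) x₀ :=
        continuous_re.continuousAt.comp (h2.comp (f := fun x : ℝ => (x : ℂ))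
          continuous_ofReal.continuousAt)
      refine h3.congr (Eventually.of_forall fun x => ?_)
      simp only [hA.deriv_u0_ofReal, ofReal_re]
    simp only [hθ]
    exact continuousAt_const.add ((continuous_ofReal.continuousAt.comp
      (continuousAt_const.mul h1).neg).mul continuousAt_const)
  · have h1 : φ t = 0 := hcφ t (by rw [ht, hγx₀]; exact (hA.isCritical_ofReal_iff x₀).mpr hx₀)
    have h2 := (hfix t h1).symm.trans (ht.trans hγx₀)
    exact_mod_cast h2
  · rw [hγx₀] at hxE ⊢
    set d := deriv (u0Real c z) x₀ with hd
    have hζ : ∀ s : ℝ, (x₀ + s * (I * θ x₀) : ℂ) = (x₀ + s * (μ * d) : ℝ) + s * I := fun s => by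
      simp only [hθ]
      push_cast
      linear_combination (-(s * (μ * d)) : ℂ) * I_mul_I
    -- Coordinates straightening the contour: the second one is the height above the graph.
    set g : ℝ × ℝ → ℂ := fun q => q.1 + (-(μ * φ q.1) + q.2 : ℝ) * I with hg
    have hgc : Continuous g := by fun_prop
    have hg0 : g (x₀, 0) = x₀ := by simp [hg, hφx₀]
    have hgre : ∀ q, (g q).re = q.1 ∧ (g q).im = -(μ * φ q.1) + q.2 := fun q => by
      constructor <;> simp [hg]
    -- The height above the graph of the point x₀ + isθ. Its derivative 1 + (μd)² at 0 is positive,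
    -- so the sign of s tells the side.
    set ψ : ℝ → ℝ := fun s => s + μ * φ (x₀ + s * (μ * d)) with hψ
    have hgψ : ∀ s : ℝ, g (x₀ + s * (μ * d), ψ s) = x₀ + s * (I * θ x₀) := fun s => by
      rw [hζ]
      simp only [hg, hψ]
      congr 2
      push_cast
      ring
    have hψ0 : ψ 0 = 0 := by simp [hψ, hφx₀]
    have hψc : Continuous ψ := by fun_prop
    have hψd : HasDerivAt ψ (1 + μ * (d * (μ * d))) 0 := by
      have h1 : HasDerivAt (fun s : ℝ => x₀ + s * (μ * d)) (μ * d) 0 := by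
        simpa using ((hasDerivAt_id (0 : ℝ)).mul_const (μ * d)).const_add x₀
      have h2 : HasDerivAt φ d (x₀ + 0 * (μ * d)) := by simpa using hφd x₀
      have h3 : HasDerivAt (fun s => φ (x₀ + s * (μ * d))) (d * (μ * d)) 0 :=
        HasDerivAt.comp (h₂ := φ) (h := fun s : ℝ => x₀ + s * (μ * d)) (0 : ℝ) h2 h1
      exact (hasDerivAt_id (0 : ℝ)).add (h3.const_mul μ)
    have hsign := eventually_nhdsWithin_sign_eq_of_deriv_pos (f := ψ) (x₀ := 0)
      (by rw [hψd.deriv]; nlinarith [mul_self_nonneg (μ * d)]) hψ0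
    have hoffr : ∀ q : ℝ × ℝ, g q ∉ γ '' {t | X ≤ |t|} → q.2 ≠ 0 → g q ∉ range γ := by
      rintro q hq h0 ⟨t, ht⟩
      rcases le_total |t| X with h | h
      · have h1 := him t h
        rw [ht, (hgre q).1, (hgre q).2] at h1
        rw [h1.1] at h1
        exact h0 (by linarith [h1.2])
      · exact hq ⟨t, h, ht⟩
    obtain ⟨r, hr, hball⟩ : ∃ r > 0, ∀ q : ℝ × ℝ, |q.1 - x₀| < r → |q.2| < r →
        g q ∉ E ∧ g q ∉ γ '' {t | X ≤ |t|} := by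
      have hcl : IsClosed (γ '' {t | X ≤ |t|}) :=
        γ.isClosedMap _ (isClosed_le continuous_const continuous_abs)
      have hx : g (x₀, 0) ∈ (E ∪ γ '' {t | X ≤ |t|})ᶜ := by
        rw [hg0]
        rintro (h | ⟨t, ht, h⟩)
        · exact hxE h
        · have := (htail t ht).1.1
          rw [h] at this
          simp at this
      obtain ⟨r, hr, hb⟩ := Metric.mem_nhds_iff.mp
        (hgc.continuousAt.preimage_mem_nhds ((hEc.union hcl).isOpen_compl.mem_nhds hx))
      refine ⟨r, hr, fun q h1 h2 => ?_⟩
      have h3 := hb (show q ∈ Metric.ball (x₀, (0 : ℝ)) r by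
        rw [Metric.mem_ball, Prod.dist_eq, max_lt_iff, Real.dist_eq, Real.dist_eq]
        simpa using ⟨h1, h2⟩)
      simpa [not_or] using h3
    obtain ⟨r', hr', hφr⟩ : ∃ r' > 0, ∀ x, |x - x₀| < r' → |μ * φ x| < r / 2 := by
      have h1 : ContinuousAt (fun x => |μ * φ x|) x₀ := by fun_prop
      have h2 := h1.eventually_lt (continuousAt_const (y := r / 2)) (by simpa [hφx₀] using hr)
      obtain ⟨r', hr', hb⟩ := Metric.eventually_nhds_iff.mp h2
      exact ⟨r', hr', fun x hx => hb (by rwa [Real.dist_eq])⟩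
    obtain ⟨x, y, hx, hy0, hy, hφx, hRpos⟩ := hup (min r' (r / 2)) (lt_min hr' (by linarith))
    rw [lt_min_iff] at hx hy
    have hφx : 0 ≤ φ x := hφx
    set ζ₁ : ℂ := x + y * I with hζ₁
    have hζ₁im : 0 < ζ₁.im := by simpa [hζ₁] using hy0
    have hζ₁s : ζ₁ ∈ superlevel c z lam 0 := Or.inl ⟨hζ₁im, Or.inr hRpos⟩
    set G : Set ℂ := g '' (Metric.ball x₀ r ×ˢ Ioo 0 r) with hG
    have hGpre : IsPreconnected G :=
      (((convex_ball x₀ r).prod (convex_Ioo 0 r)).isPreconnected).image _ hgc.continuousOn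
    have hGoff : ∀ w ∈ G, w ∉ E ∧ w ∉ range γ := by
      rintro _ ⟨q, ⟨h1, h2⟩, rfl⟩
      rw [Metric.mem_ball, Real.dist_eq] at h1
      obtain ⟨h3, h4⟩ := hball q h1 (by rw [abs_of_pos h2.1]; exact h2.2)
      exact ⟨h3, hoffr q h4 h2.1.ne'⟩
    have hζ₁G : ζ₁ ∈ G := by
      refine ⟨(x, y + μ * φ x), ⟨?_, ?_, ?_⟩, ?_⟩
      · rw [Metric.mem_ball, Real.dist_eq]; linarith [hx.2]
      · have := mul_nonneg hμ.le hφx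
        simp only
        linarith
      · have := (abs_lt.mp (hφr x hx.1)).2
        simp only
        linarith [hy.2]
      · simp only [hg, hζ₁]
        congr 2
        push_cast
        ring
    obtain ⟨q, hqU, hq⟩ := exists_notRegular_mem_component hA hζ₁s
    -- The region below both the real line and the graph. It joins the lower side to the conjugate
    -- poles, and E avoids it since E lies in the open upper half-plane.
    set B : Set ℂ := (fun q : ℝ × ℝ => (q.1 + (min 0 (-(μ * φ q.1)) + q.2 : ℝ) * I : ℂ)) ''
      (univ ×ˢ Iio 0) with hB
    have hBpre : IsPreconnected B :=
      ((convex_univ.prod (convex_Iio (0 : ℝ))).isPreconnected).image _ (by fun_prop)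
    have hBmem : ∀ w : ℂ, w.im < 0 → w.im < -(μ * φ w.re) → w ∈ B := fun w h1 h2 => by
      refine ⟨(w.re, w.im - min 0 (-(μ * φ w.re))), ⟨mem_univ _, ?_⟩, ?_⟩
      · exact sub_neg.mpr (lt_min h1 h2)
      · simp only [add_sub_cancel]
        exact re_add_im w
    have hBoff : ∀ w ∈ B, w ∉ E ∧ w ∉ range γ := by
      rintro _ ⟨q, ⟨-, h1 : q.2 < 0⟩, rfl⟩
      have hlt : ((q.1 + (min 0 (-(μ * φ q.1)) + q.2 : ℝ) * I : ℂ)).im < min 0 (-(μ * φ q.1)) := by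
        have : ((q.1 + (min 0 (-(μ * φ q.1)) + q.2 : ℝ) * I : ℂ)).im =
          min 0 (-(μ * φ q.1)) + q.2 := by simp
        rw [this]
        linarith
      have hre : ((q.1 + (min 0 (-(μ * φ q.1)) + q.2 : ℝ) * I : ℂ)).re = q.1 := by simp
      rw [lt_min_iff] at hlt
      refine ⟨fun h => absurd (hEpos rfl _ h) (not_lt.mpr hlt.1.le), ?_⟩
      rintro ⟨t, ht⟩
      beta_reduce at ht
      rw [← ht] at hlt hre
      rcases le_total |t| X with h | h
      · obtain ⟨h2, h3⟩ := him t h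
        rw [h2] at hre
        rw [← hre] at hlt
        linarith [hlt.2]
      · linarith [(htail t h).1.1, hlt.1]
    have e1 : ∀ᶠ s in 𝓝 (0 : ℝ), |ψ s| < r :=
      (ContinuousAt.eventually_lt (by fun_prop) continuousAt_const (by simpa [hψ0] using hr))
    have e2 : ∀ᶠ s in 𝓝 (0 : ℝ), |s * (μ * d)| < r :=
      (ContinuousAt.eventually_lt (by fun_prop) continuousAt_const (by simpa using hr))
    rw [eventually_nhdsWithin_iff]
    filter_upwards [hsign, e1, e2] with s h1 h2 h3 hs0
    rw [sub_zero] at h1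
    rcases lt_or_gt_of_ne (show s ≠ 0 from hs0) with hs | hs
    · rw [sign_neg hs, sign_eq_neg_one_iff] at h1
      have p₀ : Fin P := ⟨0, hA.size_pos⟩
      refine ⟨B, hBpre, hBoff, hBmem _ ?_ ?_, conj (z p₀), hBmem _ ?_ ?_, fun h => (h p₀).2 rfl⟩
      · rw [hζ]; simpa using hs
      · rw [hζ]
        simp only [add_im, ofReal_im, mul_im, ofReal_re, I_im, mul_one, I_re, mul_zero, add_zero,
          zero_add, add_re, mul_re, sub_self]
        linarith
      · simpa using hA.im_pos p₀
      · have := (abs_lt.mp (hbd (z p₀).re p₀)).2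
        simpa using this
    · rw [sign_pos hs, sign_eq_one_iff] at h1
      have hUpre := IsPreconnected.union ζ₁ hζ₁G (mem_connectedComponentIn hζ₁s) hGpre
        (isPreconnected_connectedComponentIn (F := superlevel c z lam 0))
      refine ⟨_, hUpre, ?_, Or.inl ⟨(x₀ + s * (μ * d), ψ s), ⟨?_, h1, (abs_lt.mp h2).2⟩, hgψ s⟩, q,
        Or.inr hqU, hq⟩
      · rintro w (hw | hw)
        · exact hGoff w hw
        · have hw' := connectedComponentIn_subset _ _ hw
          refine ⟨fun h => hE w h hw', ?_⟩
          rintro ⟨t, rfl⟩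
          rcases hw' with ⟨-, ⟨p, hp⟩ | h⟩ | ⟨h, -⟩
          · exact (hreg t p).1 hp.symm
          · exact absurd (hle t) (not_le.mpr h)
          · exact lt_irrefl _ h
      · rw [Metric.mem_ball, Real.dist_eq, add_sub_cancel_left]
        exact h3
  · obtain ⟨h1, h2⟩ := hmemS w hw
    exact ⟨hw.1, w.re, by rw [hfix _ h1]; exact h2.symm⟩
  · rintro ⟨hc, t, rfl⟩
    refine ⟨hc, ?_⟩
    rw [hfix t (hcφ t hc)]
    simp
  · obtain ⟨h1, h2⟩ := hmemS w hw
    refine ⟨w.re, by simp only [hfix _ h1]; exact h2.symm, fun t ht => ?_⟩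
    have h3 : φ t = 0 := hcφ t (by rw [ht]; exact hw.1)
    rw [← ht, hfix t h3, ofReal_re]
  · exact ⟨θ t, hθ0 t, hder t (hcφ t ht.1)⟩
  · have h1 : φ t ≠ 0 := fun h => ht (by
      rw [hfix t h]
      exact ⟨(hA.isCritical_ofReal_iff t).mpr h, ofReal_im t⟩)
    rw [R_of_im_eq_zero hA hw.2]
    exact (hcrit t h1).2

/-! ### The matrix N and the assembly of the contours. -/

/-- Contours of all types in the slit domain exist. -/
theorem IsAdmissible.exists_isU (hA : IsAdmissible c z lam) (m : Fin P) : ∃ γ, IsU z m γ := by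
  classical
  obtain ⟨ρ, hρ0, hρ⟩ := exists_strip_width hA
  obtain ⟨a, -, ha⟩ := Order.exists_between_finsets ∅ (Finset.univ.image fun p => (z p).re) (by simp)
  obtain ⟨b, hb1, hb2⟩ := Order.exists_between_finsets
    ((Finset.univ.filter fun p => p ≤ m).image fun p => (z p).re)
    ((Finset.univ.filter fun p => m < p).image fun p => (z p).re) (by
      simp only [Finset.mem_image, Finset.mem_filter, Finset.mem_univ, true_and]
      rintro _ ⟨p, hp, rfl⟩ _ ⟨q, hq, rfl⟩
      exact hA.re_strictMono (hp.trans_lt hq))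
  have ha' : ∀ p, a < (z p).re := fun p => ha _ (by simp)
  have hb1' : ∀ p ≤ m, (z p).re < b := fun p hp => hb1 _ (Finset.mem_image.mpr ⟨p, by simpa using hp, rfl⟩)
  have hb2' : ∀ p > m, b < (z p).re := fun p hp => hb2 _ (Finset.mem_image.mpr ⟨p, by simpa using hp, rfl⟩)
  -- The speed that crosses from a to b at height ρ during [-ρ, ρ], so that the vertical pieces have
  -- height |t|.
  set β : ℂ := (((b - a) / (2 * ρ) : ℝ) : ℂ) with hβ
  set κ : ℂ := (((a + b) / 2 : ℝ) : ℂ) + ρ * I with hκ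
  set γ₁ : ℝ → ℂ := fun t => a + t * (-I) with hγ₁
  set γ₂ : ℝ → ℂ := fun t => κ + t * β with hγ₂
  set γ₃ : ℝ → ℂ := fun t => b + t * I with hγ₃
  have hρ' : (ρ : ℂ) ≠ 0 := ofReal_ne_zero.mpr hρ0.ne'
  have h23 : γ₂ ρ = γ₃ ρ := by
    simp only [hγ₂, hγ₃, hκ, hβ]; push_cast; field_simp; ring
  have h12 : γ₁ (-ρ) = glue ρ γ₂ γ₃ (-ρ) := by
    rw [glue_of_le (by linarith)]
    simp only [hγ₁, hγ₂, hκ, hβ]; push_cast; field_simp; ring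
  obtain ⟨hLip, B, hB⟩ := (isPW_line a (-I)).glue ((isPW_line κ β).glue (isPW_line b I) h23) h12
  have hslit : ∀ w : ℂ, (w.re = a ∨ w.re = b ∨ |w.im| ≤ ρ) → w ∈ slitDomain z := fun w hw p => by
    simp only [mem_slitPlane_iff, mul_re, I_re, sub_re, zero_mul, I_im, sub_im, one_mul, zero_sub,
      mul_im, neg_mul, neg_re, conj_re, conj_im, neg_im, zero_add]
    rcases hw with hw | hw | hw
    · have := ha' p
      exact ⟨Or.inr (by linarith), Or.inr (by linarith)⟩
    · have : b - (z p).re ≠ 0 := by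
        rcases le_or_gt p m with h | h
        · linarith [hb1' p h]
        · linarith [hb2' p h]
      rw [← hw] at this
      exact ⟨Or.inr this, Or.inr fun h => this (by linarith)⟩
    · have := hρ p
      have h2 := abs_le.mp hw
      exact ⟨Or.inl (by linarith), Or.inl (by linarith)⟩
  refine ⟨⟨glue (-ρ) γ₁ (glue ρ γ₂ γ₃), B, a, b, hLip, hB, ρ, fun t ht => ?_, fun t ht => ?_⟩,
    fun t => ?_, ha', hb1', hb2'⟩
  · rw [glue_of_ge h12 (by linarith), glue_of_ge h23 ht]
  · rw [glue_of_le ht]; simp only [hγ₁]; ring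
  · apply hslit
    change (glue (-ρ) γ₁ (glue ρ γ₂ γ₃) t).re = a ∨ (glue (-ρ) γ₁ (glue ρ γ₂ γ₃) t).re = b ∨
      |(glue (-ρ) γ₁ (glue ρ γ₂ γ₃) t).im| ≤ ρ
    rcases le_total t (-ρ) with h | h
    · rw [glue_of_le h]; left; simp [hγ₁]
    · rw [glue_of_ge h12 h]
      rcases le_total t ρ with h' | h'
      · rw [glue_of_le h']; right; right
        simp only [hγ₂, hκ, hβ, add_im, ofReal_im, mul_im, ofReal_re, I_im, I_re, mul_one, mul_zero,
          add_zero, zero_add, zero_mul]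
        exact (abs_of_pos hρ0).le
      · rw [glue_of_ge h23 h']; right; left; simp [hγ₃]

/-- Integration along a contour as a linear functional on test functions. -/
noncomputable def contourFunctional (hA : IsAdmissible c z lam) {ε : ℝ} (hε : 0 < ε) {γ : UContour}
    {H : ℝ → ℂ} (hH : IsPhase c z lam γ H) : testSpace z →ₗ[ℂ] ℂ where
  toFun g := ∫ t, pullback ε γ H g t
  map_add' g₁ g₂ := by
    rw [← integral_add (integrable_pullback hA hε hH g₁.2) (integrable_pullback hA hε hH g₂.2)]
    refine integral_congr_ae (Eventually.of_forall fun t => ?_)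
    simp only [pullback, Submodule.coe_add, Pi.add_apply]
    ring
  map_smul' a g := by
    rw [RingHom.id_apply, smul_eq_mul, ← integral_const_mul]
    refine integral_congr_ae (Eventually.of_forall fun t => ?_)
    simp only [pullback, Submodule.coe_smul, Pi.smul_apply, smul_eq_mul]
    ring

theorem inv_mem_testSpace (p : Fin P) : (fun w => ((w - z p) ^ 1)⁻¹) ∈ testSpace z :=
  inv_pow_mem_testSpace (fun h => (h p).1 rfl) 1

/-- Contours with crossings at different levels are related to contours in the slit domain by an
invertible matrix. -/
theorem exists_isUnit_mul_eq (hA : IsAdmissible c z lam) {ε : ℝ} (hε : 0 < ε)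
    {W : Fin P → UContour} {H : Fin P → ℝ → ℂ} (hH : ∀ m, IsPhase c z lam (W m) (H m))
    {v t₀ : Fin P → ℝ} {θ : Fin P → ℂ} (hW : ∀ m, IsCrossing c z lam (W m) (v m) (t₀ m) (θ m))
    (hlow : ∀ m t p, -(z p).im < (W m t).im) (hv : Function.Injective v) :
    ∃ N : Matrix (Fin P) (Fin P) ℂ, IsUnit N ∧
      ∀ C : Fin P → UContour, (∀ m, IsU z m (C m)) →
        N * matrixA c z lam ε C = contourMatrix z ε W H := by
  choose C₀ hC₀ using hA.exists_isU
  have hphase : ∀ m, IsPhase c z lam (C₀ m) fun t => h c z lam (C₀ m t) := fun m =>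
    isPhase_h (hC₀ m).1
  -- A functional vanishing on the common kernel of finitely many others lies in their span.
  have hspan : ∀ m, contourFunctional hA hε (hH m) ∈
      Submodule.span ℂ (range fun k => contourFunctional hA hε (hphase k)) := fun m => by
    refine mem_span_of_iInf_ker_le_ker fun g hg => ?_
    simp only [Submodule.mem_iInf, LinearMap.mem_ker] at hg ⊢
    exact integral_eq_zero hA hε g.2 hC₀ hg (hH m) (hlow m)
  simp only [Submodule.mem_span_range_iff_exists_fun] at hspan
  choose N hN using hspan
  have hNg : ∀ g ∈ testSpace z, ∀ m, ∑ k, N m k * ∫ t, pullback ε (C₀ k)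
      (fun t => h c z lam (C₀ k t)) g t = ∫ t, pullback ε (W m) (H m) g t := fun g hg m => by
    have := LinearMap.congr_fun (hN m) ⟨g, hg⟩
    simpa [LinearMap.sum_apply, contourFunctional] using this
  refine ⟨Matrix.of N, ?_, fun C hC => ?_⟩
  · rw [Matrix.isUnit_iff_isUnit_det, isUnit_iff_ne_zero]
    intro hdet
    -- A left null vector of N would be a linear relation among the functionals of the `W m`.
    obtain ⟨b, hb, hbN⟩ := Matrix.exists_vecMul_eq_zero_iff.mpr hdet
    refine hb (eq_zero_of_sum_eq_zero hA hε hH hW hv fun g hg => ?_)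
    simp only [← hNg g hg, Finset.mul_sum]
    rw [Finset.sum_comm]
    refine Finset.sum_eq_zero fun k _ => ?_
    have := congrFun hbN k
    simp only [Matrix.vecMul, dotProduct, Matrix.of_apply, Pi.zero_apply] at this
    simp only [← mul_assoc, ← Finset.sum_mul, this, zero_mul]
  · ext m p
    simp only [Matrix.mul_apply, matrixA, contourMatrix, Matrix.of_apply, integrand_eq_pullback]
    rw [← hNg _ (inv_mem_testSpace p) m]
    -- The integrals over `C k` and the reference contour `C₀ k` agree, as both depend only on the
    -- gaps of their ends; so one N serves every choice of `C`.
    obtain ⟨F, hF⟩ := exists_solution_slitDomain (lam := lam) ε hA (inv_mem_testSpace p)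
    obtain ⟨ℓ, hℓ⟩ := exists_limits hA hε (inv_mem_testSpace p) hF
    refine Finset.sum_congr rfl fun k _ => ?_
    rw [integral_eq_of_isU hA hε (inv_mem_testSpace p) hF hℓ (hC k),
      integral_eq_of_isU hA hε (inv_mem_testSpace p) hF hℓ (hC₀ k)]

/-- From critical sets at different levels to suitable contours. -/
theorem exists_suitable_contours (hA : IsAdmissible c z lam) {Q : Fin P} {S : Fin P → Set ℂ}
    {v : Fin P → ℝ} (hv : Function.Injective v)
    (hS : ∀ m, ∃ (γ : UContour) (t₀ : ℝ) (θ : ℂ), IsCrossing c z lam γ (v m) t₀ θ ∧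
      (∀ t p, -(z p).im < (γ t).im) ∧ PassesOver c z lam γ (S m))
    (hdisj : Pairwise fun m n => Disjoint (S m) (S n))
    (hup : ∀ m, m ≠ Q → ∃ w : ℂ, 0 < w.im ∧ S m = {w})
    (hQ : (∃ w : ℂ, 0 < w.im ∧ S Q = {w}) ∨
      (S Q = {w : ℂ | IsCritical c z lam w ∧ w.im = 0} ∧ (S Q).encard ≤ 2 ∧
        ∀ w ∈ S Q, R c z lam w = 0)) :
    ∃ (W : Fin P → UContour) (H : Fin P → ℝ → ℂ),
      (∀ m, IsBranchAlong c z lam (W m) (H m)) ∧ IsSuitable c z lam Q W ∧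
      ∀ ε : ℝ, 0 < ε → (∀ m p, Integrable (integrand z ε (W m) (H m) p)) ∧
        ∃ N : Matrix (Fin P) (Fin P) ℂ, IsUnit N ∧
          ∀ C : Fin P → UContour, (∀ m, IsU z m (C m)) →
            N * matrixA c z lam ε C = contourMatrix z ε W H := by
  choose W t₀ θ hW hlow hpass using hS
  choose H hH using fun m => exists_isBranchAlong (c := c) (lam := lam) (hW m).regular
  refine ⟨W, H, hH, ⟨S, hpass, hdisj, hup, hQ⟩, fun ε hε => ⟨fun m p => ?_,
    exists_isUnit_mul_eq hA hε (fun m => (hH m).isPhase hA) hW hlow hv⟩⟩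
  rw [integrand_eq_pullback]
  exact integrable_pullback hA hε ((hH m).isPhase hA) (inv_mem_testSpace p)

theorem encard_real_critical_le (hA : IsAdmissible c z lam) (hs : RealSigns c z lam) :
    {w : ℂ | IsCritical c z lam w ∧ w.im = 0}.encard ≤ 2 := by
  have hsub : ∃ x₁ x₂ : ℝ, ∀ x, lam + u0Real c z x = 0 → x = x₁ ∨ x = x₂ := by
    rcases hs with h | ⟨x₀, -, h, -, -⟩ | ⟨x₁, x₂, -, -, -, hl, hr, hm, -, -⟩
    · exact ⟨0, 0, fun x hx => absurd hx (h x).ne⟩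
    · exact ⟨x₀, x₀, fun x hx => Or.inl (not_not.mp fun hne => (h x hne).ne hx)⟩
    · refine ⟨x₁, x₂, fun x hx => ?_⟩
      rcases lt_trichotomy x x₁ with h | h | h
      · exact absurd hx (hl x h).ne
      · exact Or.inl h
      · rcases lt_trichotomy x x₂ with h' | h' | h'
        · exact absurd hx (hm x h h').ne'
        · exact Or.inr h'
        · exact absurd hx (hr x h').ne
  obtain ⟨x₁, x₂, hx⟩ := hsub
  refine (encard_le_encard (t := {(x₁ : ℂ), (x₂ : ℂ)}) fun w hw => ?_).trans (encard_insert_le _ _ |>.trans (by rw [encard_singleton]; norm_num))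
  have h1 : w = w.re := by apply Complex.ext <;> simp [hw.2]
  have h2 := hw.1
  rw [h1, hA.isCritical_ofReal_iff] at h2
  rw [h1]
  rcases hx _ h2 with h | h <;> simp [h]

end Data

end BenjaminOno

theorem mainTheorem8 {P : ℕ} (c z : Fin P → ℂ) (lam : ℝ)
    (hKS : BenjaminOno.IsRationalKlausShaw c z)
    (hpos : ∀ x : ℝ, 0 < BenjaminOno.u0Real c z x)
    (hc : ∀ p, (c p).re = 0 ∧ (c p).im < 0)
    (hlam : lam < 0)
    (hsimple : ∀ w : ℂ, BenjaminOno.IsCritical c z lam w → 0 < w.im →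
      deriv (BenjaminOno.u0 c z) w ≠ 0)
    (hnonzero : ∀ w : ℂ, BenjaminOno.IsCritical c z lam w → 0 < w.im →
      BenjaminOno.R c z lam w ≠ 0)
    (hdistinct : ∀ w w' : ℂ, BenjaminOno.IsCritical c z lam w → 0 < w.im →
      BenjaminOno.IsCritical c z lam w' → 0 < w'.im →
      BenjaminOno.R c z lam w = BenjaminOno.R c z lam w' → w = w')
    (hedge : ∀ x : ℝ, deriv (BenjaminOno.u0Real c z) x = 0 →
      lam = -BenjaminOno.u0Real c z x → deriv (deriv (BenjaminOno.u0Real c z)) x ≠ 0) :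
    ∃ (Q : Fin P) (W : Fin P → BenjaminOno.UContour) (H : Fin P → ℝ → ℂ),
      (∀ m, BenjaminOno.IsBranchAlong c z lam (W m) (H m)) ∧
      BenjaminOno.IsSuitable c z lam Q W ∧
      ∀ ε : ℝ, 0 < ε →
        (∀ m p, MeasureTheory.Integrable (BenjaminOno.integrand z ε (W m) (H m) p)) ∧
        ∃ N : Matrix (Fin P) (Fin P) ℂ, IsUnit N ∧
          ∀ C : Fin P → BenjaminOno.UContour, (∀ m, BenjaminOno.IsU z m (C m)) →
            N * BenjaminOno.matrixA c z lam ε C = BenjaminOno.contourMatrix z ε W H := by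
  classical
  have hP : 0 < P := by
    rcases Nat.eq_zero_or_pos P with rfl | h
    · exact absurd (hpos 0) (by simp [BenjaminOno.u0Real, BenjaminOno.u0])
    · exact h
  have hA : BenjaminOno.IsAdmissible c z lam :=
    ⟨hc, hKS.pole_im_pos, hKS.pole_re_strictMono, hlam, hP⟩
  have hs := BenjaminOno.realSigns hA hKS hpos hedge
  have hcard := BenjaminOno.le_card_critical hA hs hsimple
  set A : Set ℂ := {w | BenjaminOno.IsCritical c z lam w ∧ 0 < w.im} with hAdef
  have hAfin : A.Finite := hA.finite_isCritical.subset fun w hw => hw.1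
  have : Fintype A := hAfin.fintype
  have hncard : A.ncard = Fintype.card A := by rw [← Nat.card_eq_fintype_card]; rfl
  have hlowpos : ∀ γ : BenjaminOno.UContour, (∀ t, 0 < (γ t).im) →
      ∀ t p, -(z p).im < (γ t).im := fun γ h t p => by linarith [h t, hA.im_pos p]
  have hupper : ∀ w ∈ A, ∃ (γ : BenjaminOno.UContour) (t₀ : ℝ) (θ : ℂ),
      BenjaminOno.IsCrossing c z lam γ (BenjaminOno.R c z lam w) t₀ θ ∧
      (∀ t p, -(z p).im < (γ t).im) ∧ BenjaminOno.PassesOver c z lam γ {w} := fun w hw => by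
    obtain ⟨γ, θ, h1, h2, h3⟩ := BenjaminOno.exists_upper_crossing hA hw.1 hw.2 (hsimple w hw.1 hw.2)
    exact ⟨γ, 0, θ, h1, hlowpos γ h2, h3⟩
  have hinj : ∀ w ∈ A, ∀ w' ∈ A, BenjaminOno.R c z lam w = BenjaminOno.R c z lam w' → w = w' :=
    fun w hw w' hw' => hdistinct w w' hw.1 hw.2 hw'.1 hw'.2
  let Q : Fin P := ⟨0, hP⟩
  refine ⟨Q, ?_⟩
  -- With P upper critical points no real contour is needed. Otherwise there are at least P - 1, and
  -- index Q takes the real ones at level 0, which is distinct from the other levels because these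
  -- are nonzero.
  rcases le_or_gt P A.ncard with hle | hlt
  · have hemb : Nonempty (Fin P ↪ A) := by
      rw [Function.Embedding.nonempty_iff_card_le, Fintype.card_fin, ← hncard]
      exact hle
    obtain ⟨e⟩ := hemb
    have he : ∀ m n, (e m : ℂ) = e n → m = n := fun m n h => e.injective (Subtype.ext h)
    exact BenjaminOno.exists_suitable_contours hA (S := fun m => {(e m : ℂ)})
      (v := fun m => BenjaminOno.R c z lam (e m))
      (fun m n h => he m n (hinj _ (e m).2 _ (e n).2 h)) (fun m => hupper _ (e m).2)
      (fun m n hmn => Set.disjoint_singleton.mpr fun h => hmn (he m n h))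
      (fun m _ => ⟨e m, (e m).2.2, rfl⟩) (Or.inl ⟨e Q, (e Q).2.2, rfl⟩)
  · have hex : ∃ x : ℝ, lam + BenjaminOno.u0Real c z x = 0 := by
      by_contra hno
      rw [if_neg hno] at hcard
      omega
    rw [if_pos hex] at hcard
    have hemb : Nonempty ({m : Fin P | m ≠ Q} ↪ A) := by
      rw [Function.Embedding.nonempty_iff_card_le, Set.card_ne_eq, Fintype.card_fin, ← hncard]
      omega
    obtain ⟨e⟩ := hemb
    have he : ∀ m n (hm : m ≠ Q) (hn : n ≠ Q), (e ⟨m, hm⟩ : ℂ) = e ⟨n, hn⟩ → m = n :=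
      fun m n hm hn h => congrArg Subtype.val (e.injective (Subtype.ext h))
    refine BenjaminOno.exists_suitable_contours hA
      (S := fun m => if hm : m = Q then {w | BenjaminOno.IsCritical c z lam w ∧ w.im = 0} else
        {(e ⟨m, hm⟩ : ℂ)})
      (v := fun m => if hm : m = Q then 0 else BenjaminOno.R c z lam (e ⟨m, hm⟩))
      (fun m n h => ?_) (fun m => ?_) (fun m n hmn => ?_) (fun m hm => ?_) (Or.inr ?_)
    · by_cases hm : m = Q <;> by_cases hn : n = Q
      · exact hm.trans hn.symm
      · simp only [hm, hn, dif_pos, dif_neg, not_false_eq_true] at h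
        exact absurd h.symm (hnonzero _ (e ⟨n, hn⟩).2.1 (e ⟨n, hn⟩).2.2)
      · simp only [hm, hn, dif_pos, dif_neg, not_false_eq_true] at h
        exact absurd h (hnonzero _ (e ⟨m, hm⟩).2.1 (e ⟨m, hm⟩).2.2)
      · simp only [hm, hn, dif_neg, not_false_eq_true] at h
        exact he m n hm hn (hinj _ (e ⟨m, hm⟩).2 _ (e ⟨n, hn⟩).2 h)
    · by_cases hm : m = Q
      · simp only [hm, dif_pos]
        exact BenjaminOno.exists_real_crossing hA hs hex
      · simp only [hm, dif_neg, not_false_eq_true]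
        exact hupper _ (e ⟨m, hm⟩).2
    · by_cases hm : m = Q <;> by_cases hn : n = Q
      · exact absurd (hm.trans hn.symm) hmn
      · simp only [hm, hn, dif_pos, dif_neg, not_false_eq_true]
        exact Set.disjoint_singleton_right.mpr fun h => (e ⟨n, hn⟩).2.2.ne' h.2
      · simp only [hm, hn, dif_pos, dif_neg, not_false_eq_true]
        exact Set.disjoint_singleton_left.mpr fun h => (e ⟨m, hm⟩).2.2.ne' h.2
      · simp only [hm, hn, dif_neg, not_false_eq_true]
        exact Set.disjoint_singleton.mpr fun h => hmn (he m n hm hn h)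
    · simp only [hm, dif_neg, not_false_eq_true]
      exact ⟨_, (e ⟨m, hm⟩).2.2, rfl⟩
    · simp only [dif_pos]
      exact ⟨trivial, BenjaminOno.encard_real_critical_le hA hs,
        fun w hw => BenjaminOno.R_of_im_eq_zero hA hw.2⟩
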